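/- Let $S$ be an oriented pair of pants with boundary components $A_1,A_2,A_3$ (indices modulo $3$), each oriented by the opposite of the boundary orientation, and split the interior of $S$ (a three-punctured sphere whose puncture $p_i$ corresponds to $A_i$) into two ideal triangles $T_+,T_-$ along disjoint lines $B_1,B_2,B_3$, where $B_i$ is oriented from $p_{i-1}$ to $p_{i+1}$ and $p_1,p_2,p_3$ occur clockwise in this order around $T_+$. Consider a convex real projective structure on $S$ with geodesic boundary and hyperbolic boundary monodromy, with developing map $\mathrm{dev}$ from the universal cover $\widetilde S$ to a convex domain in $\mathbb{RP}^2$ and monodromy $\rho\colon\pi_1(S)\to \mathrm{SL}_3(\mathbb R)$; hyperbolic means that $\rho(A_i)$ has eigenvalues $0<\lambda_i<\mu_i<\nu_i$. Put $\tau_i=\mu_i+\nu_i$. Choose a lift $\widetilde T_+$ of $T_+$ to $\widetilde S$ and represent the boundary components by $A_1,A_2,A_3\in\pi_1(S)$ that fix its three vertices; let $\widetilde T_i$ be the lift of $T_-$ touching $\widetilde T_+$ along the side corresponding to $B_i$, and let $A_i'\in\pi_1(S)$ be the conjugate of $A_i$ that fixes the vertex of $\widetilde T_i$ that is not a vertex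 of $\widetilde T_+$. Goldman parameters. In a basis of $\mathbb R^3$ where the repelling fixed points of $\rho(A_1),\rho(A_2),\rho(A_3)$ (the eigenspaces of the $\lambda_i$) are $[1,0,0],[0,1,0],[0,0,1]$ and where those of $\rho(A_1'),\rho(A_2'),\rho(A_3')$ are $[-1,b_1,c_1],[a_2,-1,c_2],[a_3,b_3,-1]$ with all $a_i,b_i,c_i>0$, the internal parameters $s,t>0$ are defined by $t=a_2b_3/a_3$ and $$b_3c_2=1+\tau_1\sqrt{\tfrac{\lambda_1\lambda_3}{\lambda_2}}\,s+\tfrac{\lambda_3}{\lambda_2}s^2,\quad a_3c_1=1+\tau_2\sqrt{\tfrac{\lambda_1\lambda_2}{\lambda_3}}\,s+\tfrac{\lambda_1}{\lambda_3}s^2,\quad a_2b_1=1+\tau_3\sqrt{\tfrac{\lambda_2\lambda_3}{\lambda_1}}\,s+\tfrac{\lambda_2}{\lambda_1}s^2 .$$ Fock-Goncharov coordinates. The unstable flag $F$ of a hyperbolic matrix consists of the line $F^{(1)}$, the eigenspace of the lowest eigenvalue, and of the plane $F^{(2)}$ spanned by the eigenspaces of the two lowest eigenvalues. Let $F_i$,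 $F_i'$ be the unstable flags of $\rho(A_i)$, $\rho(A_i')$, and let $f_i^{(a)}\in\Lambda^a(F_i^{(a)})$, $f_i^{\prime(a)}\in\Lambda^a(F_i^{\prime(a)})$ be arbitrary non-zero elements. Then $$\sigma_1(B_i)=\log\Bigl(-\frac{f_{i+1}^{(1)}\wedge f_{i-1}^{(1)}\wedge f_i^{(1)}}{f_{i+1}^{(1)}\wedge f_{i-1}^{(1)}\wedge f_i^{\prime(1)}}\,\frac{f_{i-1}^{(2)}\wedge f_i^{\prime(1)}}{f_{i-1}^{(2)}\wedge f_i^{(1)}}\Bigr),\qquad \sigma_2(B_i)=\log\Bigl(-\frac{f_{i+1}^{(1)}\wedge f_{i-1}^{(1)}\wedge f_i^{\prime(1)}}{f_{i+1}^{(1)}\wedge f_{i-1}^{(1)}\wedge f_i^{(1)}}\,\frac{f_{i+1}^{(2)}\wedge f_i^{(1)}}{f_{i+1}^{(2)}\wedge f_i^{\prime(1)}}\Bigr),$$ and $\tau_{111}(T_+)=\log X(F_1,F_2,F_3)$, $\tau_{111}(T_-)=\log X(F_1',F_3,F_2)$, where $$X(E,F,G)=\frac{e^{(2)}\wedge f^{(1)}}{f^{(1)}\wedge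 g^{(2)}}\,\frac{e^{(1)}\wedge g^{(2)}}{e^{(1)}\wedge f^{(2)}}\,\frac{f^{(2)}\wedge g^{(1)}}{e^{(2)}\wedge g^{(1)}}$$ for arbitrary non-zero $e^{(a)}\in\Lambda^a(E^{(a)})$, $f^{(a)}\in\Lambda^a(F^{(a)})$, $g^{(a)}\in\Lambda^a(G^{(a)})$. Both coordinate systems are well defined (the Goldman parameters exist, and the quantities inside the logarithms are positive), and the Fock-Goncharov coordinates are expressed in terms of the Goldman parameters $\lambda_i,\tau_i,s,t$ as follows. For $i=1,2,3$, $$\sigma_1(B_i)=\log\Bigl(s\,\mu_{i-1}\sqrt{\tfrac{\lambda_{i-1}\lambda_{i+1}}{\lambda_i}}\Bigr),\qquad \sigma_2(B_i)=\log\Bigl(\frac{\mu_{i+1}}{s}\sqrt{\tfrac{\lambda_{i-1}\lambda_{i+1}}{\lambda_i}}\Bigr),\qquad\text{where } \mu_i=\frac{\tau_i-\sqrt{\tau_i^2-4/\lambda_i}}{2},$$ and $$\tau_{111}(T_+)=\log\frac{(e^{-\sigma_2(B_2)}+1)(e^{-\sigma_2(B_3)}+1)}{t\,(e^{\sigma_1(B_3)}+1)},\qquad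 \tau_{111}(T_-)=\log\frac{t\,(e^{\sigma_1(B_3)}+1)}{\mu_1\mu_2\mu_3\,(e^{-\sigma_2(B_2)}+1)(e^{-\sigma_2(B_3)}+1)} .$$ -/

import Mathlib

open scoped MatrixGroups LinearAlgebra.Projectivization UpperHalfPlane

noncomputable section

namespace Pants

/-- The real vector space underlying the projective plane `RP²`. -/
abbrev V : Type := Fin 3 → ℝ

/-- The real projective plane. -/
abbrev RP2 : Type := ℙ ℝ V

/-- The quotient topology on the real projective plane. -/
instance : TopologicalSpace RP2 :=
  TopologicalSpace.coinduced
    (fun v : {v : V // v ≠ 0} => Projectivization.mk ℝ v.1 v.2) inferInstance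

/-! ### The pair of pants

The interior of the pair of pants is the three-punctured sphere `ℍ / Γ(2)`; the pair of pants `S`
itself is obtained by cutting off the cusps along horocycles. Its universal cover is therefore the
upper half-plane with disjoint open horodisks removed, one at each point of `ℚ ∪ {∞}`, and
`π₁(S) = Γ(2) / {±1}`. -/

/-- The principal congruence subgroup `Γ(2)`; the fundamental group of the pair of pants is
`Γ(2) / {±1}`. -/
abbrev Γ : Subgroup SL(2, ℤ) := CongruenceSubgroup.Gamma 2

/-- The universal cover of the pair of pants `S`, as a `Γ(2)`-invariant subset of `ℍ`. -/
def Cover : SubMulAction Γ ℍ where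
  carrier := {z | ∀ h : SL(2, ℤ), (h • z).im ≤ 2}
  smul_mem' := by
    intro g z hz h
    have := hz (h * g.1)
    rwa [mul_smul] at this

/-- The boundary component of the universal cover which runs along the horocycle centred at the
point `h⁻¹ ∞` of `ℚ ∪ {∞}`. -/
def boundaryComponent (h : SL(2, ℤ)) : Set Cover := {z | (h • (z : ℍ)).im = 2}

/-- The interior of the universal cover. -/
def coverInterior : Set Cover := {z | ∀ h : SL(2, ℤ), (h • (z : ℍ)).im < 2}

/-- The classes `A₁, A₂, A₃` of the boundary components (indices are modulo `3`, so that `0` stands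
for `3`), oriented by the opposite of the boundary orientation. The ideal triangle with vertices
`∞, 1, 0` (in this clockwise order) is a lift of `T₊`, and `A₁, A₂, A₃` fix its vertices
`∞, 1, 0`, respectively. They satisfy `A₃ A₂ A₁ = 1` up to sign. -/
def bdry : Fin 3 → Γ
  | 1 => ⟨⟨!![1, 2; 0, 1], by simp [Matrix.det_fin_two]⟩,
      CongruenceSubgroup.Gamma_mem.2 (by refine ⟨?_, ?_, ?_, ?_⟩ <;> decide)⟩
  | 2 => ⟨⟨!![-1, 2; -2, 3], by simp [Matrix.det_fin_two]⟩,
      CongruenceSubgroup.Gamma_mem.2 (by refine ⟨?_, ?_, ?_, ?_⟩ <;> decide)⟩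
  | 0 => ⟨⟨!![1, 0; -2, 1], by simp [Matrix.det_fin_two]⟩,
      CongruenceSubgroup.Gamma_mem.2 (by refine ⟨?_, ?_, ?_, ?_⟩ <;> decide)⟩

/-- Let `T̃ᵢ` be the lift of `T₋` which touches the chosen lift `T̃₊` of `T₊` along the side that
corresponds to `Bᵢ` (the side opposite to the vertex fixed by `Aᵢ`). Its vertex that is not on
this side is the image under `A_{i+1}` of the vertex of `T̃₊` fixed by `Aᵢ`; this is the boundary
class that fixes it, a conjugate of `Aᵢ`. -/
def bdry' (i : Fin 3) : Γ := bdry (i + 1) * bdry i * (bdry (i + 1))⁻¹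

/-- `l < m < n` are the eigenvalues of `M`, and they are positive. -/
def HasSpectrum (M : SL(3, ℝ)) (l m n : ℝ) : Prop :=
  0 < l ∧ l < m ∧ m < n ∧
    Module.End.HasEigenvalue (Matrix.toLin' M.1) l ∧
    Module.End.HasEigenvalue (Matrix.toLin' M.1) m ∧
    Module.End.HasEigenvalue (Matrix.toLin' M.1) n

/-- A convex projective structure on the pair of pants with geodesic boundary and hyperbolic
boundary monodromy, given by its developing map and its monodromy homomorphism. -/
structure ConvexProjectiveStructure where
  /-- the developing map -/
  dev : Cover → RP2
  /-- the monodromy homomorphism -/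
  hol : Γ →* SL(3, ℝ)
  /-- the developing map is a homeomorphism onto its image, -/
  isEmbedding_dev : Topology.IsEmbedding dev
  /-- it is equivariant, -/
  equivariant : ∀ (g : Γ) (z : Cover),
    (dev (g • z)).submodule = (dev z).submodule.map (Matrix.toLin' (hol g).1)
  /-- its image is contained in an affine chart `{ℓ = 1}`, and convex there, -/
  convex : ∃ ℓ : V →ₗ[ℝ] ℝ,
    (∀ z, ∀ v ∈ (dev z).submodule, v ≠ 0 → ℓ v ≠ 0) ∧
    Convex ℝ {v : V | ℓ v = 1 ∧ ∃ z, v ∈ (dev z).submodule}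
  /-- it is open on the interior (so that it gives local charts), -/
  isOpen_interior : IsOpen (dev '' coverInterior)
  /-- and it sends each boundary component into a projective line `{f = 0}` which is disjoint
  from the image of the interior. -/
  geodesic_boundary : ∀ h : SL(2, ℤ), ∃ f : V →ₗ[ℝ] ℝ, f ≠ 0 ∧
    (∀ z ∈ boundaryComponent h, ∀ v ∈ (dev z).submodule, f v = 0) ∧
    (∀ z ∈ coverInterior, ∀ v ∈ (dev z).submodule, v ≠ 0 → f v ≠ 0)
  /-- The monodromy of each boundary component is hyperbolic. -/
  hyperbolic_boundary : ∀ i, ∃ l m n, HasSpectrum (hol (bdry i)) l m n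

/-- The eigenspace of `M` for the eigenvalue `x`. -/
abbrev eigenspace (M : SL(3, ℝ)) (x : ℝ) : Submodule ℝ V :=
  Module.End.eigenspace (Matrix.toLin' M.1) x

/-- `lam`, `tau`, `s`, `t` are the Goldman parameters of `π`. Here `v 1, v 2, v 3` is the basis of
`ℝ³` in which the vertices of `Δ₊` (the repelling fixed points of the monodromies of
`A₁, A₂, A₃`) are `[1,0,0], [0,1,0], [0,0,1]`, and the remaining vertices of `Δ₁, Δ₂, Δ₃` are
`[-1, b₁, c₁], [a₂, -1, c₂], [a₃, b₃, -1]` in this basis. -/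
structure IsGoldman (π : ConvexProjectiveStructure) (lam tau : Fin 3 → ℝ) (s t : ℝ) : Prop where
  spectrum : ∀ i, ∃ m n, HasSpectrum (π.hol (bdry i)) (lam i) m n ∧ tau i = m + n
  s_pos : 0 < s
  internal : ∃ (v : Fin 3 → V) (b₁ c₁ a₂ c₂ a₃ b₃ : ℝ),
    LinearIndependent ℝ v ∧ (∀ i, v i ∈ eigenspace (π.hol (bdry i)) (lam i)) ∧
    (0 < b₁ ∧ 0 < c₁ ∧ 0 < a₂ ∧ 0 < c₂ ∧ 0 < a₃ ∧ 0 < b₃) ∧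
    -v 1 + b₁ • v 2 + c₁ • v 3 ∈ eigenspace (π.hol (bdry' 1)) (lam 1) ∧
    a₂ • v 1 - v 2 + c₂ • v 3 ∈ eigenspace (π.hol (bdry' 2)) (lam 2) ∧
    a₃ • v 1 + b₃ • v 2 - v 3 ∈ eigenspace (π.hol (bdry' 3)) (lam 3) ∧
    t = a₂ * b₃ / a₃ ∧
    b₃ * c₂ = 1 + tau 1 * √(lam 1 * lam 3 / lam 2) * s + lam 3 / lam 2 * s ^ 2 ∧
    a₃ * c₁ = 1 + tau 2 * √(lam 1 * lam 2 / lam 3) * s + lam 1 / lam 3 * s ^ 2 ∧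
    a₂ * b₁ = 1 + tau 3 * √(lam 2 * lam 3 / lam 1) * s + lam 2 / lam 1 * s ^ 2

/-- With `F` the unstable flag of `M` (its line is the eigenspace of the lowest eigenvalue, and its
plane is spanned by the eigenspaces of the two lowest ones), `f` spans the line `F⁽¹⁾`, and `f, k`
span the plane `F⁽²⁾`. We then use `f⁽¹⁾ = f` and `f⁽²⁾ = f ∧ k`; all non-zero elements of the lines
`Λ¹(F⁽¹⁾)` and `Λ²(F⁽²⁾)` are obtained in this way. -/
def SpansUnstableFlag (M : SL(3, ℝ)) (f k : V) : Prop :=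
  ∃ l m n, HasSpectrum M l m n ∧
    Submodule.span ℝ {f} = eigenspace M l ∧
    Submodule.span ℝ {f, k} = eigenspace M l ⊔ eigenspace M m

/-- The element `u ∧ v ∧ w` of `Λ³(ℝ³) = ℝ`. -/
def wedge (u v w : V) : ℝ := (Matrix.of ![u, v, w]).det

/-- The triple ratio whose logarithm is the triangle invariant of a triangle, with flags at the
vertices `x, y, z` (in clockwise order) represented by `f` and `k`. Moving a vector past a
2-vector does not change the sign of the wedge product. -/
def tripleRatio (f₁ k₁ f₂ k₂ f₃ k₃ : V) : ℝ :=
  wedge f₁ k₁ f₂ / wedge f₂ f₃ k₃ * (wedge f₁ f₃ k₃ / wedge f₁ f₂ k₂) *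
    (wedge f₂ k₂ f₃ / wedge f₁ k₁ f₃)

/-- The double ratio whose logarithm is `σ₁` of an oriented line. Here `fp`, `fn` and `f`, `f'`
span the lines of the flags at the positive and negative endpoints and at the third vertices of the
adjacent lifts of `T₊` and `T₋`, and `fn, kn` span the plane at the negative endpoint. -/
def doubleRatio₁ (fp fn kn f f' : V) : ℝ :=
  -(wedge fp fn f / wedge fp fn f' * (wedge fn kn f' / wedge fn kn f))

/-- The double ratio whose logarithm is `σ₂` of an oriented line; same conventions, with
`fp, kp` spanning the plane at the positive endpoint. -/
def doubleRatio₂ (fp kp fn f f' : V) : ℝ :=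
  -(wedge fp fn f' / wedge fp fn f * (wedge fp kp f / wedge fp kp f'))

/-- `σ₁ i = σ₁(Bᵢ)`, `σ₂ i = σ₂(Bᵢ)`, `τp = τ₁₁₁(T₊)` and `τm = τ₁₁₁(T₋)` are the Fock-Goncharov
coordinates of `π`: for all choices of vectors representing the flags, the ratios are positive and
the coordinates are their logarithms. The line `Bᵢ` is oriented from `A_{i-1}` to `A_{i+1}`. For
`T₋` we use the lift `T̃₁`, whose vertices are fixed by `bdry' 1`, `bdry 2`, `bdry 3` and occur
counterclockwise in this order. -/
def IsFockGoncharov (π : ConvexProjectiveStructure) (σ₁ σ₂ : Fin 3 → ℝ) (τp τm : ℝ) : Prop :=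
  ∀ f k f' k' : Fin 3 → V,
    (∀ i, SpansUnstableFlag (π.hol (bdry i)) (f i) (k i)) →
    (∀ i, SpansUnstableFlag (π.hol (bdry' i)) (f' i) (k' i)) →
    (∀ i, 0 < doubleRatio₁ (f (i + 1)) (f (i - 1)) (k (i - 1)) (f i) (f' i) ∧
      σ₁ i = Real.log (doubleRatio₁ (f (i + 1)) (f (i - 1)) (k (i - 1)) (f i) (f' i))) ∧
    (∀ i, 0 < doubleRatio₂ (f (i + 1)) (k (i + 1)) (f (i - 1)) (f i) (f' i) ∧
      σ₂ i = Real.log (doubleRatio₂ (f (i + 1)) (k (i + 1)) (f (i - 1)) (f i) (f' i))) ∧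
    (0 < tripleRatio (f 1) (k 1) (f 2) (k 2) (f 3) (k 3) ∧
      τp = Real.log (tripleRatio (f 1) (k 1) (f 2) (k 2) (f 3) (k 3))) ∧
    (0 < tripleRatio (f' 1) (k' 1) (f 3) (k 3) (f 2) (k 2) ∧
      τm = Real.log (tripleRatio (f' 1) (k' 1) (f 3) (k 3) (f 2) (k 2)))

end Pants

end

/-! Both coordinate systems are read off from one normal form. Let `v i` span the repelling fixed
point of `Aᵢ`. By convexity, `A_{i+1} vᵢ = x_{i+1} (-vᵢ + yᵢ v_{i+1} + zᵢ v_{i+2})` with all `x`,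
`y`, `z` positive (`NormalForm`). Together with `A_{i+2} A_{i+1} Aᵢ = ±1` this gives `Aᵢ` on three
vectors, so a left eigenvector of `Aᵢ` with eigenvalue `κ ≠ λᵢ` forces a quadratic equation on `κ`
with coefficients in `x`, `y`, `z`, `λ`. Its roots are `μᵢ` and `νᵢ`. Vieta and `λᵢ μᵢ νᵢ = 1` yield
`λᵢ xᵢ = λ_{i+1} x_{i+2}` and `z_{i+2} y_{i+1} = 1 + (μᵢ + νᵢ)/xᵢ + 1/(λᵢ xᵢ²)`
(`NormalForm.relations`). The first relation makes `xᵢ √(λᵢ λ_{i+2} / λ_{i+1})` independent of `i`;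
its inverse is `s`, and the second relation becomes Goldman's three equations.

The plane of an unstable flag is the kernel of the left eigenvector for `νᵢ`, whose values at the
vertices follow from the same equations. Hence `σ₁`, `σ₂` are the logarithms of `μ/x` and `x/ν`, and
the triple ratios are products of the factors `1 + νᵢ/xᵢ` and `zᵢ`
(`NormalForm.isFockGoncharov_iff`). Eliminating one factor by `(1 + ν₂/x₂)(1 + μ₂/x₂) = z₁ y₃`
brings in `t` and gives the stated formulas.

The geometric work lies in the signs (`exists_vertices`). Each boundary component has a supporting
functional that vanishes on it and is positive on the rest of the image. Iterating the hyperbolic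
monodromies transports such inequalities to the fixed points. The boundary segment need not join the
repelling to the attracting fixed point, so its line is replaced by the principal line through these
two points, and `Frame.η_r_pos` shows that the repelling fixed points at all other cusps lie
strictly on one side of it. This leaves exactly one negative coordinate for each new vertex. That it
is the expected one follows from invariance of volume and from a parity argument around the three
cusps. -/

noncomputable section

/-! ### Cusps, horocycles and collars in the universal cover. -/

namespace Pants

/-- The cusps `h⁻¹ ∞` and `h'⁻¹ ∞` are different. -/
def CuspNe (h h' : SL(2, ℤ)) : Prop := (h' * h⁻¹) 1 0 ≠ 0

lemma CuspNe.symm {h h' : SL(2, ℤ)} (H : CuspNe h h') : CuspNe h' h := by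
  unfold CuspNe at *
  have : h * h'⁻¹ = (h' * h⁻¹)⁻¹ := by group
  rw [this, Matrix.SpecialLinearGroup.SL2_inv_expl]
  simpa using H

lemma CuspNe.mul_right {h h' : SL(2, ℤ)} (H : CuspNe h h') (g : SL(2, ℤ)) :
    CuspNe (h * g) (h' * g) := by
  unfold CuspNe at *
  have : h' * g * (h * g)⁻¹ = h' * h⁻¹ := by group
  rwa [this]

/-- `Im (h z) = Im z / |c z + d|²`, and `|c z + d|² ≥ (c Im z)² ≥ (Im z)²` for an integer `c ≠ 0`.
-/
lemma im_smul_mul_im_le {h : SL(2, ℤ)} (hc : h 1 0 ≠ 0) (z : ℍ) : (h • z).im * z.im ≤ 1 := by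
  have h1 := UpperHalfPlane.c_mul_im_sq_le_normSq_denom (h : GL (Fin 2) ℝ) z
  have hpos : 0 < Complex.normSq (UpperHalfPlane.denom (h : GL (Fin 2) ℝ) z) :=
    UpperHalfPlane.normSq_denom_pos _ z.im_ne_zero
  rw [ModularGroup.im_smul_eq_div_normSq, div_mul_eq_mul_div, div_le_one hpos]
  refine le_trans ?_ h1
  have h2 : (1 : ℝ) ≤ ((h 1 0 : ℤ) : ℝ) ^ 2 := by
    have : (1 : ℤ) ≤ (h 1 0) ^ 2 := by
      have := sq_pos_of_ne_zero hc
      lia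
    exact_mod_cast this
  have h3 : ((h : GL (Fin 2) ℝ) 1 0 : ℝ) = ((h 1 0 : ℤ) : ℝ) := rfl
  rw [h3, mul_pow]
  nlinarith [sq_nonneg z.im]

lemma im_smul_of_lower_eq_zero {h : SL(2, ℤ)} (hc : h 1 0 = 0) (z : ℍ) : (h • z).im = z.im := by
  obtain ⟨n, hn⟩ := ModularGroup.exists_eq_T_zpow_of_c_eq_zero hc
  rw [hn, ModularGroup.im_T_zpow_smul]

lemma im_smul_of_not_cuspNe {h h' : SL(2, ℤ)} (H : ¬ CuspNe h h') (z : ℍ) :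
    (h' • z).im = (h • z).im := by
  have h1 := im_smul_of_lower_eq_zero (not_not.1 H) (h • z)
  rwa [← mul_smul, inv_mul_cancel_right] at h1

lemma im_smul_mul_im_smul_le {h h' : SL(2, ℤ)} (H : CuspNe h h') (z : ℍ) :
    (h' • z).im * (h • z).im ≤ 1 := by
  have h1 := im_smul_mul_im_le H (h • z)
  rwa [← mul_smul, inv_mul_cancel_right] at h1

/-- The horodisks of height `1` at different cusps are disjoint. Since `S` is cut off at height `2`,
this leaves room for collars. -/
lemma im_smul_lt_one {h h' : SL(2, ℤ)} (H : CuspNe h h') {z : ℍ} (hz : 1 < (h • z).im) :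
    (h' • z).im < 1 := by
  nlinarith [im_smul_mul_im_smul_le H z, (h' • z).im_pos]

lemma boundaryComponent_eq_of_not_cuspNe {h h' : SL(2, ℤ)} (H : ¬ CuspNe h h') :
    boundaryComponent h' = boundaryComponent h := by
  ext z
  change (h' • (z : ℍ)).im = 2 ↔ (h • (z : ℍ)).im = 2
  rw [im_smul_of_not_cuspNe H]

lemma im_lt_one_of_mem_boundaryComponent {h h' : SL(2, ℤ)} (H : CuspNe h h') {z : Cover}
    (hz : z ∈ boundaryComponent h') : (h • (z : ℍ)).im < 1 := by
  have : (h' • (z : ℍ)).im = 2 := hz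
  exact im_smul_lt_one H.symm (by rw [this]; norm_num)

lemma notMem_boundaryComponent {h h' : SL(2, ℤ)} (H : CuspNe h h') {z : Cover}
    (hz : z ∈ boundaryComponent h') : z ∉ boundaryComponent h := by
  intro h1
  have h2 : (h • (z : ℍ)).im = 2 := h1
  linarith [im_lt_one_of_mem_boundaryComponent H hz]

lemma smul_mem_boundaryComponent {h : SL(2, ℤ)} (g : Γ) {z : Cover} :
    g • z ∈ boundaryComponent h ↔ z ∈ boundaryComponent (h * g) := by
  simp only [boundaryComponent, Set.mem_ofPred_eq, SubMulAction.val_smul, mul_smul]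
  rfl

instance : ContinuousConstSMul SL(2, ℤ) ℍ :=
  ⟨fun h => continuous_const_smul (h : GL (Fin 2) ℝ)⟩

/-- The open collar of a boundary component. -/
def collar (h : SL(2, ℤ)) : Set Cover := {z | 1 < (h • (z : ℍ)).im ∧ (h • (z : ℍ)).im < 2}

lemma collar_subset_coverInterior (h : SL(2, ℤ)) : collar h ⊆ coverInterior := by
  intro z hz h'
  by_cases H : CuspNe h h'
  · linarith [im_smul_lt_one H hz.1]
  · rw [im_smul_of_not_cuspNe H]
    exact hz.2

lemma inv_smul_mem_cover (h : SL(2, ℤ)) {τ : ℍ} (h1 : 1 < τ.im) (h2 : τ.im ≤ 2) :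
    h⁻¹ • τ ∈ Cover := by
  intro h'
  by_cases H : CuspNe h h'
  · linarith [im_smul_lt_one H (z := h⁻¹ • τ) (by rwa [smul_inv_smul])]
  · rw [im_smul_of_not_cuspNe H, smul_inv_smul]
    exact h2

/-- In the coordinate `h z` the collar is the full convex strip `1 < Im < 2`, as no other horodisk
reaches into it. -/
lemma isPreconnected_collar (h : SL(2, ℤ)) : IsPreconnected (collar h) := by
  have hind : Topology.IsInducing (fun z : Cover => ((h • (z : ℍ) : ℍ) : ℂ)) :=
    UpperHalfPlane.isEmbedding_coe.isInducing.comp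
      ((Homeomorph.smul h).isInducing.comp Topology.IsInducing.subtypeVal)
  rw [← hind.isPreconnected_image]
  have : (fun z : Cover => ((h • (z : ℍ) : ℍ) : ℂ)) '' collar h = {z : ℂ | 1 < z.im ∧ z.im < 2} := by
    ext w
    constructor
    · rintro ⟨z, hz, rfl⟩
      exact hz
    · rintro ⟨h1, h2⟩
      let τ : ℍ := ⟨w, by linarith⟩
      refine ⟨⟨h⁻¹ • τ, inv_smul_mem_cover h h1 h2.le⟩, ?_, ?_⟩
      · simp only [collar, Set.mem_ofPred_eq, smul_inv_smul]
        exact ⟨h1, h2⟩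
      · simp only [smul_inv_smul]
        rfl
  rw [this]
  refine Convex.isPreconnected ?_
  exact ((convex_Ioo (1 : ℝ) 2).is_linear_preimage (f := Complex.im) Complex.imLm.isLinear)

lemma boundaryComponent_nonempty (h : SL(2, ℤ)) : (boundaryComponent h).Nonempty := by
  let τ : ℍ := ⟨2 * Complex.I, by simp⟩
  have hτ : τ.im = 2 := by simp [τ, UpperHalfPlane.im]
  refine ⟨⟨h⁻¹ • τ, inv_smul_mem_cover h (by rw [hτ]; norm_num) hτ.le⟩, ?_⟩
  simp [boundaryComponent, hτ]

lemma continuous_im_smul (h : SL(2, ℤ)) : Continuous fun z : Cover => (h • (z : ℍ)).im :=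
  UpperHalfPlane.continuous_im.comp (continuous_subtype_val.const_smul h)

/-- The generator of the stabilizer of the boundary component at `h⁻¹ ∞`. -/
def parab (h : SL(2, ℤ)) : Γ :=
  ⟨h⁻¹ * (bdry 1).1 * h, by
    have := (CongruenceSubgroup.Gamma_normal 2).conj_mem _ (bdry 1).2 h⁻¹
    rwa [inv_inv] at this⟩

lemma parab_mul (h : SL(2, ℤ)) (g : Γ) : parab (h * g) = g⁻¹ * parab h * g := by
  ext1
  simp [parab, mul_assoc]

lemma bdry_one_eq : ((bdry 1 : Γ) : SL(2, ℤ)) = ModularGroup.T ^ (2 : ℤ) := by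
  ext i j
  rw [ModularGroup.coe_T_zpow]
  rfl

lemma parab_pow (h : SL(2, ℤ)) (n : ℤ) :
    ((parab h ^ n : Γ) : SL(2, ℤ)) = h⁻¹ * ModularGroup.T ^ (2 * n) * h := by
  have : ((parab h : Γ) : SL(2, ℤ)) = h⁻¹ * ModularGroup.T ^ (2 : ℤ) * h := by
    rw [← bdry_one_eq]; rfl
  rw [Subgroup.coe_zpow, this, zpow_mul]
  simpa using! conj_zpow (a := h⁻¹) (b := ModularGroup.T ^ (2 : ℤ)) (i := n)

lemma parab_zpow_smul_ne (h : SL(2, ℤ)) {n : ℤ} (hn : n ≠ 0) (z : Cover) : parab h ^ n • z ≠ z := by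
  intro H
  have h1 : ((parab h ^ n : Γ) : SL(2, ℤ)) • (z : ℍ) = z := congrArg Subtype.val H
  rw [parab_pow, mul_assoc, mul_smul, inv_smul_eq_iff, mul_smul] at h1
  have h2 := congrArg UpperHalfPlane.re h1
  rw [ModularGroup.re_T_zpow_smul] at h2
  have : ((2 * n : ℤ) : ℝ) = 0 := by linarith
  have : 2 * n = 0 := by exact_mod_cast this
  lia

lemma parab_smul_ne (h : SL(2, ℤ)) (z : Cover) : parab h • z ≠ z := by
  simpa using parab_zpow_smul_ne h one_ne_zero z

lemma mul_parab_zpow (h : SL(2, ℤ)) (n : ℤ) :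
    h * ((parab h ^ n : Γ) : SL(2, ℤ)) = ModularGroup.T ^ (2 * n) * h := by
  rw [parab_pow]; group

lemma T_zpow_mul_lower (n : ℤ) (g : SL(2, ℤ)) : (ModularGroup.T ^ n * g) 1 0 = g 1 0 := by
  rw [Matrix.SpecialLinearGroup.coe_mul, ModularGroup.coe_T_zpow]
  simp [Matrix.mul_apply, Fin.sum_univ_two]

lemma cuspNe_mul_parab_iff {h h' : SL(2, ℤ)} (n : ℤ) :
    CuspNe (h * ((parab h ^ n : Γ) : SL(2, ℤ))) h' ↔ CuspNe h h' := by
  unfold CuspNe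
  rw [mul_parab_zpow]
  have : (h' * (ModularGroup.T ^ (2 * n) * h)⁻¹) = ((ModularGroup.T ^ (2 * n)) * (h * h'⁻¹))⁻¹ := by
    group
  rw [this]
  have h3 : h' * h⁻¹ = (h * h'⁻¹)⁻¹ := by group
  rw [h3]
  simp only [Matrix.SpecialLinearGroup.SL2_inv_expl]
  simp [T_zpow_mul_lower]

lemma smul_parab_mem (h : SL(2, ℤ)) (n : ℤ) {z : Cover} :
    parab h ^ n • z ∈ boundaryComponent h ↔ z ∈ boundaryComponent h := by
  rw [smul_mem_boundaryComponent]
  have : ¬ CuspNe h (h * ((parab h ^ n : Γ) : SL(2, ℤ))) := by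
    intro H
    have := (cuspNe_mul_parab_iff n).1 H.symm
    simp [CuspNe] at this
  rw [boundaryComponent_eq_of_not_cuspNe this]

/-- The stabilizer of a cusp moves the other cusps freely. -/
lemma CuspNe.mul_parab_zpow {h h' : SL(2, ℤ)} (H : CuspNe h h') {i j : ℤ} (hij : i ≠ j) :
    CuspNe (h' * ((parab h ^ i : Γ) : SL(2, ℤ))) (h' * ((parab h ^ j : Γ) : SL(2, ℤ))) := by
  unfold CuspNe at *
  rw [parab_pow, parab_pow]
  have : h' * (h⁻¹ * ModularGroup.T ^ (2 * j) * h) * (h' * (h⁻¹ * ModularGroup.T ^ (2 * i) * h))⁻¹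
      = (h' * h⁻¹) * ModularGroup.T ^ (2 * (j - i)) * (h' * h⁻¹)⁻¹ := by group
  rw [this]
  generalize h' * h⁻¹ = g at H
  simp only [Matrix.SpecialLinearGroup.coe_mul, Matrix.SpecialLinearGroup.coe_inv,
    Matrix.adjugate_fin_two, ModularGroup.coe_T_zpow]
  simp [Matrix.mul_apply, Fin.sum_univ_two]
  have : j - i ≠ 0 := by lia
  intro h0
  have : (g 1 0) ^ 2 * (2 * (j - i)) = 0 := by linarith
  simp_all

lemma CuspNe.mul_parab_zpow_right {h h' : SL(2, ℤ)} (H : CuspNe h h') (i : ℤ) :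
    CuspNe h (h' * ((parab h ^ i : Γ) : SL(2, ℤ))) := by
  have := H.mul_right ((parab h ^ i : Γ) : SL(2, ℤ))
  rwa [cuspNe_mul_parab_iff] at this

end Pants

namespace Pants

/-! ### Linear algebra in dimension three -/

lemma exists_dual_basis {r u w : V} (h : LinearIndependent ℝ ![r, u, w]) :
    ∃ ξ η ζ : V →ₗ[ℝ] ℝ, (∀ x, x = ξ x • r + η x • u + ζ x • w) ∧
      (ξ r = 1 ∧ ξ u = 0 ∧ ξ w = 0) ∧ (η r = 0 ∧ η u = 1 ∧ η w = 0) ∧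
      (ζ r = 0 ∧ ζ u = 0 ∧ ζ w = 1) := by
  let b := basisOfLinearIndependentOfCardEqFinrank h (by simp)
  have hb : ⇑b = ![r, u, w] := coe_basisOfLinearIndependentOfCardEqFinrank _ _
  have h0 : b 0 = r := by rw [hb]; rfl
  have h1 : b 1 = u := by rw [hb]; rfl
  have h2 : b 2 = w := by rw [hb]; rfl
  refine ⟨b.coord 0, b.coord 1, b.coord 2, fun x => ?_, ?_, ?_, ?_⟩
  · have := b.sum_repr x
    rw [Fin.sum_univ_three, h0, h1, h2] at this
    exact this.symm
  all_goals
    rw [← h0, ← h1, ← h2]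
    simp [Module.Basis.coord_apply]

lemma linearIndependent_triple_iff {u v w : V} : LinearIndependent ℝ ![u, v, w] ↔
    ∀ a b c : ℝ, a • u + b • v + c • w = 0 → a = 0 ∧ b = 0 ∧ c = 0 := by
  rw [Fintype.linearIndependent_iff]
  constructor
  · intro h a b c habc
    have := h ![a, b, c] (by simpa [Fin.sum_univ_three] using habc)
    exact ⟨this 0, this 1, this 2⟩
  · intro h g hg
    obtain ⟨h0, h1, h2⟩ := h (g 0) (g 1) (g 2) (by simpa [Fin.sum_univ_three] using hg)
    intro i
    fin_cases i <;> assumption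

lemma eq_smul_of_common_zeros {f g : V →ₗ[ℝ] ℝ} {u v w : V} (huv : LinearIndependent ℝ ![u, v])
    (fu : f u = 0) (fv : f v = 0) (gu : g u = 0) (gv : g v = 0) (fw : f w ≠ 0) :
    g = (g w / f w) • f := by
  have hli : LinearIndependent ℝ ![u, v, w] := by
    rw [linearIndependent_triple_iff]
    intro a b c habc
    have hc : c = 0 := by
      have := congrArg f habc
      simpa [fu, fv, fw] using this
    subst hc
    have := LinearIndependent.pair_iff.1 huv a b (by simpa using habc)
    exact ⟨this.1, this.2, rfl⟩
  obtain ⟨ξ, η, ζ, hx, -⟩ := exists_dual_basis hli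
  refine LinearMap.ext fun x => ?_
  conv_lhs => rw [hx x]
  conv_rhs => rw [hx x]
  simp only [map_add, map_smul, fu, fv, gu, gv, LinearMap.smul_apply, smul_eq_mul]
  field_simp
  ring

lemma eq_zero_of_three_zeros {f : V →ₗ[ℝ] ℝ} {u v w : V} (h : LinearIndependent ℝ ![u, v, w])
    (fu : f u = 0) (fv : f v = 0) (fw : f w = 0) : f = 0 := by
  obtain ⟨ξ, η, ζ, hx, -⟩ := exists_dual_basis h
  refine LinearMap.ext fun x => ?_
  rw [hx x]
  simp [fu, fv, fw]

/-- Each equation makes two of the numbers opposite in sign, or both zero. Three nonzero numbers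
cannot be pairwise opposite. -/
lemma coeffs_eq_zero {a b c p12 p13 p21 p23 p31 p32 : ℝ} (h12 : 0 < p12) (h13 : 0 < p13)
    (h21 : 0 < p21) (h23 : 0 < p23) (h31 : 0 < p31) (h32 : 0 < p32)
    (h1 : b * p12 + c * p13 = 0) (h2 : a * p21 + c * p23 = 0) (h3 : a * p31 + b * p32 = 0) :
    a = 0 ∧ b = 0 ∧ c = 0 := by
  have hc : c = 0 := by
    rcases lt_trichotomy c 0 with hc | hc | hc
    · have hb : 0 < b := by
        by_contra! hb
        nlinarith [mul_neg_of_neg_of_pos hc h13, mul_nonpos_of_nonpos_of_nonneg hb h12.le]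
      have ha : 0 < a := by
        by_contra! ha
        nlinarith [mul_neg_of_neg_of_pos hc h23, mul_nonpos_of_nonpos_of_nonneg ha h21.le]
      nlinarith [mul_pos ha h31, mul_pos hb h32]
    · exact hc
    · have hb : b < 0 := by
        by_contra! hb
        nlinarith [mul_pos hc h13, mul_nonneg hb h12.le]
      have ha : a < 0 := by
        by_contra! ha
        nlinarith [mul_pos hc h23, mul_nonneg ha h21.le]
      nlinarith [mul_neg_of_neg_of_pos ha h31, mul_neg_of_neg_of_pos hb h32]
  subst hc
  simp only [zero_mul, add_zero, mul_eq_zero] at h1 h2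
  exact ⟨h2.resolve_right h21.ne', h1.resolve_right h12.ne', rfl⟩

section TripleDuality

variable {f₁ f₂ f₃ : V →ₗ[ℝ] ℝ} {x₁ x₂ x₃ : V} (h11 : f₁ x₁ = 0) (h22 : f₂ x₂ = 0)
  (h33 : f₃ x₃ = 0) (h12 : 0 < f₁ x₂) (h13 : 0 < f₁ x₃) (h21 : 0 < f₂ x₁) (h23 : 0 < f₂ x₃)
  (h31 : 0 < f₃ x₁) (h32 : 0 < f₃ x₂)

include h11 h22 h33 h12 h13 h21 h23 h31 h32

/-- Three points of the boundary of a convex cone with tangents that touch it at one of the points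
and not at the others are in general position. -/
lemma linearIndependent_of_supports : LinearIndependent ℝ ![x₁, x₂, x₃] := by
  rw [linearIndependent_triple_iff]
  intro a b c habc
  have e1 := congrArg f₁ habc
  have e2 := congrArg f₂ habc
  have e3 := congrArg f₃ habc
  simp only [map_add, map_smul, smul_eq_mul, h11, h22, h33, map_zero, mul_zero, zero_add,
    add_zero] at e1 e2 e3
  exact coeffs_eq_zero h12 h13 h21 h23 h31 h32 e1 e2 e3

/-- The dual statement: the three tangents are not concurrent. Expanding `e` in the three points
gives the same sign pattern. -/
lemma eq_zero_of_supports {e : V} (e1 : f₁ e = 0) (e2 : f₂ e = 0) (e3 : f₃ e = 0) : e = 0 := by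
  obtain ⟨ξ, η, ζ, hx, -⟩ := exists_dual_basis
    (linearIndependent_of_supports h11 h22 h33 h12 h13 h21 h23 h31 h32)
  rw [hx e] at e1 e2 e3
  simp only [map_add, map_smul, smul_eq_mul, h11, h22, h33, mul_zero, zero_add,
    add_zero] at e1 e2 e3
  obtain ⟨a, b, c⟩ := coeffs_eq_zero h12 h13 h21 h23 h31 h32 e1 e2 e3
  rw [hx e, a, b, c]
  simp

end TripleDuality

/-! ### The convex image in an affine chart and its supporting functionals. -/

namespace ConvexProjectiveStructure

variable (π : ConvexProjectiveStructure)

/-- A functional that defines an affine chart containing the image of the developing map. -/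
def chart : V →ₗ[ℝ] ℝ := π.convex.choose

lemma chart_ne_zero {z : Cover} {v : V} (hv : v ∈ (π.dev z).submodule) (h0 : v ≠ 0) :
    π.chart v ≠ 0 := π.convex.choose_spec.1 z v hv h0

/-- The image of a point in the affine chart. -/
def pt (z : Cover) : V := (π.chart (π.dev z).rep)⁻¹ • (π.dev z).rep

lemma rep_mem (p : RP2) : p.rep ∈ p.submodule := by
  rw [Projectivization.submodule_eq]
  exact Submodule.mem_span_singleton_self _

lemma chart_rep_ne_zero (z : Cover) : π.chart (π.dev z).rep ≠ 0 :=
  π.chart_ne_zero (rep_mem _) (Projectivization.rep_nonzero _)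

@[simp] lemma chart_pt (z : Cover) : π.chart (π.pt z) = 1 := by
  simp [pt, π.chart_rep_ne_zero z]

lemma pt_ne_zero (z : Cover) : π.pt z ≠ 0 := by
  intro h
  have := π.chart_pt z
  simp [h] at this

lemma pt_mem (z : Cover) : π.pt z ∈ (π.dev z).submodule :=
  Submodule.smul_mem _ _ (rep_mem _)

lemma eq_smul_pt {z : Cover} {v : V} (hv : v ∈ (π.dev z).submodule) : v = π.chart v • π.pt z := by
  rw [Projectivization.submodule_eq, Submodule.mem_span_singleton] at hv
  obtain ⟨c, rfl⟩ := hv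
  rw [map_smul, smul_eq_mul, pt, smul_smul]
  congr 1
  field_simp [π.chart_rep_ne_zero z]

lemma mk_pt (z : Cover) : Projectivization.mk ℝ (π.pt z) (π.pt_ne_zero z) = π.dev z := by
  conv_rhs => rw [← Projectivization.mk_rep (π.dev z)]
  rw [Projectivization.mk_eq_mk_iff']
  exact ⟨_, rfl⟩

lemma pt_injective : Function.Injective π.pt := by
  intro z z' h
  apply π.isEmbedding_dev.injective
  rw [← π.mk_pt z, ← π.mk_pt z']
  simp only [h]

lemma continuous_mk : Continuous fun v : {v : V // v ≠ 0} => Projectivization.mk ℝ v.1 v.2 :=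
  continuous_coinduced_rng

/-- The saturation of an open set is the union of its rescalings by units. -/
lemma isOpenMap_mk : IsOpenMap fun v : {v : V // v ≠ 0} => Projectivization.mk ℝ v.1 v.2 := by
  intro U hU
  refine isOpen_coinduced.2 ?_
  have : (fun v : {v : V // v ≠ 0} => Projectivization.mk ℝ v.1 v.2) ⁻¹'
      ((fun v : {v : V // v ≠ 0} => Projectivization.mk ℝ v.1 v.2) '' U) =
      ⋃ c : ℝˣ, (fun v : {v : V // v ≠ 0} =>
        (⟨c • v.1, by simpa [Units.smul_def] using v.2⟩ : {v : V // v ≠ 0})) ⁻¹' U := by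
    ext v
    simp only [Set.mem_preimage, Set.mem_image, Set.mem_iUnion]
    constructor
    · rintro ⟨u, hu, huv⟩
      obtain ⟨c, hc⟩ := (Projectivization.mk_eq_mk_iff ℝ _ _ _ _).1 huv
      refine ⟨c, ?_⟩
      convert hu
    · rintro ⟨c, hc⟩
      exact ⟨_, hc, (Projectivization.mk_eq_mk_iff ℝ _ _ _ _).2 ⟨c, rfl⟩⟩
  rw [this]
  refine isOpen_iUnion fun c => hU.preimage ?_
  exact Continuous.subtype_mk (continuous_subtype_val.const_smul c) _

/-- The normalization `v ↦ v / chart v` is invariant under scaling, so continuity can be tested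
upstairs along the open quotient map, where no choice of representatives enters. -/
lemma continuous_pt : Continuous π.pt := by
  let G : RP2 → V := fun p => (π.chart p.rep)⁻¹ • p.rep
  rw [continuous_iff_continuousAt]
  intro z
  change ContinuousAt (G ∘ π.dev) z
  refine ContinuousAt.comp ?_ π.isEmbedding_dev.continuous.continuousAt
  let mk' : {v : V // v ≠ 0} → RP2 := fun v => Projectivization.mk ℝ v.1 v.2
  let v : {v : V // v ≠ 0} := ⟨π.pt z, π.pt_ne_zero z⟩
  have hz : π.dev z = mk' v := (π.mk_pt z).symm
  have hmap : nhds (mk' v) = Filter.map mk' (nhds v) :=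
    (isOpenMap_mk.map_nhds_eq continuous_mk.continuousAt).symm
  rw [hz, ContinuousAt, hmap, Filter.tendsto_map'_iff]
  have hG : G ∘ mk' = fun u => (π.chart u.1)⁻¹ • u.1 := by
    funext u
    obtain ⟨a, ha⟩ := Projectivization.exists_smul_eq_mk_rep ℝ u.1 u.2
    change (π.chart (mk' u).rep)⁻¹ • (mk' u).rep = _
    have ha' : (mk' u).rep = (a : ℝ) • u.1 := ha.symm
    rw [ha', map_smul, smul_eq_mul, smul_smul]
    congr 1
    have : (a : ℝ) ≠ 0 := a.ne_zero
    by_cases hu : π.chart u.1 = 0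
    · simp [hu]
    · field_simp
  rw [hG]
  have hc : Continuous π.chart := LinearMap.continuous_of_finiteDimensional _
  have h1 : G (mk' v) = (π.chart v.1)⁻¹ • v.1 := congrFun hG v
  rw [h1]
  refine ContinuousAt.smul (ContinuousAt.inv₀ (hc.comp continuous_subtype_val).continuousAt ?_)
    continuous_subtype_val.continuousAt
  simp [v]

lemma exists_segment (z₁ z₂ : Cover) : ∃ γ : unitInterval → Cover, Continuous γ ∧
    (∀ t, π.pt (γ t) = (1 - (t : ℝ)) • π.pt z₁ + (t : ℝ) • π.pt z₂) ∧ γ 0 = z₁ ∧ γ 1 = z₂ := by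
  have hex : ∀ t : unitInterval, ∃ z, π.pt z = (1 - (t : ℝ)) • π.pt z₁ + (t : ℝ) • π.pt z₂ := by
    intro t
    have hmem : ∀ z, π.pt z ∈ {v : V | π.chart v = 1 ∧ ∃ z, v ∈ (π.dev z).submodule} :=
      fun z => ⟨π.chart_pt z, z, π.pt_mem z⟩
    obtain ⟨h1, z, hz⟩ := π.convex.choose_spec.2 (hmem z₁) (hmem z₂)
      (sub_nonneg.2 t.2.2) t.2.1 (sub_add_cancel (1 : ℝ) (t : ℝ))
    refine ⟨z, ?_⟩
    have h2 := π.eq_smul_pt hz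
    rw [show π.chart _ = 1 from h1, one_smul] at h2
    exact h2.symm
  choose γ hγ using hex
  refine ⟨γ, ?_, hγ, π.pt_injective ?_, π.pt_injective ?_⟩
  · rw [π.isEmbedding_dev.isInducing.continuous_iff]
    have : π.dev ∘ γ = (fun v : {v : V // v ≠ 0} => Projectivization.mk ℝ v.1 v.2) ∘
        fun t : unitInterval => ⟨(1 - (t : ℝ)) • π.pt z₁ + (t : ℝ) • π.pt z₂, by
          rw [← hγ]; exact π.pt_ne_zero _⟩ := by
      funext t
      simp only [Function.comp_apply, ← hγ]
      exact (π.mk_pt _).symm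
    rw [this]
    refine continuous_mk.comp (Continuous.subtype_mk ?_ _)
    fun_prop
  · simp [hγ]
  · simp [hγ]

/-- `f` is a functional that cuts out the line of the boundary component `h` and is positive on the
rest of the image of the developing map. -/
structure IsSupport (h : SL(2, ℤ)) (f : V →ₗ[ℝ] ℝ) : Prop where
  zero : ∀ z ∈ boundaryComponent h, f (π.pt z) = 0
  pos : ∀ z ∉ boundaryComponent h, 0 < f (π.pt z)

/-- Every point off a boundary component is seen from this component through its collar. -/
lemma exists_mem_collar {h : SL(2, ℤ)} {q z : Cover} (hq : q ∈ boundaryComponent h)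
    (hz : z ∉ boundaryComponent h) {f : V →ₗ[ℝ] ℝ} (hf : f (π.pt q) = 0) :
    ∃ y ∈ collar h, ∃ t : ℝ, 0 < t ∧ f (π.pt y) = t * f (π.pt z) := by
  obtain ⟨γ, hc, hpt, h0, h1⟩ := π.exists_segment q z
  have hcont := (continuous_im_smul h).comp hc
  have g0 : (h • (γ 0 : ℍ)).im = 2 := by rw [h0]; exact hq
  have g1 : (h • (γ 1 : ℍ)).im < 2 := by
    rw [h1]
    exact lt_of_le_of_ne (z.2 h) hz
  -- Along the segment `f` is `t * f (pt z)`, so any parameter `t > 0` in the collar will do. The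
  -- height starts at `2`; the level chosen here is attained and lies strictly between `1` and `2`.
  have hmem : max ((h • (γ 1 : ℍ)).im) (3 / 2) ∈
      Set.Icc ((h • (γ 1 : ℍ)).im) ((h • (γ 0 : ℍ)).im) :=
    ⟨le_max_left _ _, by rw [g0]; exact max_le g1.le (by norm_num)⟩
  obtain ⟨t, ht⟩ : max ((h • (γ 1 : ℍ)).im) (3 / 2) ∈ Set.range fun t => (h • (γ t : ℍ)).im :=
    mem_range_of_exists_le_of_exists_ge hcont ⟨1, hmem.1⟩ ⟨0, hmem.2⟩
  have ht' : (h • (γ t : ℍ)).im = max ((h • (γ 1 : ℍ)).im) (3 / 2) := ht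
  have hlt : max ((h • (γ 1 : ℍ)).im) (3 / 2) < 2 := max_lt g1 (by norm_num)
  refine ⟨γ t, ⟨?_, ?_⟩, t, ?_, ?_⟩
  · rw [ht']; exact lt_max_of_lt_right (by norm_num)
  · rwa [ht']
  · refine lt_of_le_of_ne t.2.1 fun h => ?_
    have : t = 0 := Subtype.ext h.symm
    rw [this, g0] at ht'
    linarith
  · rw [hpt]; simp [hf]

/-- The functional of the geodesic boundary has no zero on the connected collar, hence a constant
sign there, and `exists_mem_collar` spreads this sign to every point off the component, other
boundary components included. -/
lemma exists_isSupport (h : SL(2, ℤ)) : ∃ f, π.IsSupport h f := by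
  obtain ⟨f, -, hf0, hf1⟩ := π.geodesic_boundary h
  obtain ⟨q, hq⟩ := boundaryComponent_nonempty h
  have hfq : ∀ z ∈ boundaryComponent h, f (π.pt z) = 0 := fun z hz => hf0 z hz _ (π.pt_mem z)
  have hne : ∀ z ∈ collar h, f (π.pt z) ≠ 0 := fun z hz =>
    hf1 z (collar_subset_coverInterior h hz) _ (π.pt_mem z) (π.pt_ne_zero z)
  have hcont : Continuous fun z => f (π.pt z) :=
    (LinearMap.continuous_of_finiteDimensional f).comp π.continuous_pt
  have key : (∀ z ∈ collar h, 0 < f (π.pt z)) ∨ ∀ z ∈ collar h, f (π.pt z) < 0 := by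
    by_contra! hcon
    obtain ⟨⟨z₁, hz₁, h1⟩, z₂, hz₂, h2⟩ := hcon
    obtain ⟨z, hz, h0⟩ := (isPreconnected_collar h).intermediate_value hz₁ hz₂ hcont.continuousOn
      ⟨h1, h2⟩
    exact hne z hz h0
  rcases key with key | key
  · refine ⟨f, hfq, fun z hz => ?_⟩
    obtain ⟨y, hy, t, ht, e⟩ := π.exists_mem_collar hq hz (hfq q hq)
    have := key y hy
    rw [e] at this
    exact pos_of_mul_pos_right this ht.le
  · refine ⟨-f, fun z hz => by simp [hfq z hz], fun z hz => ?_⟩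
    obtain ⟨y, hy, t, ht, e⟩ := π.exists_mem_collar hq hz (hfq q hq)
    have := key y hy
    rw [e] at this
    simp only [LinearMap.neg_apply, Left.neg_pos_iff]
    by_contra! h3
    nlinarith [mul_nonneg ht.le h3]

variable {π}

lemma IsSupport.nonneg {h : SL(2, ℤ)} {f : V →ₗ[ℝ] ℝ} (hf : π.IsSupport h f) (z : Cover) :
    0 ≤ f (π.pt z) := by
  by_cases hz : z ∈ boundaryComponent h
  · exact (hf.zero z hz).ge
  · exact (hf.pos z hz).le

lemma IsSupport.pos_of_cuspNe {h h' : SL(2, ℤ)} {f : V →ₗ[ℝ] ℝ} (hf : π.IsSupport h f)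
    (H : CuspNe h h') {z : Cover} (hz : z ∈ boundaryComponent h') : 0 < f (π.pt z) :=
  hf.pos z (notMem_boundaryComponent H hz)

lemma linearIndependent_pt_pair {z z' : Cover} (h : z ≠ z') :
    LinearIndependent ℝ ![π.pt z, π.pt z'] := by
  rw [LinearIndependent.pair_iff]
  intro s t hst
  have h1 := congrArg π.chart hst
  simp only [map_add, map_smul, chart_pt, smul_eq_mul, mul_one, map_zero] at h1
  have hs : s = -t := by linarith
  subst hs
  have h2 : t • (π.pt z' - π.pt z) = 0 := by rw [← hst]; module
  rcases smul_eq_zero.1 h2 with h3 | h3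
  · simp [h3]
  · exact absurd (π.pt_injective (sub_eq_zero.1 h3)).symm h

section

variable {h₁ h₂ h₃ : SL(2, ℤ)} (H12 : CuspNe h₁ h₂) (H13 : CuspNe h₁ h₃) (H23 : CuspNe h₂ h₃)
include H12 H13 H23

lemma linearIndependent_pt {z₁ z₂ z₃ : Cover} (hz₁ : z₁ ∈ boundaryComponent h₁)
    (hz₂ : z₂ ∈ boundaryComponent h₂) (hz₃ : z₃ ∈ boundaryComponent h₃) :
    LinearIndependent ℝ ![π.pt z₁, π.pt z₂, π.pt z₃] := by
  obtain ⟨f₁, hf₁⟩ := π.exists_isSupport h₁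
  obtain ⟨f₂, hf₂⟩ := π.exists_isSupport h₂
  obtain ⟨f₃, hf₃⟩ := π.exists_isSupport h₃
  exact linearIndependent_of_supports (hf₁.zero _ hz₁) (hf₂.zero _ hz₂) (hf₃.zero _ hz₃)
    (hf₁.pos_of_cuspNe H12 hz₂) (hf₁.pos_of_cuspNe H13 hz₃) (hf₂.pos_of_cuspNe H12.symm hz₁)
    (hf₂.pos_of_cuspNe H23 hz₃) (hf₃.pos_of_cuspNe H13.symm hz₁) (hf₃.pos_of_cuspNe H23.symm hz₂)

lemma eq_zero_of_isSupport {f₁ f₂ f₃ : V →ₗ[ℝ] ℝ} (hf₁ : π.IsSupport h₁ f₁)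
    (hf₂ : π.IsSupport h₂ f₂) (hf₃ : π.IsSupport h₃ f₃) {e : V} (e1 : f₁ e = 0) (e2 : f₂ e = 0)
    (e3 : f₃ e = 0) : e = 0 := by
  obtain ⟨z₁, hz₁⟩ := boundaryComponent_nonempty h₁
  obtain ⟨z₂, hz₂⟩ := boundaryComponent_nonempty h₂
  obtain ⟨z₃, hz₃⟩ := boundaryComponent_nonempty h₃
  exact eq_zero_of_supports (hf₁.zero _ hz₁) (hf₂.zero _ hz₂) (hf₃.zero _ hz₃)
    (hf₁.pos_of_cuspNe H12 hz₂) (hf₁.pos_of_cuspNe H13 hz₃) (hf₂.pos_of_cuspNe H12.symm hz₁)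
    (hf₂.pos_of_cuspNe H23 hz₃) (hf₃.pos_of_cuspNe H13.symm hz₁) (hf₃.pos_of_cuspNe H23.symm hz₂)
    e1 e2 e3

end

end ConvexProjectiveStructure

end Pants

namespace Pants

lemma wedge_ne_zero_iff {u v w : V} : wedge u v w ≠ 0 ↔ LinearIndependent ℝ ![u, v, w] := by
  have := Matrix.linearIndependent_rows_iff_isUnit (A := Matrix.of ![u, v, w])
  rw [Matrix.isUnit_iff_isUnit_det, isUnit_iff_ne_zero] at this
  exact this.symm

lemma wedge_eq (u v w : V) : wedge u v w = u 0 * v 1 * w 2 - u 0 * v 2 * w 1 - u 1 * v 0 * w 2 +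
    u 1 * v 2 * w 0 + u 2 * v 0 * w 1 - u 2 * v 1 * w 0 := by
  simp [wedge, Matrix.det_fin_three]

lemma wedge_mulVec (M : Matrix (Fin 3) (Fin 3) ℝ) (u v w : V) :
    wedge (M.mulVec u) (M.mulVec v) (M.mulVec w) = M.det * wedge u v w := by
  have : Matrix.of ![M.mulVec u, M.mulVec v, M.mulVec w] = Matrix.of ![u, v, w] * M.transpose := by
    ext i j
    fin_cases i <;> simp [Matrix.mul_apply, Matrix.mulVec, dotProduct, mul_comm]
  rw [wedge, this, Matrix.det_mul, Matrix.det_transpose, wedge, mul_comm]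

/-! ### Eigenbases -/

/-- Division by `n ^ k` leaves only `c` in the limit. This is how inequalities at points of the
image pass to the fixed points of the monodromy. -/
lemma nonneg_of_forall_pow {a b c l m n : ℝ} (hl : 0 < l) (hlm : l < m) (hmn : m < n)
    (h : ∀ k : ℕ, 0 ≤ l ^ k * a + m ^ k * b + n ^ k * c) : 0 ≤ c := by
  have hm := hl.trans hlm
  have hn := hm.trans hmn
  have h1 : Filter.Tendsto (fun k : ℕ => (l / n) ^ k) Filter.atTop (nhds 0) :=
    tendsto_pow_atTop_nhds_zero_of_lt_one (by positivity) ((div_lt_one hn).2 (hlm.trans hmn))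
  have h2 : Filter.Tendsto (fun k : ℕ => (m / n) ^ k) Filter.atTop (nhds 0) :=
    tendsto_pow_atTop_nhds_zero_of_lt_one (by positivity) ((div_lt_one hn).2 hmn)
  have h3 : Filter.Tendsto (fun k : ℕ => (l / n) ^ k * a + (m / n) ^ k * b + c) Filter.atTop
      (nhds (0 * a + 0 * b + c)) :=
    ((h1.mul_const a).add (h2.mul_const b)).add_const c
  rw [zero_mul, zero_mul, zero_add, zero_add] at h3
  refine ge_of_tendsto' h3 fun k => ?_
  have h4 : (l / n) ^ k * a + (m / n) ^ k * b + c = (l ^ k * a + m ^ k * b + n ^ k * c) / n ^ k := by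
    rw [div_pow, div_pow]
    field_simp
  rw [h4]
  exact div_nonneg (h k) (by positivity)

/-- `r, u, w` is an eigenbasis of `A` with eigenvalues `l < m < n`, and `ξ, η, ζ` is the dual
basis. -/
structure EigenBasis (A : V →ₗ[ℝ] V) (l m n : ℝ) (r u w : V) (ξ η ζ : V →ₗ[ℝ] ℝ) : Prop where
  l_pos : 0 < l
  l_lt : l < m
  m_lt : m < n
  map_r : A r = l • r
  map_u : A u = m • u
  map_w : A w = n • w
  expand : ∀ x, x = ξ x • r + η x • u + ζ x • w
  ξr : ξ r = 1
  ξu : ξ u = 0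
  ξw : ξ w = 0
  ηr : η r = 0
  ηu : η u = 1
  ηw : η w = 0
  ζr : ζ r = 0
  ζu : ζ u = 0
  ζw : ζ w = 1

lemma HasSpectrum.exists_eigenBasis {M : SL(3, ℝ)} {l m n : ℝ} (h : HasSpectrum M l m n) :
    ∃ r u w ξ η ζ, EigenBasis (Matrix.toLin' M.1) l m n r u w ξ η ζ := by
  obtain ⟨hl, hlm, hmn, el, em, en⟩ := h
  obtain ⟨r, hr⟩ := el.exists_hasEigenvector
  obtain ⟨u, hu⟩ := em.exists_hasEigenvector
  obtain ⟨w, hw⟩ := en.exists_hasEigenvector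
  have hli : LinearIndependent ℝ ![r, u, w] := by
    refine Module.End.eigenvectors_linearIndependent' (Matrix.toLin' M.1) ![l, m, n] ?_ _ ?_
    · intro i j hij
      fin_cases i <;> fin_cases j <;> simp at hij ⊢ <;> linarith
    · intro i
      fin_cases i <;> assumption
  obtain ⟨ξ, η, ζ, hx, ⟨h1, h2, h3⟩, ⟨h4, h5, h6⟩, h7, h8, h9⟩ := exists_dual_basis hli
  exact ⟨r, u, w, ξ, η, ζ, hl, hlm, hmn, hr.apply_eq_smul, hu.apply_eq_smul, hw.apply_eq_smul, hx,
    h1, h2, h3, h4, h5, h6, h7, h8, h9⟩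

namespace EigenBasis

variable {A : V →ₗ[ℝ] V} {l m n : ℝ} {r u w : V} {ξ η ζ : V →ₗ[ℝ] ℝ}
  (E : EigenBasis A l m n r u w ξ η ζ)
include E

lemma m_pos : 0 < m := E.l_pos.trans E.l_lt
lemma n_pos : 0 < n := E.m_pos.trans E.m_lt

lemma r_ne_zero : r ≠ 0 := by
  rintro rfl
  simpa using E.ξr

lemma u_ne_zero : u ≠ 0 := by
  rintro rfl
  simpa using E.ηu

lemma w_ne_zero : w ≠ 0 := by
  rintro rfl
  simpa using E.ζw

lemma map_eq (x : V) : A x = (l * ξ x) • r + (m * η x) • u + (n * ζ x) • w := by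
  conv_lhs => rw [E.expand x]
  simp only [map_add, map_smul, E.map_r, E.map_u, E.map_w]
  module

lemma ξ_map (x : V) : ξ (A x) = l * ξ x := by
  rw [E.map_eq]; simp [E.ξr, E.ξu, E.ξw]

lemma η_map (x : V) : η (A x) = m * η x := by
  rw [E.map_eq]; simp [E.ηr, E.ηu, E.ηw]

lemma ζ_map (x : V) : ζ (A x) = n * ζ x := by
  rw [E.map_eq]; simp [E.ζr, E.ζu, E.ζw]

lemma pow_eq (k : ℕ) (x : V) :
    (A ^ k) x = (l ^ k * ξ x) • r + (m ^ k * η x) • u + (n ^ k * ζ x) • w := by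
  induction k with
  | zero => simpa using E.expand x
  | succ k ih =>
    rw [pow_succ', Module.End.mul_apply, ih]
    simp only [map_add, map_smul, E.map_r, E.map_u, E.map_w]
    module

lemma map_expand (f : V →ₗ[ℝ] ℝ) (x : V) : f x = ξ x * f r + η x * f u + ζ x * f w := by
  conv_lhs => rw [E.expand x]
  simp

lemma nonneg_top {f : V →ₗ[ℝ] ℝ} {x : V} (h : ∀ k : ℕ, 0 ≤ f ((A ^ k) x)) : 0 ≤ ζ x * f w := by
  refine nonneg_of_forall_pow (a := ξ x * f r) (b := η x * f u) E.l_pos E.l_lt E.m_lt fun k => ?_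
  have := h k
  rw [E.pow_eq] at this
  simp only [map_add, map_smul, smul_eq_mul] at this
  linarith

lemma nonneg_mid {f : V →ₗ[ℝ] ℝ} {x : V} (h : ∀ k : ℕ, 0 ≤ f ((A ^ k) x)) (h0 : ζ x = 0) :
    0 ≤ η x * f u := by
  -- The top component is absent, so `m` plays the role of the largest eigenvalue; `p` is a dummy
  -- middle one with coefficient `0`.
  obtain ⟨p, hp⟩ := exists_between E.l_lt
  refine nonneg_of_forall_pow (a := ξ x * f r) (b := 0) E.l_pos hp.1 hp.2 fun k => ?_
  have := h k
  rw [E.pow_eq] at this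
  simp only [map_add, map_smul, smul_eq_mul, h0] at this
  linarith

lemma linearIndependent : LinearIndependent ℝ ![r, u, w] := by
  rw [linearIndependent_triple_iff]
  intro a b c h
  have h1 := congrArg ξ h
  have h2 := congrArg η h
  have h3 := congrArg ζ h
  simp only [map_add, map_smul, smul_eq_mul, E.ξr, E.ξu, E.ξw, E.ηr, E.ηu, E.ηw, E.ζr, E.ζu, E.ζw,
    map_zero] at h1 h2 h3
  refine ⟨?_, ?_, ?_⟩ <;> linarith

/-- Inversion exchanges the attracting and repelling roles, so each statement about `w` yields one
about `r`. -/
lemma symm {B : V →ₗ[ℝ] V} (hB : ∀ x, B (A x) = x) :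
    EigenBasis B n⁻¹ m⁻¹ l⁻¹ w u r ζ η ξ where
  l_pos := inv_pos.2 E.n_pos
  l_lt := inv_strictAnti₀ E.m_pos E.m_lt
  m_lt := inv_strictAnti₀ E.l_pos E.l_lt
  map_r := by
    rw [eq_inv_smul_iff₀ E.n_pos.ne', ← map_smul, ← E.map_w, hB]
  map_u := by
    rw [eq_inv_smul_iff₀ E.m_pos.ne', ← map_smul, ← E.map_u, hB]
  map_w := by
    rw [eq_inv_smul_iff₀ E.l_pos.ne', ← map_smul, ← E.map_r, hB]
  expand x := by
    conv_lhs => rw [E.expand x]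
    module
  ξr := E.ζw
  ξu := E.ζu
  ξw := E.ζr
  ηr := E.ηw
  ηu := E.ηu
  ηw := E.ηr
  ζr := E.ξw
  ζu := E.ξu
  ζw := E.ξr

/-- Rescaling of the basis vectors. -/
lemma rescale {a b c : ℝ} (ha : a ≠ 0) (hb : b ≠ 0) (hc : c ≠ 0) :
    EigenBasis A l m n (a • r) (b • u) (c • w) (a⁻¹ • ξ) (b⁻¹ • η) (c⁻¹ • ζ) where
  l_pos := E.l_pos
  l_lt := E.l_lt
  m_lt := E.m_lt
  map_r := by rw [map_smul, E.map_r, smul_comm]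
  map_u := by rw [map_smul, E.map_u, smul_comm]
  map_w := by rw [map_smul, E.map_w, smul_comm]
  expand x := by
    conv_lhs => rw [E.expand x]
    simp only [LinearMap.smul_apply, smul_eq_mul, smul_smul]
    congr 1
    · congr 1
      · congr 1; field_simp
      · congr 1; field_simp
    · congr 1; field_simp
  ξr := by simp [E.ξr, ha]
  ξu := by simp [E.ξu]
  ξw := by simp [E.ξw]
  ηr := by simp [E.ηr]
  ηu := by simp [E.ηu, hb]
  ηw := by simp [E.ηw]
  ζr := by simp [E.ζr]
  ζu := by simp [E.ζu]
  ζw := by simp [E.ζw, hc]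

lemma eigenvector_cases {c : ℝ} {x : V} (hx : A x = c • x) (h0 : x ≠ 0) :
    (c = l ∧ η x = 0 ∧ ζ x = 0) ∨ (c = m ∧ ξ x = 0 ∧ ζ x = 0) ∨ (c = n ∧ ξ x = 0 ∧ η x = 0) := by
  have h1 := E.ξ_map x
  have h2 := E.η_map x
  have h3 := E.ζ_map x
  simp only [hx, map_smul, smul_eq_mul] at h1 h2 h3
  have k1 : c = l ∨ ξ x = 0 := by
    rcases eq_or_ne (ξ x) 0 with h | h
    · exact Or.inr h
    · exact Or.inl (mul_right_cancel₀ h h1)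
  have k2 : c = m ∨ η x = 0 := by
    rcases eq_or_ne (η x) 0 with h | h
    · exact Or.inr h
    · exact Or.inl (mul_right_cancel₀ h h2)
  have k3 : c = n ∨ ζ x = 0 := by
    rcases eq_or_ne (ζ x) 0 with h | h
    · exact Or.inr h
    · exact Or.inl (mul_right_cancel₀ h h3)
  have d1 := E.l_lt
  have d2 := E.m_lt
  rcases k1 with rfl | k1
  · exact Or.inl ⟨rfl, k2.resolve_left d1.ne, k3.resolve_left (d1.trans d2).ne⟩
  · rcases k2 with rfl | k2
    · exact Or.inr (Or.inl ⟨rfl, k1, k3.resolve_left d2.ne⟩)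
    · rcases k3 with rfl | k3
      · exact Or.inr (Or.inr ⟨rfl, k1, k2⟩)
      · refine absurd ?_ h0
        rw [E.expand x, k1, k2, k3]
        simp

end EigenBasis

/-! ### The monodromy acting on the cone over the image. -/

namespace ConvexProjectiveStructure

variable (π : ConvexProjectiveStructure)

/-- The linear action of the fundamental group through the monodromy. -/
def act (g : Γ) : V →ₗ[ℝ] V := Matrix.toLin' (π.hol g).1

@[simp] lemma act_mul (g g' : Γ) (v : V) : π.act (g * g') v = π.act g (π.act g' v) := by
  simp [act, Matrix.toLin'_mul]

@[simp] lemma act_one (v : V) : π.act 1 v = v := by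
  simp [act]

@[simp] lemma act_inv_act (g : Γ) (v : V) : π.act g⁻¹ (π.act g v) = v := by
  rw [← act_mul]; simp

@[simp] lemma act_act_inv (g : Γ) (v : V) : π.act g (π.act g⁻¹ v) = v := by
  rw [← act_mul]; simp

lemma act_pow (g : Γ) (k : ℕ) (v : V) : π.act (g ^ k) v = (π.act g ^ k) v := by
  induction k generalizing v with
  | zero => simp
  | succ k ih => rw [pow_succ, act_mul, ih, pow_succ, Module.End.mul_apply]

lemma wedge_act (g : Γ) (u v w : V) :
    wedge (π.act g u) (π.act g v) (π.act g w) = wedge u v w := by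
  simp only [act, Matrix.toLin'_apply, wedge_mulVec]
  rw [(π.hol g).2, one_mul]

lemma act_eq_zero {g : Γ} {v : V} (h : π.act g v = 0) : v = 0 := by
  have := π.act_inv_act g v
  rw [h, map_zero] at this
  exact this.symm

lemma act_pt (g : Γ) (z : Cover) :
    π.act g (π.pt z) = π.chart (π.act g (π.pt z)) • π.pt (g • z) := by
  apply π.eq_smul_pt
  rw [π.equivariant]
  exact Submodule.mem_map_of_mem (π.pt_mem z)

lemma chart_act_ne_zero (g : Γ) (z : Cover) : π.chart (π.act g (π.pt z)) ≠ 0 := by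
  intro h
  have h1 := π.act_pt g z
  rw [h, zero_smul] at h1
  exact π.pt_ne_zero z (π.act_eq_zero h1)

/-- The monodromy of `g` preserves the cone over the image of the developing map, and does not
exchange it with its opposite. -/
def Preserves (g : Γ) : Prop := ∀ z, 0 < π.chart (π.act g (π.pt z))

lemma chart_act_mul (g g' : Γ) (z : Cover) : π.chart (π.act (g * g') (π.pt z)) =
    π.chart (π.act g' (π.pt z)) * π.chart (π.act g (π.pt (g' • z))) := by
  rw [act_mul, act_pt π g' z]
  simp

variable {π}

lemma Preserves.mul {g g' : Γ} (h : π.Preserves g) (h' : π.Preserves g') :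
    π.Preserves (g * g') := by
  intro z
  rw [chart_act_mul]
  exact mul_pos (h' z) (h _)

lemma Preserves.one : π.Preserves 1 := by
  intro z
  simp

lemma Preserves.pow {g : Γ} (h : π.Preserves g) (k : ℕ) : π.Preserves (g ^ k) := by
  induction k with
  | zero => simpa using Preserves.one
  | succ k ih => rw [pow_succ]; exact ih.mul h

lemma Preserves.inv {g : Γ} (h : π.Preserves g) : π.Preserves g⁻¹ := by
  intro z
  have h1 := π.chart_act_mul g g⁻¹ z
  rw [mul_inv_cancel, act_one, chart_pt] at h1
  have h2 := h (g⁻¹ • z)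
  exact pos_of_mul_pos_left (by rw [← h1]; norm_num) h2.le

lemma Preserves.zpow {g : Γ} (h : π.Preserves g) (k : ℤ) : π.Preserves (g ^ k) := by
  cases k with
  | ofNat k => simpa using h.pow k
  | negSucc k => rw [zpow_negSucc]; exact (h.pow _).inv

/-- A group element either preserves the cone or exchanges it with its opposite. -/
lemma preserves_or (g : Γ) : π.Preserves g ∨ ∀ z, π.chart (π.act g (π.pt z)) < 0 := by
  by_contra! hcon
  obtain ⟨h1, z₂, h2⟩ := hcon
  simp only [Preserves, not_forall, not_lt] at h1
  obtain ⟨z₁, h1⟩ := h1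
  obtain ⟨γ, -, hγ, -⟩ := π.exists_segment z₁ z₂
  set a := π.chart (π.act g (π.pt z₁)) with ha
  set b := π.chart (π.act g (π.pt z₂)) with hb
  have ha0 : a < 0 := lt_of_le_of_ne h1 (π.chart_act_ne_zero g z₁)
  have hba : 0 < b - a := by linarith
  let t : unitInterval := ⟨-a / (b - a), by
    constructor
    · exact div_nonneg (by linarith) hba.le
    · rw [div_le_one hba]; linarith⟩
  -- `t` is the parameter at which the affine function running from `a` to `b` would vanish.
  apply π.chart_act_ne_zero g (γ t)
  rw [hγ]
  simp only [map_add, map_smul, smul_eq_mul, ← ha, ← hb, t]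
  field_simp
  ring

lemma IsSupport.comp_act {h : SL(2, ℤ)} {f : V →ₗ[ℝ] ℝ} (hf : π.IsSupport h f) {g : Γ}
    (hg : π.Preserves g) : π.IsSupport (h * g) (f ∘ₗ π.act g) := by
  refine ⟨fun z hz => ?_, fun z hz => ?_⟩
  · rw [LinearMap.comp_apply, act_pt, map_smul, hf.zero _ ((smul_mem_boundaryComponent g).2 hz),
      smul_zero]
  · rw [LinearMap.comp_apply, act_pt, map_smul]
    exact mul_pos (hg z) (hf.pos _ fun h1 => hz ((smul_mem_boundaryComponent g).1 h1))

lemma IsSupport.nonneg_act {h : SL(2, ℤ)} {f : V →ₗ[ℝ] ℝ} (hf : π.IsSupport h f) {g : Γ}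
    (hg : π.Preserves g) (z : Cover) : 0 ≤ f (π.act g (π.pt z)) := by
  rw [act_pt, map_smul]
  exact mul_nonneg (hg z).le (hf.nonneg _)

lemma exists_cuspNe (h : SL(2, ℤ)) : ∃ h', CuspNe h h' :=
  ⟨ModularGroup.S * h, by
    unfold CuspNe
    rw [mul_inv_cancel_right]
    simp [ModularGroup.S]⟩

/-- Three different cusps. -/
lemma exists_cuspNe_cuspNe {h h' : SL(2, ℤ)} (H : CuspNe h h') :
    ∃ h'', CuspNe h h'' ∧ CuspNe h' h'' :=
  ⟨_, H.mul_parab_zpow_right 1, by simpa using H.mul_parab_zpow (i := 0) (j := 1) (by norm_num)⟩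

variable (π)

/-- The group `Γ` contains `-1`, which acts trivially on the cover. Its monodromy fixes every point
of the image projectively, so it is a scalar, and a real scalar of determinant `1` in dimension
three is `1`. Relations that hold in `Γ` up to sign therefore hold exactly for the monodromy. -/
lemma act_neg_one {g : Γ} (hg : (g : SL(2, ℤ)) = -1) (v : V) : π.act g v = v := by
  have hfix : ∀ z : Cover, ∃ c : ℝ, π.act g (π.pt z) = c • π.pt z := by
    intro z
    have : g • z = z := by
      apply Subtype.ext
      change (g : SL(2, ℤ)) • (z : ℍ) = z
      rw [hg, ModularGroup.SL_neg_smul, one_smul]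
    exact ⟨_, by simpa [this] using π.act_pt g z⟩
  obtain ⟨h', H⟩ := exists_cuspNe 1
  obtain ⟨h'', H', H''⟩ := exists_cuspNe_cuspNe H
  obtain ⟨z₁, hz₁⟩ := boundaryComponent_nonempty 1
  obtain ⟨z₂, hz₂⟩ := boundaryComponent_nonempty h'
  obtain ⟨z₃, hz₃⟩ := boundaryComponent_nonempty h''
  have hli := linearIndependent_pt (π := π) H H' H'' hz₁ hz₂ hz₃
  -- Two successive midpoints give a fixed point with all three coordinates nonzero, which forces
  -- the three eigenvalues to agree.
  obtain ⟨γ, -, hγ, -⟩ := π.exists_segment z₁ z₂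
  obtain ⟨δ, -, hδ, -⟩ := π.exists_segment (γ ⟨1 / 2, by norm_num, by norm_num⟩) z₃
  obtain ⟨c₁, e₁⟩ := hfix z₁
  obtain ⟨c₂, e₂⟩ := hfix z₂
  obtain ⟨c₃, e₃⟩ := hfix z₃
  obtain ⟨c, e⟩ := hfix (δ ⟨1 / 2, by norm_num, by norm_num⟩)
  rw [hδ, hγ] at e
  simp only [map_add, map_smul, e₁, e₂, e₃] at e
  have e' : ((c₁ - c) / 4) • π.pt z₁ + ((c₂ - c) / 4) • π.pt z₂ + ((c₃ - c) / 2) • π.pt z₃ = 0 := by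
    rw [← sub_eq_zero] at e
    rw [← e]
    module
  obtain ⟨k₁, k₂, k₃⟩ := linearIndependent_triple_iff.1 hli _ _ _ e'
  obtain rfl : c₁ = c := by linarith
  obtain rfl : c₂ = c₁ := by linarith
  obtain rfl : c₃ = c₂ := by linarith
  have hw := π.wedge_act g (π.pt z₁) (π.pt z₂) (π.pt z₃)
  rw [e₁, e₂, e₃] at hw
  have hw' : wedge (c₃ • π.pt z₁) (c₃ • π.pt z₂) (c₃ • π.pt z₃) =
      c₃ ^ 3 * wedge (π.pt z₁) (π.pt z₂) (π.pt z₃) := by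
    simp only [wedge_eq, Pi.smul_apply, smul_eq_mul]
    ring
  rw [hw'] at hw
  have hc3 : c₃ ^ 3 = 1 := by
    have := wedge_ne_zero_iff.2 hli
    exact mul_right_cancel₀ this (by linarith)
  have hc : c₃ = 1 := by
    have : (c₃ - 1) * (c₃ ^ 2 + c₃ + 1) = 0 := by linarith
    rcases mul_eq_zero.1 this with h | h
    · linarith
    · nlinarith [sq_nonneg (c₃ + 1 / 2)]
  subst hc
  obtain ⟨ξ, η, ζ, hx, -⟩ := exists_dual_basis hli
  rw [hx v]
  simp [e₁, e₂, e₃]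

/-- The monodromy of the parabolic elements at the cusp `h⁻¹ ∞` is hyperbolic. -/
def HypAt (h : SL(2, ℤ)) : Prop := ∃ l m n, HasSpectrum (π.hol (parab h)) l m n

variable {π}

lemma HypAt.exists_eigenBasis {h : SL(2, ℤ)} (hh : π.HypAt h) :
    ∃ l m n r u w ξ η ζ, EigenBasis (π.act (parab h)) l m n r u w ξ η ζ := by
  obtain ⟨l, m, n, hs⟩ := hh
  exact ⟨l, m, n, hs.exists_eigenBasis⟩

/-- If the cone went to its opposite, the even powers would still give `ζ * f w ≥ 0` on the image,
while a single application of the monodromy reverses this sign although `n > 0`. So the product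
vanishes for every support `f`, which is impossible as the image spans and the supports have no
common zero. -/
lemma HypAt.preserves {h : SL(2, ℤ)} (hh : π.HypAt h) : π.Preserves (parab h) := by
  refine (preserves_or _).resolve_right fun hneg => ?_
  obtain ⟨l, m, n, r, u, w, ξ, η, ζ, E⟩ := hh.exists_eigenBasis
  have hsq : π.Preserves (parab h ^ 2) := by
    intro z
    rw [pow_two, chart_act_mul]
    exact mul_pos_of_neg_of_neg (hneg _) (hneg _)
  have key : ∀ {h' : SL(2, ℤ)} {f : V →ₗ[ℝ] ℝ}, π.IsSupport h' f → ∀ z, ζ (π.pt z) * f w = 0 := by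
    intro h' f hf
    have hnn : ∀ z, 0 ≤ ζ (π.pt z) * f w := by
      intro z
      refine nonneg_of_forall_pow (l := l ^ 2) (m := m ^ 2) (n := n ^ 2)
        (a := ξ (π.pt z) * f r) (b := η (π.pt z) * f u) (pow_pos E.l_pos 2)
        (pow_lt_pow_left₀ E.l_lt E.l_pos.le two_ne_zero)
        (pow_lt_pow_left₀ E.m_lt E.m_pos.le two_ne_zero) fun k => ?_
      have h1 := hf.nonneg_act (hsq.pow k) z
      rw [← pow_mul, act_pow, E.pow_eq] at h1
      simp only [map_add, map_smul, smul_eq_mul] at h1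
      rw [← pow_mul, ← pow_mul, ← pow_mul]
      linarith
    intro z
    have h1 := E.ζ_map (π.pt z)
    rw [act_pt, map_smul, smul_eq_mul] at h1
    have h2 := hnn z
    have h3 := hnn (parab h • z)
    have h4 := hneg z
    have h5 : n * (ζ (π.pt z) * f w) =
        π.chart (π.act (parab h) (π.pt z)) * (ζ (π.pt (parab h • z)) * f w) := by
      rw [← mul_assoc, ← h1, mul_assoc]
    have h6 := mul_nonpos_of_nonpos_of_nonneg h4.le h3
    have h7 : n * (ζ (π.pt z) * f w) ≤ 0 := by rw [h5]; exact h6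
    exact le_antisymm (nonpos_of_mul_nonpos_right h7 E.n_pos) h2
  obtain ⟨h', H⟩ := exists_cuspNe h
  obtain ⟨h'', H', H''⟩ := exists_cuspNe_cuspNe H
  obtain ⟨z₁, hz₁⟩ := boundaryComponent_nonempty h
  obtain ⟨z₂, hz₂⟩ := boundaryComponent_nonempty h'
  obtain ⟨z₃, hz₃⟩ := boundaryComponent_nonempty h''
  have hli := linearIndependent_pt (π := π) H H' H'' hz₁ hz₂ hz₃
  obtain ⟨f₁, hf₁⟩ := π.exists_isSupport h
  obtain ⟨f₂, hf₂⟩ := π.exists_isSupport h'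
  obtain ⟨f₃, hf₃⟩ := π.exists_isSupport h''
  by_cases hz : ∃ z, ζ (π.pt z) ≠ 0
  · obtain ⟨z, hz⟩ := hz
    refine E.w_ne_zero (eq_zero_of_isSupport H H' H'' hf₁ hf₂ hf₃ ?_ ?_ ?_)
    · exact (mul_eq_zero.1 (key hf₁ z)).resolve_left hz
    · exact (mul_eq_zero.1 (key hf₂ z)).resolve_left hz
    · exact (mul_eq_zero.1 (key hf₃ z)).resolve_left hz
  · push Not at hz
    have h0 := eq_zero_of_three_zeros hli (hz z₁) (hz z₂) (hz z₃)
    have := E.ζw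
    simp [h0] at this

end ConvexProjectiveStructure

end Pants

/-! ### Fixed points and principal lines of a boundary component. -/

namespace Pants

namespace ConvexProjectiveStructure

variable {π : ConvexProjectiveStructure}

/-- The line of a boundary component does not contain fixed points of the monodromy of another
boundary component. -/
lemma IsSupport.ne_zero_of_eigenvector {h h' : SL(2, ℤ)} (hh : π.HypAt h) (H : CuspNe h h')
    {f : V →ₗ[ℝ] ℝ} (hf : π.IsSupport h' f) {e : V} {c : ℝ} (he : e ≠ 0)
    (hc : π.act (parab h) e = c • e) : f e ≠ 0 := by
  intro h0
  have hc0 : c ≠ 0 := by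
    rintro rfl
    rw [zero_smul] at hc
    exact he (π.act_eq_zero hc)
  have hinv : π.act (parab h)⁻¹ e = c⁻¹ • e := by
    rw [eq_inv_smul_iff₀ hc0, ← map_smul, ← hc, act_inv_act]
  -- The supports `f`, `f ∘ A`, `f ∘ A⁻¹` belong to three different components, and all would vanish
  -- at the eigenvector.
  have s0 := H.mul_parab_zpow (i := 0) (j := 1) (by norm_num)
  have s1 := H.mul_parab_zpow (i := 0) (j := -1) (by norm_num)
  have s2 := H.mul_parab_zpow (i := 1) (j := -1) (by norm_num)
  have e1 := hf.comp_act hh.preserves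
  have e2 := hf.comp_act hh.preserves.inv
  simp only [zpow_zero, zpow_one, zpow_neg, Subgroup.coe_one, mul_one] at s0 s1 s2
  refine he (eq_zero_of_isSupport s0 s1 s2 hf e1 e2 h0 ?_ ?_)
  · rw [LinearMap.comp_apply, hc, map_smul, h0, smul_zero]
  · rw [LinearMap.comp_apply, hinv, map_smul, h0, smul_zero]

lemma pt_not_eigenvector (h : SL(2, ℤ)) (z : Cover) (c : ℝ) :
    π.act (parab h) (π.pt z) ≠ c • π.pt z := by
  intro hc
  have h1 := hc
  rw [act_pt] at h1
  have h2 := congrArg π.chart h1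
  simp only [map_smul, chart_pt, smul_eq_mul, mul_one] at h2
  rw [h2] at h1
  have hc0 : c ≠ 0 := by
    rw [← h2]
    exact π.chart_act_ne_zero _ _
  exact parab_smul_ne h z (π.pt_injective (smul_right_injective _ hc0 h1))

/-- A left eigenvector vanishing on the component `h'` is proportional to its support and also
vanishes on the translate of that component. The support is positive on the translate, so the factor
is `0`. -/
lemma exists_pt_ne_zero {h h' : SL(2, ℤ)} (hh : π.HypAt h) (H : CuspNe h h') {ψ : V →ₗ[ℝ] ℝ} {c : ℝ}
    (hψ : ∀ x, ψ (π.act (parab h) x) = c * ψ x) (h0 : ψ ≠ 0) :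
    ∃ z ∈ boundaryComponent h', ψ (π.pt z) ≠ 0 := by
  by_contra! hcon
  obtain ⟨z, hz⟩ := boundaryComponent_nonempty h'
  obtain ⟨f, hf⟩ := π.exists_isSupport h'
  have hz' : parab h' • z ∈ boundaryComponent h' := by
    simpa using (smul_parab_mem h' 1).2 hz
  have hli := linearIndependent_pt_pair (π := π) (parab_smul_ne h' z).symm
  have hfA := hf.comp_act hh.preserves
  have hpos : 0 < f (π.act (parab h) (π.pt z)) := by
    have := hfA.pos_of_cuspNe (h' := h') ?_ hz
    · simpa using this
    · have := H.mul_parab_zpow (i := 1) (j := 0) (by norm_num)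
      simpa using this
  refine h0 ?_
  have := eq_smul_of_common_zeros (g := ψ) hli (hf.zero _ hz) (hf.zero _ hz') (hcon _ hz)
    (hcon _ hz') hpos.ne'
  rw [this, hψ, hcon z hz, mul_zero, zero_div, zero_smul]

variable (π) in
/-- The fixed points of the monodromy at a cusp, with signs such that the repelling and the
attracting fixed points lie in the closure of the cone over the image of the developing map, and
the functional `η`, which vanishes at these two points, is positive on the other boundary
components. -/
structure Frame (h : SL(2, ℤ)) where
  (l m n : ℝ)
  (r u w : V)
  (ξ η ζ : V →ₗ[ℝ] ℝ)
  eigen : EigenBasis (π.act (parab h)) l m n r u w ξ η ζ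
  hyp : π.HypAt h
  nonneg_r : ∀ {h' f}, π.IsSupport h' f → 0 ≤ f r
  nonneg_w : ∀ {h' f}, π.IsSupport h' f → 0 ≤ f w
  nonpos : ∀ z ∈ boundaryComponent h, η (π.pt z) ≤ 0
  pos : ∀ {h'}, CuspNe h h' → ∀ z ∈ boundaryComponent h', 0 < η (π.pt z)

section Existence

variable {h : SL(2, ℤ)} {l m n : ℝ} {r u w : V} {ξ η ζ : V →ₗ[ℝ] ℝ}

lemma HypAt.nonneg_w (hh : π.HypAt h) (E : EigenBasis (π.act (parab h)) l m n r u w ξ η ζ)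
    {h' : SL(2, ℤ)} {f : V →ₗ[ℝ] ℝ} (hf : π.IsSupport h' f) (z : Cover) :
    0 ≤ ζ (π.pt z) * f w := by
  refine E.nonneg_top fun k => ?_
  rw [← act_pow]
  exact hf.nonneg_act (hh.preserves.pow k) z

lemma HypAt.nonneg_u_of_ζ (hh : π.HypAt h) (E : EigenBasis (π.act (parab h)) l m n r u w ξ η ζ)
    {h' : SL(2, ℤ)} {f : V →ₗ[ℝ] ℝ} (hf : π.IsSupport h' f) (z : Cover) (h0 : ζ (π.pt z) = 0) :
    0 ≤ η (π.pt z) * f u := by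
  refine E.nonneg_mid (fun k => ?_) h0
  rw [← act_pow]
  exact hf.nonneg_act (hh.preserves.pow k) z

lemma HypAt.nonneg_r (hh : π.HypAt h) (E : EigenBasis (π.act (parab h)) l m n r u w ξ η ζ)
    {h' : SL(2, ℤ)} {f : V →ₗ[ℝ] ℝ} (hf : π.IsSupport h' f) (z : Cover) :
    0 ≤ ξ (π.pt z) * f r := by
  refine (E.symm (π.act_inv_act _)).nonneg_top fun k => ?_
  rw [← act_pow]
  exact hf.nonneg_act (hh.preserves.inv.pow k) z

lemma HypAt.nonneg_u_of_ξ (hh : π.HypAt h) (E : EigenBasis (π.act (parab h)) l m n r u w ξ η ζ)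
    {h' : SL(2, ℤ)} {f : V →ₗ[ℝ] ℝ} (hf : π.IsSupport h' f) (z : Cover) (h0 : ξ (π.pt z) = 0) :
    0 ≤ η (π.pt z) * f u := by
  refine (E.symm (π.act_inv_act _)).nonneg_mid (fun k => ?_) h0
  rw [← act_pow]
  exact hf.nonneg_act (hh.preserves.inv.pow k) z

/-- The case in which the boundary component is not the segment between the repelling and the
attracting fixed point. -/
lemma exists_frame_of_nonprincipal (hh : π.HypAt h)
    (E : EigenBasis (π.act (parab h)) l m n r u w ξ η ζ)
    (hr : ∀ {h' f}, π.IsSupport h' f → 0 ≤ f r) (hw : ∀ {h' f}, π.IsSupport h' f → 0 ≤ f w)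
    (hu : ∀ z ∈ boundaryComponent h, ∀ {h' f}, π.IsSupport h' f → 0 ≤ η (π.pt z) * f u)
    {q : Cover} (hq : q ∈ boundaryComponent h) (hq0 : η (π.pt q) ≠ 0)
    (hpos : ∀ {h'}, CuspNe h h' → ∀ z ∈ boundaryComponent h', 0 < ξ (π.pt z) ∨ 0 < ζ (π.pt z)) :
    Nonempty (π.Frame h) := by
  have hr' : ∀ {h' f}, CuspNe h h' → π.IsSupport h' f → 0 < f r := fun H hf =>
    lt_of_le_of_ne (hr hf) (hf.ne_zero_of_eigenvector hh H E.r_ne_zero E.map_r).symm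
  have hw' : ∀ {h' f}, CuspNe h h' → π.IsSupport h' f → 0 < f w := fun H hf =>
    lt_of_le_of_ne (hw hf) (hf.ne_zero_of_eigenvector hh H E.w_ne_zero E.map_w).symm
  have hu' : ∀ {h' f}, CuspNe h h' → π.IsSupport h' f → 0 < η (π.pt q) * f u := fun H hf =>
    lt_of_le_of_ne (hu q hq hf)
      (mul_ne_zero hq0 (hf.ne_zero_of_eigenvector hh H E.u_ne_zero E.map_u)).symm
  have hξ : ∀ z, 0 ≤ ξ (π.pt z) := by
    intro z
    obtain ⟨h', H⟩ := exists_cuspNe h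
    obtain ⟨f, hf⟩ := π.exists_isSupport h'
    exact nonneg_of_mul_nonneg_left (hh.nonneg_r E hf z) (hr' H hf)
  have hζ : ∀ z, 0 ≤ ζ (π.pt z) := by
    intro z
    obtain ⟨h', H⟩ := exists_cuspNe h
    obtain ⟨f, hf⟩ := π.exists_isSupport h'
    exact nonneg_of_mul_nonneg_left (hh.nonneg_w E hf z) (hw' H hf)
  -- Scaling `u` by `-η (pt q)` replaces `η` by `-η / η (pt q)`, which is `-1` at `q`.
  have E' := E.rescale (a := 1) (c := 1) one_ne_zero (neg_ne_zero.2 hq0) one_ne_zero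
  refine ⟨⟨l, m, n, _, _, _, _, _, _, E', hh, fun hf => ?_, fun hf => ?_, fun z hz => ?_,
    fun {h'} H z hz => ?_⟩⟩
  · simpa using hr hf
  · simpa using hw hf
  · obtain ⟨h', H⟩ := exists_cuspNe h
    obtain ⟨f, hf⟩ := π.exists_isSupport h'
    have h1 := hu z hz hf
    have h2 := hu' H hf
    have h3 : 0 ≤ η (π.pt z) * (η (π.pt q))⁻¹ := by
      have h4 : 0 ≤ (η (π.pt z) * (η (π.pt q))⁻¹) * (η (π.pt q) * f u) := by
        have : (η (π.pt z) * (η (π.pt q))⁻¹) * (η (π.pt q) * f u) = η (π.pt z) * f u := by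
          field_simp
        rwa [this]
      exact nonneg_of_mul_nonneg_left h4 h2
    simp only [LinearMap.smul_apply, smul_eq_mul, inv_neg]
    linarith
  · obtain ⟨f, hf⟩ := π.exists_isSupport h'
    -- On the component `h'` its support gives `ξ f(r) + η f(u) + ζ f(w) = 0`. The outer terms have
    -- positive sum, so `η f(u)` is negative there, whereas it is positive at `q`.
    have h1 := E.map_expand f (π.pt z)
    rw [hf.zero z hz] at h1
    have h2 := hu' H hf
    have h3 := hr' H hf
    have h4 := hw' H hf
    have h5 : 0 < ξ (π.pt z) * f r + ζ (π.pt z) * f w := by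
      rcases hpos H z hz with h6 | h6
      · exact add_pos_of_pos_of_nonneg (mul_pos h6 h3) (mul_nonneg (hζ z) h4.le)
      · exact add_pos_of_nonneg_of_pos (mul_nonneg (hξ z) h3.le) (mul_pos h6 h4)
    have h6 : η (π.pt z) * f u < 0 := by linarith
    have h7 : (η (π.pt q))⁻¹ * η (π.pt z) * (η (π.pt q) * f u) < 0 := by
      have : (η (π.pt q))⁻¹ * η (π.pt z) * (η (π.pt q) * f u) = η (π.pt z) * f u := by field_simp
      rwa [this]
    have h8 : (η (π.pt q))⁻¹ * η (π.pt z) < 0 := by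
      by_contra! h9
      exact absurd (mul_nonneg h9 h2.le) (not_le.2 h7)
    simp only [LinearMap.smul_apply, smul_eq_mul, inv_neg]
    linarith

/-- The monodromy preserves the boundary component, so the support of this component is a left
eigenvector and hence a multiple of `η`, `ζ` or `ξ`. The first case is the principal one; in the
others the component lies on the line through `u` and one of `r`, `w`. -/
lemma HypAt.nonempty_frame (hh : π.HypAt h) : Nonempty (π.Frame h) := by
  obtain ⟨l, m, n, r, u, w, ξ, η, ζ, E⟩ := hh.exists_eigenBasis
  obtain ⟨h', H⟩ := exists_cuspNe h
  have hξ0 : ξ ≠ 0 := fun h0 => by simpa [h0] using E.ξr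
  have hζ0 : ζ ≠ 0 := fun h0 => by simpa [h0] using E.ζw
  obtain ⟨z₁, -, hz₁⟩ := exists_pt_ne_zero hh H E.ξ_map hξ0
  obtain ⟨z₂, -, hz₂⟩ := exists_pt_ne_zero hh H E.ζ_map hζ0
  have hr : ∀ {h' f}, π.IsSupport h' f → 0 ≤ f (ξ (π.pt z₁) • r) := fun hf => by
    simpa using hh.nonneg_r E hf z₁
  have hw : ∀ {h' f}, π.IsSupport h' f → 0 ≤ f (ζ (π.pt z₂) • w) := fun hf => by
    simpa using hh.nonneg_w E hf z₂
  -- The coordinates of points of the image fix the signs of `r` and `w`, placing them on the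
  -- nonnegative side of every support.
  replace E := E.rescale (b := 1) hz₁ one_ne_zero hz₂
  generalize ξ (π.pt z₁) • r = r at *
  generalize ζ (π.pt z₂) • w = w at *
  generalize (1 : ℝ) • u = u at *
  generalize (ξ (π.pt z₁))⁻¹ • ξ = ξ at *
  generalize (ζ (π.pt z₂))⁻¹ • ζ = ζ at *
  generalize (1 : ℝ)⁻¹ • η = η at *
  clear hξ0 hζ0 hz₁ hz₂ z₁ z₂
  obtain ⟨f, hf⟩ := π.exists_isSupport h
  obtain ⟨q, hq⟩ := boundaryComponent_nonempty h
  have hq' : parab h • q ∈ boundaryComponent h := by simpa using (smul_parab_mem h 1).2 hq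
  obtain ⟨p, hp⟩ := boundaryComponent_nonempty h'
  have hfA := hf.comp_act hh.preserves
  have hcomp : boundaryComponent (h * (parab h : SL(2, ℤ))) = boundaryComponent h := by
    ext z
    rw [← smul_mem_boundaryComponent]
    simpa using smul_parab_mem h 1
  have hfp : f (π.pt p) ≠ 0 := (hf.pos_of_cuspNe H hp).ne'
  have heig := eq_smul_of_common_zeros (g := f ∘ₗ π.act (parab h))
    (linearIndependent_pt_pair (π := π) (parab_smul_ne h q).symm) (hf.zero _ hq) (hf.zero _ hq')
    (hfA.zero _ (by rwa [hcomp])) (hfA.zero _ (by rwa [hcomp])) hfp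
  set c := (f ∘ₗ π.act (parab h)) (π.pt p) / f (π.pt p)
  have hr' := congrArg (fun g : V →ₗ[ℝ] ℝ => g r) heig
  have hu' := congrArg (fun g : V →ₗ[ℝ] ℝ => g u) heig
  have hw' := congrArg (fun g : V →ₗ[ℝ] ℝ => g w) heig
  simp only [LinearMap.comp_apply, LinearMap.smul_apply, E.map_r, E.map_u, E.map_w, map_smul,
    smul_eq_mul] at hr' hu' hw'
  have hlm := E.l_lt
  have hmn := E.m_lt
  have hexp := E.map_expand f
  by_cases hr0 : f r = 0
  · by_cases hw0 : f w = 0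
    · have hfη : ∀ x, f x = f u * η x := fun x => by rw [hexp, hr0, hw0]; ring
      have hu0 : f u ≠ 0 := fun h0 => hfp (by rw [hfη, h0, zero_mul])
      have E' := E.rescale (a := 1) (c := 1) one_ne_zero (inv_ne_zero hu0) one_ne_zero
      refine ⟨⟨l, m, n, _, _, _, _, _, _, E', hh, fun hf => ?_, fun hf => ?_, fun z hz => ?_,
        fun {h'} H z hz => ?_⟩⟩
      · simpa using hr hf
      · simpa using hw hf
      · simp only [inv_inv, LinearMap.smul_apply, smul_eq_mul, ← hfη]
        exact (hf.zero z hz).le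
      · simp only [inv_inv, LinearMap.smul_apply, smul_eq_mul, ← hfη]
        exact hf.pos_of_cuspNe H hz
    · have hc : n = c := mul_right_cancel₀ hw0 hw'
      have hu0 : f u = 0 := by
        by_contra h0
        exact absurd (mul_right_cancel₀ h0 hu') (by rw [← hc]; exact hmn.ne)
      have hfζ : ∀ x, f x = f w * ζ x := fun x => by rw [hexp, hr0, hu0]; ring
      have hzero : ∀ z ∈ boundaryComponent h, ζ (π.pt z) = 0 := fun z hz => by
        have := hf.zero z hz
        rw [hfζ] at this
        exact (mul_eq_zero.1 this).resolve_left hw0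
      refine exists_frame_of_nonprincipal hh E hr hw
        (fun z hz _ _ hf => hh.nonneg_u_of_ζ E hf z (hzero z hz)) hq (fun h0 => ?_)
        (fun H z hz => ?_)
      -- If `η` vanished too, `q` would map to the repelling fixed point, but the parabolic element
      -- acts freely on the cover.
      · apply pt_not_eigenvector (π := π) h q l
        rw [E.map_eq, h0, hzero q hq]
        conv_rhs => rw [E.expand (π.pt q), h0, hzero q hq]
        module
      · have := hf.pos_of_cuspNe H hz
        rw [hfζ] at this
        exact Or.inr (pos_of_mul_pos_right this (hw hf))
  · have hc : l = c := mul_right_cancel₀ hr0 hr'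
    have hu0 : f u = 0 := by
      by_contra h0
      exact absurd (mul_right_cancel₀ h0 hu') (by rw [← hc]; exact hlm.ne')
    have hw0 : f w = 0 := by
      by_contra h0
      exact absurd (mul_right_cancel₀ h0 hw') (by rw [← hc]; exact (hlm.trans hmn).ne')
    have hfξ : ∀ x, f x = f r * ξ x := fun x => by rw [hexp, hw0, hu0]; ring
    have hzero : ∀ z ∈ boundaryComponent h, ξ (π.pt z) = 0 := fun z hz => by
      have := hf.zero z hz
      rw [hfξ] at this
      exact (mul_eq_zero.1 this).resolve_left hr0
    refine exists_frame_of_nonprincipal hh E hr hw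
      (fun z hz _ _ hf => hh.nonneg_u_of_ξ E hf z (hzero z hz)) hq (fun h0 => ?_)
      (fun H z hz => ?_)
    · apply pt_not_eigenvector (π := π) h q n
      rw [E.map_eq, h0, hzero q hq]
      conv_rhs => rw [E.expand (π.pt q), h0, hzero q hq]
      module
    · have := hf.pos_of_cuspNe H hz
      rw [hfξ] at this
      exact Or.inl (pos_of_mul_pos_right this (hr hf))

end Existence

end ConvexProjectiveStructure

end Pants

/-! ### Relative position of principal lines and fixed points at different cusps. -/

namespace Pants

lemma hasEigenvalue_conj {M N : SL(3, ℝ)} {x : ℝ}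
    (h : Module.End.HasEigenvalue (Matrix.toLin' M.1) x) :
    Module.End.HasEigenvalue (Matrix.toLin' (N * M * N⁻¹).1) x := by
  obtain ⟨v, hv⟩ := h.exists_hasEigenvector
  have hinv : ∀ y : V, Matrix.toLin' (N⁻¹).1 (Matrix.toLin' N.1 y) = y := by
    intro y
    rw [← LinearMap.comp_apply, ← Matrix.toLin'_mul]
    have : (N⁻¹).1 * N.1 = 1 := congrArg Subtype.val (inv_mul_cancel N)
    rw [this]
    simp
  refine Module.End.hasEigenvalue_of_hasEigenvector (x := Matrix.toLin' N.1 v) ⟨?_, fun h0 => ?_⟩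
  · rw [Module.End.mem_eigenspace_iff]
    change Matrix.toLin' (N.1 * M.1 * (N⁻¹).1) _ = _
    rw [Matrix.toLin'_mul, Matrix.toLin'_mul, LinearMap.comp_apply, LinearMap.comp_apply, hinv,
      hv.apply_eq_smul, map_smul]
  · have := hinv v
    rw [h0, map_zero] at this
    exact hv.2 this.symm

lemma HasSpectrum.conj {M : SL(3, ℝ)} {l m n : ℝ} (h : HasSpectrum M l m n) (N : SL(3, ℝ)) :
    HasSpectrum (N * M * N⁻¹) l m n :=
  ⟨h.1, h.2.1, h.2.2.1, hasEigenvalue_conj h.2.2.2.1, hasEigenvalue_conj h.2.2.2.2.1,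
    hasEigenvalue_conj h.2.2.2.2.2⟩

lemma EigenBasis.conj {A : V →ₗ[ℝ] V} {l m n : ℝ} {r u w : V} {ξ η ζ : V →ₗ[ℝ] ℝ}
    (E : EigenBasis A l m n r u w ξ η ζ) {A' B C : V →ₗ[ℝ] V} (hBC : ∀ x, B (C x) = x)
    (hCB : ∀ x, C (B x) = x) (hA' : ∀ x, A' x = C (A (B x))) :
    EigenBasis A' l m n (C r) (C u) (C w) (ξ ∘ₗ B) (η ∘ₗ B) (ζ ∘ₗ B) where
  l_pos := E.l_pos
  l_lt := E.l_lt
  m_lt := E.m_lt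
  map_r := by rw [hA', hBC, E.map_r, map_smul]
  map_u := by rw [hA', hBC, E.map_u, map_smul]
  map_w := by rw [hA', hBC, E.map_w, map_smul]
  expand x := by
    rw [LinearMap.comp_apply, LinearMap.comp_apply, LinearMap.comp_apply, ← map_smul, ← map_smul,
      ← map_smul, ← map_add, ← map_add, ← E.expand, hCB]
  ξr := by rw [LinearMap.comp_apply, hBC, E.ξr]
  ξu := by rw [LinearMap.comp_apply, hBC, E.ξu]
  ξw := by rw [LinearMap.comp_apply, hBC, E.ξw]
  ηr := by rw [LinearMap.comp_apply, hBC, E.ηr]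
  ηu := by rw [LinearMap.comp_apply, hBC, E.ηu]
  ηw := by rw [LinearMap.comp_apply, hBC, E.ηw]
  ζr := by rw [LinearMap.comp_apply, hBC, E.ζr]
  ζu := by rw [LinearMap.comp_apply, hBC, E.ζu]
  ζw := by rw [LinearMap.comp_apply, hBC, E.ζw]

namespace ConvexProjectiveStructure

variable {π : ConvexProjectiveStructure}

lemma HypAt.mul {h : SL(2, ℤ)} (hh : π.HypAt h) (g : Γ) : π.HypAt (h * g) := by
  obtain ⟨l, m, n, hs⟩ := hh
  refine ⟨l, m, n, ?_⟩
  rw [parab_mul, map_mul, map_mul, map_inv]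
  simpa using hs.conj (π.hol g)⁻¹

namespace Frame

variable {h h' : SL(2, ℤ)} (F : π.Frame h) (F' : π.Frame h')

/-- The frame at a translated cusp. -/
def translate {g : Γ} (hg : π.Preserves g) : π.Frame (h * g) where
  l := F.l
  m := F.m
  n := F.n
  r := π.act g⁻¹ F.r
  u := π.act g⁻¹ F.u
  w := π.act g⁻¹ F.w
  ξ := F.ξ ∘ₗ π.act g
  η := F.η ∘ₗ π.act g
  ζ := F.ζ ∘ₗ π.act g
  hyp := F.hyp.mul g
  eigen := F.eigen.conj (fun x => π.act_act_inv g x) (fun x => π.act_inv_act g x) fun x => by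
    rw [parab_mul, act_mul, act_mul]
  nonneg_r hf := F.nonneg_r (hf.comp_act hg.inv)
  nonneg_w hf := F.nonneg_w (hf.comp_act hg.inv)
  nonpos z hz := by
    rw [LinearMap.comp_apply, act_pt, map_smul]
    exact mul_nonpos_of_nonneg_of_nonpos (hg z).le
      (F.nonpos _ ((smul_mem_boundaryComponent g).2 hz))
  pos {k} H z hz := by
    rw [LinearMap.comp_apply, act_pt, map_smul]
    refine mul_pos (hg z) (F.pos (h' := k * ((g⁻¹ : Γ) : SL(2, ℤ))) ?_ _
      ((smul_mem_boundaryComponent g).2 (by simpa using hz)))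
    simpa using H.mul_right ((g⁻¹ : Γ) : SL(2, ℤ))

variable {F F'}

lemma pos_r (H : CuspNe h h') {f : V →ₗ[ℝ] ℝ} (hf : π.IsSupport h' f) : 0 < f F.r :=
  lt_of_le_of_ne (F.nonneg_r hf)
    (hf.ne_zero_of_eigenvector F.hyp H F.eigen.r_ne_zero F.eigen.map_r).symm

lemma pos_w (H : CuspNe h h') {f : V →ₗ[ℝ] ℝ} (hf : π.IsSupport h' f) : 0 < f F.w :=
  lt_of_le_of_ne (F.nonneg_w hf)
    (hf.ne_zero_of_eigenvector F.hyp H F.eigen.w_ne_zero F.eigen.map_w).symm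

lemma ξ_pt_nonneg (z : Cover) : 0 ≤ F.ξ (π.pt z) := by
  obtain ⟨h', H⟩ := exists_cuspNe h
  obtain ⟨f, hf⟩ := π.exists_isSupport h'
  exact nonneg_of_mul_nonneg_left (F.hyp.nonneg_r F.eigen hf z) (pos_r H hf)

lemma ζ_pt_nonneg (z : Cover) : 0 ≤ F.ζ (π.pt z) := by
  obtain ⟨h', H⟩ := exists_cuspNe h
  obtain ⟨f, hf⟩ := π.exists_isSupport h'
  exact nonneg_of_mul_nonneg_left (F.hyp.nonneg_w F.eigen hf z) (pos_w H hf)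

/-- Different boundary components have different principal lines. -/
lemma η_ne_smul (H : CuspNe h h') (c : ℝ) : F'.η ≠ c • F.η := by
  intro hc
  obtain ⟨k, H1, H2⟩ := exists_cuspNe_cuspNe H
  obtain ⟨p, hp⟩ := boundaryComponent_nonempty k
  have hcpos : 0 < c := by
    have h1 := F'.pos H2 p hp
    rw [hc, LinearMap.smul_apply, smul_eq_mul] at h1
    exact pos_of_mul_pos_left h1 (F.pos H1 p hp).le
  -- If the lines coincided, `A'` would preserve the sign of `η`. But `A'` moves the component `h`,
  -- where `η ≤ 0`, onto another one, where `η > 0`.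
  obtain ⟨z, hz⟩ := boundaryComponent_nonempty h
  have h1 := F'.eigen.η_map (π.pt z)
  rw [act_pt, map_smul, hc] at h1
  simp only [LinearMap.smul_apply, smul_eq_mul] at h1
  have h2 : 0 < F.η (π.pt (parab h' • z)) := by
    refine F.pos (h' := h * (((parab h') ^ (-1 : ℤ) : Γ) : SL(2, ℤ))) ?_ _ ?_
    · simpa using H.symm.mul_parab_zpow (i := 0) (j := -1) (by norm_num)
    · rw [smul_mem_boundaryComponent]
      simpa using hz
  have h3 := F.nonpos z hz
  have h4 := F'.hyp.preserves z
  have h5 : 0 < π.chart (π.act (parab h') (π.pt z)) * (c * F.η (π.pt (parab h' • z))) := by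
    positivity
  rw [h1] at h5
  nlinarith [mul_nonpos_of_nonneg_of_nonpos (mul_pos F'.eigen.m_pos hcpos).le h3]

lemma η_act_nonneg (hyp' : π.HypAt h') (H : CuspNe h h') {i j : ℤ} (hij : i ≠ j) {z : Cover}
    (hz : z ∈ boundaryComponent (h * ((parab h' ^ i : Γ) : SL(2, ℤ)))) :
    0 ≤ F.η (π.act (parab h' ^ j) (π.pt z)) := by
  rw [act_pt, map_smul]
  refine mul_nonneg ((hyp'.preserves.zpow j z)).le (F.pos (h' :=
    h * ((parab h' ^ (i - j) : Γ) : SL(2, ℤ))) ?_ _ ?_).le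
  · have := H.symm.mul_parab_zpow (i := 0) (j := i - j) (by lia)
    simpa using this
  · rw [smul_mem_boundaryComponent, mul_assoc, ← Subgroup.coe_mul, ← zpow_add]
    simpa using hz

/-- Points on the image of the component `h` under `A'` never return to it under further positive
powers of `A'`, so `η` stays nonnegative along the orbit, which tends to the attracting fixed point
when its `ζ'`-coordinate is nonzero. The exponent `-1` below selects this translate. -/
lemma η_w_nonneg (H : CuspNe h h') : 0 ≤ F.η F'.w := by
  have hζ0 : F'.ζ ≠ 0 := fun h0 => by simpa [h0] using F'.eigen.ζw
  have H' := H.symm.mul_parab_zpow_right (-1)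
  obtain ⟨z, hz, hne⟩ := exists_pt_ne_zero F'.hyp H' F'.eigen.ζ_map hζ0
  have h1 : 0 ≤ F'.ζ (π.pt z) * F.η F'.w := by
    refine F'.eigen.nonneg_top fun k => ?_
    rw [← act_pow, ← zpow_natCast]
    exact η_act_nonneg F'.hyp H (by lia) hz
  exact nonneg_of_mul_nonneg_right h1 (lt_of_le_of_ne (ζ_pt_nonneg z) hne.symm)

lemma η_r_nonneg (H : CuspNe h h') : 0 ≤ F.η F'.r := by
  have hξ0 : F'.ξ ≠ 0 := fun h0 => by simpa [h0] using F'.eigen.ξr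
  have H' := H.symm.mul_parab_zpow_right 1
  obtain ⟨z, hz, hne⟩ := exists_pt_ne_zero F'.hyp H' F'.eigen.ξ_map hξ0
  have h1 : 0 ≤ F'.ξ (π.pt z) * F.η F'.r := by
    refine (F'.eigen.symm (π.act_inv_act _)).nonneg_top fun k => ?_
    rw [← act_pow, inv_pow, ← zpow_natCast, ← zpow_neg]
    exact η_act_nonneg F'.hyp H (by lia) hz
  exact nonneg_of_mul_nonneg_right h1 (lt_of_le_of_ne (ξ_pt_nonneg z) hne.symm)

/-- `x` is one of the two fixed points on the principal line. -/
def IsEnd (F : π.Frame h) (x : V) : Prop := x = F.r ∨ x = F.w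

lemma IsEnd.η_eq_zero {x : V} (hx : F.IsEnd x) : F.η x = 0 := by
  rcases hx with rfl | rfl
  · exact F.eigen.ηr
  · exact F.eigen.ηw

lemma IsEnd.translate {x : V} (hx : F.IsEnd x) {g : Γ} (hg : π.Preserves g) :
    (F.translate hg).IsEnd (π.act g⁻¹ x) := by
  rcases hx with rfl | rfl
  · exact Or.inl rfl
  · exact Or.inr rfl

/-- If `η` vanished at `x`, both principal lines would pass through the distinct points `e` and `x`,
hence coincide. -/
lemma IsEnd.η_pos {x e : V} (hx : F'.IsEnd x) (H : CuspNe h h')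
    (hli : LinearIndependent ℝ ![e, x]) (he : F.η e = 0) (he' : F'.η e = 0) : 0 < F.η x := by
  refine lt_of_le_of_ne ?_ fun h0 => ?_
  · rcases hx with rfl | rfl
    · exact η_r_nonneg H
    · exact η_w_nonneg H
  · refine η_ne_smul (F := F) (F' := F') H _ (eq_smul_of_common_zeros hli he h0.symm he'
      hx.η_eq_zero (w := F.u) ?_)
    rw [F.eigen.ηu]
    exact one_ne_zero

lemma exists_isEnd (F : π.Frame h) {e : V} (he : e ≠ 0) :
    ∃ x, F.IsEnd x ∧ LinearIndependent ℝ ![e, x] := by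
  by_contra! hcon
  have h1 := hcon _ (Or.inl rfl)
  have h2 := hcon _ (Or.inr rfl)
  rw [LinearIndependent.pair_iff' he] at h1 h2
  push Not at h1 h2
  obtain ⟨a, ha⟩ := h1
  obtain ⟨b, hb⟩ := h2
  have h3 := F.eigen.ξr
  have h4 := F.eigen.ξw
  have h5 := F.eigen.ζw
  rw [← ha] at h3
  rw [← hb] at h4 h5
  have h6 := F.eigen.ζr
  rw [← ha] at h6
  simp only [map_smul, smul_eq_mul, mul_eq_zero] at h3 h4 h5 h6
  rcases h4 with h4 | h4
  · rw [h4] at h5; simp at h5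
  · rw [h4] at h3; simp at h3

/-- If the principal line of `h` passed through a fixed point `e` of `A'`, so would its translates
by `A'` and `A'⁻¹`. Endpoints different from `e` on these three lines satisfy the positivity
conditions of `eq_zero_of_supports`, so the lines cannot be concurrent. -/
lemma η_pos_of_eigenvector (H : CuspNe h h') {e : V} {c : ℝ} (he : e ≠ 0)
    (hc : π.act (parab h') e = c • e) (hnn : 0 ≤ F.η e) (hyp' : π.HypAt h') : 0 < F.η e := by
  refine lt_of_le_of_ne hnn fun h0 => ?_
  have hc0 : c ≠ 0 := by
    rintro rfl
    rw [zero_smul] at hc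
    exact he (π.act_eq_zero hc)
  have hinv : π.act (parab h')⁻¹ e = c⁻¹ • e := by
    rw [eq_inv_smul_iff₀ hc0, ← map_smul, ← hc, act_inv_act]
  obtain ⟨x, hx, hli⟩ := F.exists_isEnd he
  have s0 := H.symm.mul_parab_zpow (i := 0) (j := 1) (by norm_num)
  have s1 := H.symm.mul_parab_zpow (i := 0) (j := -1) (by norm_num)
  have s2 := H.symm.mul_parab_zpow (i := 1) (j := -1) (by norm_num)
  simp only [zpow_zero, zpow_one, zpow_neg, Subgroup.coe_one, mul_one] at s0 s1 s2
  have hg := hyp'.preserves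
  have hx1 := hx.translate hg
  have hx2 := hx.translate hg.inv
  have e1 : (F.translate hg).η e = 0 := by
    change F.η (π.act _ e) = 0
    rw [hc, map_smul, ← h0, smul_zero]
  have e2 : (F.translate hg.inv).η e = 0 := by
    change F.η (π.act _ e) = 0
    rw [hinv, map_smul, ← h0, smul_zero]
  have l1 : LinearIndependent ℝ ![e, π.act (parab h')⁻¹ x] := by
    rw [LinearIndependent.pair_iff] at hli ⊢
    intro s t hst
    have := congrArg (π.act (parab h')) hst
    simp only [map_add, map_smul, act_act_inv, hc, map_zero, smul_smul] at this
    have h3 := hli _ _ this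
    exact ⟨(mul_eq_zero.1 h3.1).resolve_right hc0, h3.2⟩
  have l2 : LinearIndependent ℝ ![e, π.act (parab h')⁻¹⁻¹ x] := by
    rw [LinearIndependent.pair_iff] at hli ⊢
    intro s t hst
    have := congrArg (π.act (parab h')⁻¹) hst
    simp only [map_add, map_smul, act_act_inv, hinv, map_zero, smul_smul] at this
    have h3 := hli _ _ this
    exact ⟨(mul_eq_zero.1 h3.1).resolve_right (inv_ne_zero hc0), h3.2⟩
  exact he (eq_zero_of_supports hx.η_eq_zero hx1.η_eq_zero hx2.η_eq_zero
    (hx1.η_pos s0 l1 h0.symm e1) (hx2.η_pos s1 l2 h0.symm e2) (hx.η_pos s0.symm hli e1 h0.symm)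
    (hx2.η_pos s2 l2 e1 e2) (hx.η_pos s1.symm hli e2 h0.symm) (hx1.η_pos s2.symm l1 e2 e1)
    h0.symm e1 e2)

/-- The principal line of a boundary component separates this boundary component from the fixed
points of the other ones. -/
lemma η_r_pos (H : CuspNe h h') : 0 < F.η F'.r :=
  η_pos_of_eigenvector H F'.eigen.r_ne_zero F'.eigen.map_r (η_r_nonneg H) F'.hyp

end Frame

end ConvexProjectiveStructure

end Pants

/-! ### The triangle of repelling fixed points and its neighbours. -/

namespace Pants

/-- A matrix that sends the fixed point of `bdry i` to `∞`. -/
def cusp : Fin 3 → SL(2, ℤ)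
  | 1 => 1
  | 2 => ⟨!![0, -1; 1, -1], by simp [Matrix.det_fin_two]⟩
  | 0 => ⟨!![0, -1; 1, 0], by simp [Matrix.det_fin_two]⟩

lemma parab_cusp (i : Fin 3) : parab (cusp i) = bdry i := by
  apply Subtype.ext
  change (cusp i)⁻¹ * (bdry 1).1 * cusp i = _
  apply Subtype.ext
  fin_cases i <;> decide +kernel

lemma cuspNe_cusp {i j : Fin 3} (hij : i ≠ j) : CuspNe (cusp i) (cusp j) := by
  unfold CuspNe
  revert hij
  fin_cases i <;> fin_cases j <;> decide +kernel

lemma cuspNe_translate (i j : Fin 3) :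
    CuspNe (cusp j) (cusp i * (((bdry (i + 1))⁻¹ : Γ) : SL(2, ℤ))) := by
  unfold CuspNe
  fin_cases i <;> fin_cases j <;> decide +kernel

lemma bdry_mul (i : Fin 3) : ((bdry (i + 2) * bdry (i + 1) * bdry i : Γ) : SL(2, ℤ)) = -1 := by
  apply Subtype.ext
  fin_cases i <;> decide +kernel

lemma EigenBasis.hasSpectrum {M : SL(3, ℝ)} {l m n : ℝ} {r u w : V} {ξ η ζ : V →ₗ[ℝ] ℝ}
    (E : EigenBasis (Matrix.toLin' M.1) l m n r u w ξ η ζ) : HasSpectrum M l m n :=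
  ⟨E.l_pos, E.l_lt, E.m_lt,
    Module.End.hasEigenvalue_of_hasEigenvector
      ⟨Module.End.mem_eigenspace_iff.2 E.map_r, E.r_ne_zero⟩,
    Module.End.hasEigenvalue_of_hasEigenvector
      ⟨Module.End.mem_eigenspace_iff.2 E.map_u, E.u_ne_zero⟩,
    Module.End.hasEigenvalue_of_hasEigenvector
      ⟨Module.End.mem_eigenspace_iff.2 E.map_w, E.w_ne_zero⟩⟩

lemma wedge_cyc (u v w : V) : wedge u v w = wedge v w u := by
  simp only [wedge_eq]; ring

lemma wedge_smul_left (c : ℝ) (u v w : V) : wedge (c • u) v w = c * wedge u v w := by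
  simp only [wedge_eq, Pi.smul_apply, smul_eq_mul]; ring

lemma wedge_smul_mid (c : ℝ) (u v w : V) : wedge u (c • v) w = c * wedge u v w := by
  simp only [wedge_eq, Pi.smul_apply, smul_eq_mul]; ring

lemma wedge_smul_right (c : ℝ) (u v w : V) : wedge u v (c • w) = c * wedge u v w := by
  simp only [wedge_eq, Pi.smul_apply, smul_eq_mul]; ring

/-- Measures the direction in which `A` turns the line through `r` and `x`; with `n > m` it depends
only on the sign of `η x * ζ x` and the orientation of the basis. -/
lemma EigenBasis.wedge_map {A : V →ₗ[ℝ] V} {l m n : ℝ} {r u w : V} {ξ η ζ : V →ₗ[ℝ] ℝ}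
    (E : EigenBasis A l m n r u w ξ η ζ) (x : V) :
    wedge r x (A x) = (n - m) * (η x * ζ x) * wedge r u w := by
  rw [E.map_eq]
  conv_lhs => rw [E.expand x]
  simp only [E.ξr, E.ξu, E.ξw, E.ηr, E.ηu, E.ηw, E.ζr, E.ζu, E.ζw, map_add, map_smul, smul_eq_mul]
  simp only [wedge_eq, Pi.add_apply, Pi.smul_apply, smul_eq_mul]
  ring

/-- A point of a convex curve through three other ones has exactly one negative coordinate with
respect to them. -/
lemma sign_coordinates {x y z a12 a13 a21 a23 a31 a32 b1 b2 b3 : ℝ} (h12 : 0 < a12) (h13 : 0 < a13)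
    (h21 : 0 < a21) (h23 : 0 < a23) (h31 : 0 < a31) (h32 : 0 < a32) (hb1 : 0 < b1) (hb2 : 0 < b2)
    (hb3 : 0 < b3) (h1 : 0 < y * a12 + z * a13) (h2 : 0 < x * a21 + z * a23)
    (h3 : 0 < x * a31 + y * a32) (h0 : x * b1 + y * b2 + z * b3 = 0) :
    (x < 0 ∧ 0 < y ∧ 0 < z) ∨ (0 < x ∧ y < 0 ∧ 0 < z) ∨ (0 < x ∧ 0 < y ∧ z < 0) := by
  have k1 : ∀ {p q a b : ℝ}, 0 < a → 0 < b → 0 < p * a + q * b → p ≤ 0 → 0 < q := by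
    intro p q a b ha hb h hp
    by_contra! hq
    nlinarith [mul_nonpos_of_nonpos_of_nonneg hp ha.le, mul_nonpos_of_nonpos_of_nonneg hq hb.le]
  have k2 : ∀ {p q a b : ℝ}, 0 < a → 0 < b → 0 < p * a + q * b → q ≤ 0 → 0 < p := by
    intro p q a b ha hb h hq
    exact k1 hb ha (by linarith) hq
  rcases lt_or_ge x 0 with hx | hx
  · exact Or.inl ⟨hx, k1 h31 h32 h3 hx.le, k1 h21 h23 h2 hx.le⟩
  rcases lt_or_ge y 0 with hy | hy
  · exact Or.inr (Or.inl ⟨k2 h31 h32 h3 hy.le, hy, k1 h12 h13 h1 hy.le⟩)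
  rcases lt_or_ge z 0 with hz | hz
  · exact Or.inr (Or.inr ⟨k2 h21 h23 h2 hz.le, k2 h12 h13 h1 hz.le, hz⟩)
  have e1 := mul_nonneg hx hb1.le
  have e2 := mul_nonneg hy hb2.le
  have e3 := mul_nonneg hz hb3.le
  have hx0 : x = 0 := by
    have : x * b1 = 0 := by linarith
    exact (mul_eq_zero.1 this).resolve_right hb1.ne'
  have hy0 : y = 0 := by
    have : y * b2 = 0 := by linarith
    exact (mul_eq_zero.1 this).resolve_right hb2.ne'
  rw [hx0, hy0] at h3
  simp at h3

namespace ConvexProjectiveStructure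

variable {π : ConvexProjectiveStructure}

lemma Frame.ζ_r_nonneg {h h' : SL(2, ℤ)} (F : π.Frame h) (F' : π.Frame h') : 0 ≤ F.ζ F'.r := by
  obtain ⟨k, H⟩ := exists_cuspNe h
  obtain ⟨f, hf⟩ := π.exists_isSupport k
  refine nonneg_of_mul_nonneg_left (F.eigen.nonneg_top (f := f) fun k => ?_) (Frame.pos_w H hf)
  rw [← act_pow]
  exact F'.nonneg_r (hf.comp_act (F.hyp.preserves.pow k))

/-- The monodromy of a boundary component moves the repelling fixed points of the other ones in the
same direction. -/
lemma Frame.wedge_mul_wedge_nonneg {h h' h'' : SL(2, ℤ)} (F : π.Frame h) (F' : π.Frame h')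
    (F'' : π.Frame h'') (H' : CuspNe h h') (H'' : CuspNe h h'') :
    0 ≤ wedge F.r F'.r (π.act (parab h) F'.r) * wedge F.r F''.r (π.act (parab h) F''.r) := by
  rw [F.eigen.wedge_map, F.eigen.wedge_map]
  have h1 := sub_pos.2 F.eigen.m_lt
  have h2 := mul_nonneg (η_r_pos (F := F) (F' := F') H').le (F.ζ_r_nonneg F')
  have h3 := mul_nonneg (η_r_pos (F := F) (F' := F'') H'').le (F.ζ_r_nonneg F'')
  have : 0 ≤ ((F.n - F.m) * (F.n - F.m)) * ((F.η F'.r * F.ζ F'.r) * (F.η F''.r * F.ζ F''.r)) *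
      (wedge F.r F.u F.w * wedge F.r F.u F.w) :=
    mul_nonneg (mul_nonneg (mul_self_nonneg _) (mul_nonneg h2 h3)) (mul_self_nonneg _)
  linarith

variable (π)

lemma hypAt_cusp (i : Fin 3) : π.HypAt (cusp i) := by
  unfold HypAt
  rw [parab_cusp]
  exact π.hyperbolic_boundary i

lemma act_relation (i : Fin 3) (x : V) :
    π.act (bdry (i + 2)) (π.act (bdry (i + 1)) (π.act (bdry i) x)) = x := by
  rw [← act_mul, ← act_mul]
  exact π.act_neg_one (bdry_mul i) x

/-- The positions of the vertices of the triangle `Δ₊` and of the adjacent triangles. -/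
theorem exists_vertices : ∃ (r : Fin 3 → V) (x y z : Fin 3 → ℝ),
    (∀ i, LinearIndependent ℝ ![r i, r (i + 1), r (i + 2)]) ∧
    (∀ i, ∃ l m n, HasSpectrum (π.hol (bdry i)) l m n ∧ π.act (bdry i) (r i) = l • r i) ∧
    (∀ i, π.act (bdry (i + 1)) (r i) = x i • r i + y i • r (i + 1) + z i • r (i + 2)) ∧
    ∀ i, x i < 0 ∧ 0 < y i ∧ 0 < z i := by
  let F : ∀ i, π.Frame (cusp i) := fun i => (π.hypAt_cusp i).nonempty_frame.some
  have hpres : ∀ i, π.Preserves (bdry i) := fun i => by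
    rw [← parab_cusp]; exact (π.hypAt_cusp i).preserves
  let G : ∀ i, π.Frame (cusp i * (((bdry (i + 1))⁻¹ : Γ) : SL(2, ℤ))) := fun i =>
    (F i).translate (hpres (i + 1)).inv
  have hne1 : ∀ i : Fin 3, i ≠ i + 1 := by decide
  have hne2 : ∀ i : Fin 3, i ≠ i + 2 := by decide
  have hne3 : ∀ i : Fin 3, i + 1 ≠ i + 2 := by decide
  have e12 : ∀ i : Fin 3, i + 1 + 1 = i + 2 := by decide
  have e21 : ∀ i : Fin 3, i + 2 + 1 = i := by decide
  have e22 : ∀ i : Fin 3, i + 2 + 2 = i + 1 := by decide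
  have e11 : ∀ i : Fin 3, i + 1 + 2 = i := by decide
  set r : Fin 3 → V := fun i => (F i).r with hr
  have hG : ∀ i, (G i).r = π.act (bdry (i + 1)) (r i) := fun i => by
    change π.act (bdry (i + 1))⁻¹⁻¹ _ = _
    rw [inv_inv]
  have pos : ∀ {i j}, i ≠ j → 0 < (F i).η (r j) := fun {i j} hij =>
    Frame.η_r_pos (cuspNe_cusp hij)
  have posG : ∀ i j, 0 < (F j).η (G i).r := fun i j => Frame.η_r_pos (cuspNe_translate i j)
  have posG' : ∀ i j, 0 < (G i).η (r j) := fun i j => Frame.η_r_pos (cuspNe_translate i j).symm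
  have hli : ∀ i, LinearIndependent ℝ ![r i, r (i + 1), r (i + 2)] := fun i =>
    linearIndependent_of_supports (F i).eigen.ηr (F (i + 1)).eigen.ηr (F (i + 2)).eigen.ηr
      (pos (hne1 i)) (pos (hne2 i)) (pos (hne1 i).symm) (pos (hne3 i)) (pos (hne2 i).symm)
      (pos (hne3 i).symm)
  have hD : ∀ i, wedge (r i) (r (i + 1)) (r (i + 2)) ≠ 0 := fun i => wedge_ne_zero_iff.2 (hli i)
  have hcoord : ∀ i, ∃ x y z : ℝ, (G i).r = x • r i + y • r (i + 1) + z • r (i + 2) := fun i => by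
    obtain ⟨ξ, η, ζ, hx, -⟩ := exists_dual_basis (hli i)
    exact ⟨_, _, _, hx _⟩
  choose x y z hxyz using hcoord
  have hA : ∀ i, π.act (bdry i) (r i) = (F i).l • r i := fun i => by
    have := (F i).eigen.map_r
    rwa [parab_cusp] at this
  have hl : ∀ i, 0 < (F i).l := fun i => (F i).eigen.l_pos
  have hAG : ∀ i, π.act (bdry (i + 2)) (G i).r = (F i).l⁻¹ • r i := fun i => by
    have := π.act_relation i (r i)
    rw [hA, map_smul, map_smul, ← hG] at this
    rw [eq_inv_smul_iff₀ (hl i).ne', this]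
  have hsign : ∀ i, (x i < 0 ∧ 0 < y i ∧ 0 < z i) ∨ (0 < x i ∧ y i < 0 ∧ 0 < z i) ∨
      (0 < x i ∧ 0 < y i ∧ z i < 0) := fun i => by
    have h1 := posG i i
    have h2 := posG i (i + 1)
    have h3 := posG i (i + 2)
    have h0 := (G i).eigen.ηr
    rw [hxyz] at h1 h2 h3 h0
    simp only [map_add, map_smul, smul_eq_mul] at h1 h2 h3 h0
    rw [show (F i).η (r i) = 0 from (F i).eigen.ηr, mul_zero, zero_add] at h1
    rw [show (F (i + 1)).η (r (i + 1)) = 0 from (F (i + 1)).eigen.ηr, mul_zero, add_zero] at h2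
    rw [show (F (i + 2)).η (r (i + 2)) = 0 from (F (i + 2)).eigen.ηr, mul_zero, add_zero] at h3
    exact sign_coordinates (pos (hne1 i)) (pos (hne2 i)) (pos (hne1 i).symm) (pos (hne3 i))
      (pos (hne2 i).symm) (pos (hne3 i).symm) (posG' i i) (posG' i _) (posG' i _) h1 h2 h3 h0
  -- `Aᵢ` sends `rᵢ`, `r_{i+2}`, `A_{i+2} r_{i+1}` to multiples of `rᵢ`, `Aᵢ r_{i+2}`, `r_{i+1}`.
  -- Comparing volumes shows that all `x` have the same sign.
  have hxx : ∀ i, 0 < x (i + 2) * x (i + 1) := fun i => by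
    have h1 := π.wedge_act (bdry i) (r i) (r (i + 2)) (G (i + 1)).r
    have h2 := hAG (i + 1)
    have h3 : (G (i + 2)).r = π.act (bdry i) (r (i + 2)) := (hG (i + 2)).trans (by rw [e21])
    rw [e11] at h2
    rw [h2, ← h3, hA, hxyz, hxyz] at h1
    simp only [e11, e12, e21, e22] at h1
    have h4 : (F i).l * (F (i + 1)).l⁻¹ * x (i + 2) * wedge (r i) (r (i + 1)) (r (i + 2)) =
        x (i + 1) * wedge (r i) (r (i + 1)) (r (i + 2)) := by
      simp only [wedge_eq, Pi.add_apply, Pi.smul_apply, smul_eq_mul] at h1 ⊢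
      linarith
    have h5 := mul_right_cancel₀ (hD i) h4
    rw [← h5]
    have h6 : x (i + 2) ≠ 0 := by
      rcases hsign (i + 2) with h | h | h
      · exact h.1.ne
      · exact h.1.ne'
      · exact h.1.ne'
    have h7 := hl i
    have h8 := hl (i + 1)
    have h9 : 0 < x (i + 2) * x (i + 2) := mul_self_pos.2 h6
    have : x (i + 2) * ((F i).l * (F (i + 1)).l⁻¹ * x (i + 2)) =
        (F i).l * (F (i + 1)).l⁻¹ * (x (i + 2) * x (i + 2)) := by ring
    rw [this]
    positivity
  -- `A_{i+1}` turns the lines to `rᵢ` and to `Aᵢ r_{i+2}` in the same direction.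
  have hyz : ∀ i, 0 ≤ z i * y (i + 2) := fun i => by
    have h1 := (F (i + 1)).wedge_mul_wedge_nonneg (F i) (G (i + 2))
      (cuspNe_cusp (hne1 i).symm) (cuspNe_translate _ _)
    have h2 := hAG (i + 2)
    rw [e22] at h2
    rw [parab_cusp, h2] at h1
    change 0 ≤ wedge (r (i + 1)) (r i) (π.act (bdry (i + 1)) (r i)) *
      wedge (r (i + 1)) (G (i + 2)).r _ at h1
    rw [← hG, hxyz i, hxyz (i + 2)] at h1
    simp only [e21, e22] at h1
    have h3 : 0 ≤ (z i * y (i + 2)) * ((F (i + 2)).l⁻¹ *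
        (wedge (r i) (r (i + 1)) (r (i + 2)) * wedge (r i) (r (i + 1)) (r (i + 2)))) := by
      refine h1.trans_eq ?_
      have k1 : wedge (r (i + 1)) (r i) (x i • r i + y i • r (i + 1) + z i • r (i + 2)) =
          -(z i * wedge (r i) (r (i + 1)) (r (i + 2))) := by
        simp only [wedge_eq, Pi.add_apply, Pi.smul_apply, smul_eq_mul]
        ring
      have k2 : wedge (r (i + 1)) (x (i + 2) • r (i + 2) + y (i + 2) • r i + z (i + 2) • r (i + 1))
          ((F (i + 2)).l⁻¹ • r (i + 2)) =
          -(y (i + 2) * (F (i + 2)).l⁻¹ * wedge (r i) (r (i + 1)) (r (i + 2))) := by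
        simp only [wedge_eq, Pi.add_apply, Pi.smul_apply, smul_eq_mul]
        ring
      rw [k1, k2]
      ring
    exact nonneg_of_mul_nonneg_left h3
      (mul_pos (inv_pos.2 (hl _)) (mul_self_pos.2 (hD i)))
  refine ⟨r, x, y, z, hli, fun i => ⟨(F i).l, (F i).m, (F i).n, ?_, hA i⟩, fun i => ?_,
    fun i => ?_⟩
  · have := (F i).eigen
    rw [parab_cusp] at this
    exact this.hasSpectrum
  · rw [← hG, hxyz]
  · refine (hsign i).resolve_right fun hi => ?_
    have hx0 : ∀ j, 0 < x j := by
      have h0 : 0 < x i := hi.elim (fun h => h.1) fun h => h.1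
      have h1 := hxx (i + 2)
      have h2 := hxx (i + 1)
      rw [e21, e22] at h1
      rw [e11, e12] at h2
      have p1 : 0 < x (i + 1) := pos_of_mul_pos_left h1 h0.le
      have p2 : 0 < x (i + 2) := pos_of_mul_pos_right h2 h0.le
      intro j
      have hj : ∀ i j : Fin 3, j = i ∨ j = i + 1 ∨ j = i + 2 := by decide
      rcases hj i j with rfl | rfl | rfl <;> assumption
    have hone : ∀ j, (y j < 0 ∧ 0 < z j) ∨ (0 < y j ∧ z j < 0) := fun j => by
      rcases hsign j with h | h | h
      · exact absurd h.1 (hx0 j).not_gt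
      · exact Or.inl h.2
      · exact Or.inr h.2
    -- If all `x` were positive, `yⱼ` and `zⱼ` would have opposite signs for each `j`, while `zᵢ`
    -- and `y_{i+2}` agree. So the sign of `z` would alternate around a cycle of length three.
    have hy0 := hyz 0
    have hy1 := hyz 1
    have hy2 := hyz 2
    simp only [show (0 : Fin 3) + 2 = 2 by decide, show (1 : Fin 3) + 2 = 0 by decide,
      show (2 : Fin 3) + 2 = 1 by decide] at hy0 hy1 hy2
    rcases hone 0 with a | a <;> rcases hone 1 with b | b <;> rcases hone 2 with c | c <;>
    nlinarith

end ConvexProjectiveStructure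

end Pants

/-! ### Spectra, unstable flags and the normal form. -/

namespace Pants

lemma fin_add_two_one (i : Fin 3) : i + 2 + 1 = i := by revert i; decide
lemma fin_add_two_two (i : Fin 3) : i + 2 + 2 = i + 1 := by revert i; decide
lemma fin_add_one_one (i : Fin 3) : i + 1 + 1 = i + 2 := by revert i; decide
lemma fin_add_one_two (i : Fin 3) : i + 1 + 2 = i := by revert i; decide

lemma EigenBasis.prod_eq_one {M : SL(3, ℝ)} {l m n : ℝ} {r u w : V} {ξ η ζ : V →ₗ[ℝ] ℝ}
    (E : EigenBasis (Matrix.toLin' M.1) l m n r u w ξ η ζ) : l * m * n = 1 := by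
  have h1 := wedge_mulVec M.1 r u w
  simp only [← Matrix.toLin'_apply, E.map_r, E.map_u, E.map_w, M.2, one_mul] at h1
  rw [wedge_smul_left, wedge_smul_mid, wedge_smul_right] at h1
  have h2 := wedge_ne_zero_iff.2 E.linearIndependent
  exact mul_right_cancel₀ h2 (by linarith)

namespace HasSpectrum

variable {M : SL(3, ℝ)} {l m n : ℝ}

lemma prod_eq_one (h : HasSpectrum M l m n) : l * m * n = 1 := by
  obtain ⟨r, u, w, ξ, η, ζ, E⟩ := h.exists_eigenBasis
  exact E.prod_eq_one

lemma eigenvalue_cases (h : HasSpectrum M l m n) {x : ℝ}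
    (hx : Module.End.HasEigenvalue (Matrix.toLin' M.1) x) : x = l ∨ x = m ∨ x = n := by
  obtain ⟨r, u, w, ξ, η, ζ, E⟩ := h.exists_eigenBasis
  obtain ⟨v, hv⟩ := hx.exists_hasEigenvector
  rcases E.eigenvector_cases hv.apply_eq_smul hv.2 with h | h | h
  · exact Or.inl h.1
  · exact Or.inr (Or.inl h.1)
  · exact Or.inr (Or.inr h.1)

lemma unique (h : HasSpectrum M l m n) {l' m' n' : ℝ} (h' : HasSpectrum M l' m' n') :
    l' = l ∧ m' = m ∧ n' = n := by
  have h1 := h.eigenvalue_cases h'.2.2.2.1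
  have h2 := h.eigenvalue_cases h'.2.2.2.2.1
  have h3 := h.eigenvalue_cases h'.2.2.2.2.2
  obtain ⟨-, a, b, -⟩ := h
  obtain ⟨-, a', b', -⟩ := h'
  rcases h1 with rfl | rfl | rfl <;> rcases h2 with rfl | rfl | rfl <;>
    rcases h3 with rfl | rfl | rfl <;> first | exact ⟨rfl, rfl, rfl⟩ | (exfalso; linarith)

lemma exists_smul (h : HasSpectrum M l m n) {v v' : V} (hv : v ∈ eigenspace M l)
    (hv' : v' ∈ eigenspace M l) (h0 : v' ≠ 0) : ∃ c : ℝ, v = c • v' := by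
  obtain ⟨r, u, w, ξ, η, ζ, E⟩ := h.exists_eigenBasis
  have key : ∀ {y : V}, y ∈ eigenspace M l → y = ξ y • r := by
    intro y hy
    by_cases hy0 : y = 0
    · simp [hy0]
    · have hex := E.expand y
      rcases E.eigenvector_cases (Module.End.mem_eigenspace_iff.1 hy) hy0 with h | h | h
      · rw [h.2.1, h.2.2] at hex
        simpa using hex
      · exact absurd h.1 E.l_lt.ne
      · exact absurd h.1 (E.l_lt.trans E.m_lt).ne
  have hξ : ξ v' ≠ 0 := fun h1 => h0 (by rw [key hv', h1, zero_smul])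
  refine ⟨ξ v / ξ v', ?_⟩
  calc v = ξ v • r := key hv
    _ = (ξ v / ξ v') • (ξ v' • r) := by rw [smul_smul, div_mul_cancel₀ _ hξ]
    _ = (ξ v / ξ v') • v' := by rw [← key hv']

end HasSpectrum

/-- The functional `f ∧ k ∧ ·`. -/
def wedgeLin (f k : V) : V →ₗ[ℝ] ℝ where
  toFun := wedge f k
  map_add' x y := by simp only [wedge_eq, Pi.add_apply]; ring
  map_smul' c x := by simp only [wedge_eq, Pi.smul_apply, smul_eq_mul, RingHom.id_apply]; ring

lemma EigenBasis.mem_eigenspace_mid {M : SL(3, ℝ)} {l m n : ℝ} {r u w : V} {ξ η ζ : V →ₗ[ℝ] ℝ}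
    (E : EigenBasis (Matrix.toLin' M.1) l m n r u w ξ η ζ) {y : V} (hy : y ∈ eigenspace M m) :
    y = η y • u := by
  by_cases hy0 : y = 0
  · simp [hy0]
  · have hex := E.expand y
    rcases E.eigenvector_cases (Module.End.mem_eigenspace_iff.1 hy) hy0 with h | h | h
    · exact absurd h.1 E.l_lt.ne'
    · rw [h.2.1, h.2.2] at hex
      simpa using hex
    · exact absurd h.1 E.m_lt.ne

lemma EigenBasis.spansUnstableFlag {M : SL(3, ℝ)} {l m n : ℝ} {r u w : V} {ξ η ζ : V →ₗ[ℝ] ℝ}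
    (E : EigenBasis (Matrix.toLin' M.1) l m n r u w ξ η ζ) : SpansUnstableFlag M r u := by
  have h1 : Submodule.span ℝ {r} = eigenspace M l := by
    apply le_antisymm
    · rw [Submodule.span_singleton_le_iff_mem]
      exact Module.End.mem_eigenspace_iff.2 E.map_r
    · intro y hy
      obtain ⟨c, rfl⟩ := E.hasSpectrum.exists_smul hy (Module.End.mem_eigenspace_iff.2 E.map_r)
        E.r_ne_zero
      exact Submodule.smul_mem _ _ (Submodule.mem_span_singleton_self _)
  have h2 : Submodule.span ℝ {u} = eigenspace M m := by
    apply le_antisymm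
    · rw [Submodule.span_singleton_le_iff_mem]
      exact Module.End.mem_eigenspace_iff.2 E.map_u
    · intro y hy
      rw [E.mem_eigenspace_mid hy]
      exact Submodule.smul_mem _ _ (Submodule.mem_span_singleton_self _)
  exact ⟨l, m, n, E.hasSpectrum, h1, by rw [Submodule.span_insert, h1, h2]⟩

namespace SpansUnstableFlag

variable {M : SL(3, ℝ)} {f k : V} {l m n : ℝ}

lemma mem_eigenspace (h : SpansUnstableFlag M f k) (hs : HasSpectrum M l m n) :
    f ∈ eigenspace M l ∧ f ≠ 0 := by
  obtain ⟨l', m', n', hs', h1, -⟩ := h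
  obtain ⟨rfl, rfl, rfl⟩ := hs.unique hs'
  refine ⟨h1 ▸ Submodule.mem_span_singleton_self f, ?_⟩
  rintro rfl
  have := hs.2.2.2.1
  rw [Module.End.hasEigenvalue_iff] at this
  exact this (h1.symm.trans (by simp))

/-- The functional vanishes on the two lower eigenspaces, so it is a nonzero multiple of the dual
vector `ζ`. Only this property of the plane is needed later. -/
lemma wedgeLin_map (h : SpansUnstableFlag M f k) (hs : HasSpectrum M l m n) :
    (∀ x, wedgeLin f k (Matrix.toLin' M.1 x) = n * wedgeLin f k x) ∧ wedgeLin f k ≠ 0 := by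
  obtain ⟨hf, hf0⟩ := h.mem_eigenspace hs
  obtain ⟨l', m', n', hs', h1, h2⟩ := h
  obtain ⟨rfl, rfl, rfl⟩ := hs.unique hs'
  obtain ⟨r, u, w, ξ, η, ζ, E⟩ := hs.exists_eigenBasis
  obtain ⟨c, hc⟩ := hs.exists_smul hf (Module.End.mem_eigenspace_iff.2 E.map_r) E.r_ne_zero
  have hc0 : c ≠ 0 := fun h0 => hf0 (by rw [hc, h0, zero_smul])
  have hk : k ∈ eigenspace M l' ⊔ eigenspace M m' := by
    rw [← h2]; exact Submodule.subset_span (by simp)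
  obtain ⟨a, ha, b, hb, hab⟩ := Submodule.mem_sup.1 hk
  obtain ⟨a', ha'⟩ := hs.exists_smul ha (Module.End.mem_eigenspace_iff.2 E.map_r) E.r_ne_zero
  have hb' := E.mem_eigenspace_mid hb
  have hkey : ∀ x, wedgeLin f k x = c * η b * ζ x * wedge r u w := by
    intro x
    change wedge f k x = _
    rw [hc, ← hab, ha', hb']
    conv_lhs => rw [E.expand x]
    simp only [wedge_eq, Pi.add_apply, Pi.smul_apply, smul_eq_mul, map_smul, E.ηu]
    ring
  have hu : u ∈ Submodule.span ℝ {f, k} := by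
    rw [h2]
    exact Submodule.mem_sup_right (Module.End.mem_eigenspace_iff.2 E.map_u)
  obtain ⟨p, q, hpq⟩ := Submodule.mem_span_pair.1 hu
  have hηb : η b ≠ 0 := by
    intro h0
    have h3 := congrArg η hpq
    rw [hc, ← hab, ha'] at h3
    simp [E.ηr, E.ηu, h0] at h3
  refine ⟨fun x => ?_, fun h0 => ?_⟩
  · rw [hkey, hkey, E.ζ_map]; ring
  · have h3 := hkey w
    rw [h0, E.ζw] at h3
    have h4 := mul_ne_zero (mul_ne_zero hc0 hηb) (wedge_ne_zero_iff.2 E.linearIndependent)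
    apply h4
    simpa using h3.symm

end SpansUnstableFlag

/-- The vectors `v` span the repelling fixed points of `bdry i`, and the fixed points of `bdry' i`
are `[-1, y 1, z 1], [z 2, -1, y 2], [y 3, z 3, -1]` in this basis. -/
structure NormalForm (π : ConvexProjectiveStructure) (lam m n : Fin 3 → ℝ) (v : Fin 3 → V)
    (x y z : Fin 3 → ℝ) : Prop where
  spectrum : ∀ i, HasSpectrum (π.hol (bdry i)) (lam i) (m i) (n i)
  li : ∀ i, LinearIndependent ℝ ![v i, v (i + 1), v (i + 2)]
  map_v : ∀ i, π.act (bdry i) (v i) = lam i • v i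
  x_pos : ∀ i, 0 < x i
  y_pos : ∀ i, 0 < y i
  z_pos : ∀ i, 0 < z i
  map_next : ∀ i, π.act (bdry (i + 1)) (v i) =
    x (i + 1) • (-v i + y i • v (i + 1) + z i • v (i + 2))

variable {π : ConvexProjectiveStructure}

lemma exists_normalForm (π : ConvexProjectiveStructure) :
    ∃ lam m n v x y z, NormalForm π lam m n v x y z := by
  obtain ⟨r, x, y, z, hli, hs, hA, hpos⟩ := π.exists_vertices
  choose l m n hs hr using hs
  -- The normal form indexes `x` by the acting element `A_{i+1}` rather than by the vertex `i`,
  -- hence the shift.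
  refine ⟨l, m, n, r, fun i => -x (i + 2), fun i => y i / -x i, fun i => z i / -x i, hs, hli, hr,
    fun i => neg_pos.2 (hpos _).1, fun i => div_pos (hpos i).2.1 (neg_pos.2 (hpos i).1),
    fun i => div_pos (hpos i).2.2 (neg_pos.2 (hpos i).1), fun i => ?_⟩
  have hx : -x i ≠ 0 := neg_ne_zero.2 (hpos i).1.ne
  rw [hA]
  simp only [fin_add_one_two, smul_add, smul_smul, mul_div_cancel₀ _ hx]
  module

/-- Normal forms are obtained from arbitrary eigenvectors. -/
lemma NormalForm.of_eigenvectors {lam m n y z : Fin 3 → ℝ} {v : Fin 3 → V}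
    (hs : ∀ i, HasSpectrum (π.hol (bdry i)) (lam i) (m i) (n i))
    (hv : ∀ i, v i ∈ eigenspace (π.hol (bdry i)) (lam i)) (hv0 : ∀ i, v i ≠ 0)
    (hP : ∀ i, -v i + y i • v (i + 1) + z i • v (i + 2) ∈ eigenspace (π.hol (bdry' i)) (lam i))
    (hy : ∀ i, 0 < y i) (hz : ∀ i, 0 < z i) : ∃ x, NormalForm π lam m n v x y z := by
  obtain ⟨r, x₀, y₀, z₀, hli, hs', hA, hpos⟩ := π.exists_vertices
  have hr : ∀ i, r i ∈ eigenspace (π.hol (bdry i)) (lam i) := fun i => by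
    obtain ⟨l', m', n', h1, h2⟩ := hs' i
    obtain ⟨rfl, -⟩ := (h1.unique (hs i))
    exact Module.End.mem_eigenspace_iff.2 h2
  have hr0 : ∀ i, r i ≠ 0 := fun i => (hli i).ne_zero 0
  have hk : ∀ i, ∃ c : ℝ, v i = c • r i := fun i => (hs i).exists_smul (hv i) (hr i) (hr0 i)
  choose c hc using hk
  have hc0 : ∀ i, c i ≠ 0 := fun i h0 => hv0 i (by rw [hc, h0, zero_smul])
  have hli' : ∀ i, LinearIndependent ℝ ![v i, v (i + 1), v (i + 2)] := by
    intro i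
    have h1 := wedge_ne_zero_iff.2 (hli i)
    rw [← wedge_ne_zero_iff, hc i, hc (i + 1), hc (i + 2), wedge_smul_left, wedge_smul_mid,
      wedge_smul_right]
    exact mul_ne_zero (hc0 _) (mul_ne_zero (hc0 _) (mul_ne_zero (hc0 _) h1))
  have hv' : ∀ i, π.act (bdry i) (v i) = lam i • v i := fun i => Module.End.mem_eigenspace_iff.1 (hv i)
  have hmem : ∀ i, π.act (bdry (i + 1)) (v i) ∈ eigenspace (π.hol (bdry' i)) (lam i) := fun i => by
    refine Module.End.mem_eigenspace_iff.2 ?_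
    change π.act (bdry' i) _ = _
    rw [bdry', ConvexProjectiveStructure.act_mul, ConvexProjectiveStructure.act_mul,
      ConvexProjectiveStructure.act_inv_act, hv', map_smul]
  have hspec' : ∀ i, HasSpectrum (π.hol (bdry' i)) (lam i) (m i) (n i) := fun i => by
    rw [bdry', map_mul, map_mul, map_inv]
    exact (hs i).conj _
  have hP0 : ∀ i, -v i + y i • v (i + 1) + z i • v (i + 2) ≠ 0 := fun i h0 => by
    have := linearIndependent_triple_iff.1 (hli' i) (-1) (y i) (z i) (by rw [← h0]; module)
    linarith [this.1]
  have hex : ∀ i, ∃ d : ℝ, π.act (bdry (i + 1)) (v i) =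
      d • (-v i + y i • v (i + 1) + z i • v (i + 2)) := fun i =>
    (hspec' i).exists_smul (hmem i) (hP i) (hP0 i)
  choose d hd using hex
  -- The coordinate of `A_{i+1} vᵢ` along `vᵢ` does not depend on the scaling of the basis, so its
  -- sign is the one already found.
  have hdx : ∀ i, d i = -x₀ i := by
    intro i
    have h1 := hd i
    rw [hc i, map_smul, hA, hc (i + 1), hc (i + 2)] at h1
    have h2 := linearIndependent_triple_iff.1 (hli i) (c i * x₀ i + d i * c i)
      (c i * y₀ i - d i * (y i * c (i + 1))) (c i * z₀ i - d i * (z i * c (i + 2))) (by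
        rw [← sub_eq_zero] at h1
        rw [← h1]
        module)
    have h3 : c i * (x₀ i + d i) = 0 := by linarith [h2.1]
    have := (mul_eq_zero.1 h3).resolve_left (hc0 i)
    linarith
  refine ⟨fun i => d (i + 2), hs, hli', hv', fun i => ?_, hy, hz, fun i => ?_⟩
  · rw [hdx]
    exact neg_pos.2 (hpos _).1
  · simp only [fin_add_one_two]
    exact hd i

namespace NormalForm

variable {lam m n : Fin 3 → ℝ} {v : Fin 3 → V} {x y z : Fin 3 → ℝ}
  (N : NormalForm π lam m n v x y z)
include N

lemma lam_pos (i : Fin 3) : 0 < lam i := (N.spectrum i).1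
lemma m_pos (i : Fin 3) : 0 < m i := (N.lam_pos i).trans (N.spectrum i).2.1
lemma n_pos (i : Fin 3) : 0 < n i := (N.m_pos i).trans (N.spectrum i).2.2.1

lemma map_opposite (i : Fin 3) :
    π.act (bdry (i + 2)) (-v i + y i • v (i + 1) + z i • v (i + 2)) =
      (lam i * x (i + 1))⁻¹ • v i := by
  have h1 := π.act_relation i (v i)
  rw [N.map_v, map_smul, map_smul, N.map_next, map_smul, smul_smul] at h1
  rw [eq_inv_smul_iff₀ (mul_pos (N.lam_pos i) (N.x_pos _)).ne', h1]

/-- Evaluating the eigenvector equation at `v i` kills `ψ (v i)`; at `v (i + 2)` and at the vertex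
opposite to `v (i + 1)` it gives two linear equations for the other two values. Eliminating these
gives the quadratic in `κ`. -/
lemma functional {i : Fin 3} {ψ : V →ₗ[ℝ] ℝ} {κ : ℝ} (hψ : ∀ x, ψ (π.act (bdry i) x) = κ * ψ x)
    (h0 : ψ ≠ 0) (hκ : 0 < κ) (hne : κ ≠ lam i) :
    ψ (v i) = 0 ∧ ψ (v (i + 1)) ≠ 0 ∧ ψ (v (i + 2)) ≠ 0 ∧
      (κ + x i) * ψ (v (i + 2)) = x i * z (i + 2) * ψ (v (i + 1)) ∧
      (κ + (lam (i + 1) * x (i + 2))⁻¹) * (κ + x i) = κ * x i * (z (i + 2) * y (i + 1)) := by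
  have h1 : ψ (v i) = 0 := by
    have := hψ (v i)
    rw [N.map_v, map_smul, smul_eq_mul] at this
    have h : (κ - lam i) * ψ (v i) = 0 := by linarith
    exact (mul_eq_zero.1 h).resolve_left (sub_ne_zero.2 hne)
  have h2 := hψ (v (i + 2))
  have h3 := N.map_next (i + 2)
  have h4 := N.map_opposite (i + 1)
  simp only [fin_add_one_one, fin_add_one_two, fin_add_two_one, fin_add_two_two] at h3 h4
  rw [h3] at h2
  have h5 := hψ (-v (i + 1) + y (i + 1) • v (i + 2) + z (i + 1) • v i)
  rw [h4] at h5
  simp only [map_add, map_neg, map_smul, smul_eq_mul, h1] at h2 h5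
  have hx := N.x_pos i
  have hz := N.z_pos (i + 2)
  have hy := N.y_pos (i + 1)
  have hq : 0 < (lam (i + 1) * x (i + 2))⁻¹ := inv_pos.2 (mul_pos (N.lam_pos _) (N.x_pos _))
  set q := (lam (i + 1) * x (i + 2))⁻¹
  have k1 : (κ + x i) * ψ (v (i + 2)) = x i * z (i + 2) * ψ (v (i + 1)) := by linarith
  have k2 : (κ + q) * ψ (v (i + 1)) = κ * y (i + 1) * ψ (v (i + 2)) := by linarith
  have k3 : ψ (v (i + 1)) ≠ 0 := by
    intro hu
    rw [hu, mul_zero] at k1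
    have hw := (mul_eq_zero.1 k1).resolve_left (by positivity)
    exact h0 (eq_zero_of_three_zeros (N.li i) h1 hu hw)
  have k4 : ψ (v (i + 2)) ≠ 0 := by
    intro hw
    rw [hw, mul_zero] at k2
    exact (mul_ne_zero (by positivity) k3) k2
  refine ⟨h1, k3, k4, k1, ?_⟩
  refine mul_right_cancel₀ k3 ?_
  calc (κ + q) * (κ + x i) * ψ (v (i + 1)) = (κ + x i) * ((κ + q) * ψ (v (i + 1))) := by ring
    _ = κ * y (i + 1) * ((κ + x i) * ψ (v (i + 2))) := by rw [k2]; ring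
    _ = κ * x i * (z (i + 2) * y (i + 1)) * ψ (v (i + 1)) := by rw [k1]; ring

/-- Vieta's formulas for the quadratic in `functional`, whose roots are `m i` and `n i`, with `m i *
n i` replaced by `1 / lam i`. -/
lemma relations (i : Fin 3) : lam i * x i = lam (i + 1) * x (i + 2) ∧
    z (i + 2) * y (i + 1) = 1 + (m i + n i) * (x i)⁻¹ + (x i)⁻¹ ^ 2 / lam i := by
  obtain ⟨r, u, w, ξ, η, ζ, E⟩ := (N.spectrum i).exists_eigenBasis
  have h1 := N.functional (i := i) E.η_map (fun h0 => by simpa [h0] using E.ηu) E.m_pos E.l_lt.ne'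
  have h2 := N.functional (i := i) E.ζ_map (fun h0 => by simpa [h0] using E.ζw) E.n_pos
    (E.l_lt.trans E.m_lt).ne'
  replace h1 := h1.2.2.2.2
  replace h2 := h2.2.2.2.2
  have h3 := E.prod_eq_one
  have hmn := E.m_lt
  have hl := E.l_pos
  have hx := N.x_pos i
  have hm := E.m_pos
  have hn := E.n_pos
  have hQ : 0 < lam (i + 1) * x (i + 2) := mul_pos (N.lam_pos _) (N.x_pos _)
  generalize lam (i + 1) * x (i + 2) = Q at *
  generalize z (i + 2) * y (i + 1) = Y at *
  have h4 : (n i - m i) * (m i + n i + Q⁻¹ + x i - x i * Y) = 0 := by linarith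
  have h5 := (mul_eq_zero.1 h4).resolve_left (sub_ne_zero.2 hmn.ne')
  have h6 : (n i - m i) * (Q⁻¹ * x i - m i * n i) = 0 := by
    have e1 : (m i) ^ 2 + m i * (Q⁻¹ + x i - x i * Y) + Q⁻¹ * x i = 0 := by linarith
    have e2 : Q⁻¹ + x i - x i * Y = -(m i + n i) := by linarith
    rw [e2] at e1
    have e3 : Q⁻¹ * x i - m i * n i = 0 := by linarith
    rw [e3, mul_zero]
  have h7 := (mul_eq_zero.1 h6).resolve_left (sub_ne_zero.2 hmn.ne')
  have hq : Q = lam i * x i := by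
    have e1 : x i = m i * n i * Q := by
      field_simp at h7
      linarith
    calc Q = (lam i * m i * n i) * Q := by rw [h3, one_mul]
      _ = lam i * (m i * n i * Q) := by ring
      _ = lam i * x i := by rw [← e1]
  refine ⟨hq.symm, ?_⟩
  rw [hq] at h5
  field_simp at h5 ⊢
  linarith

lemma map_opposite' (i : Fin 3) :
    (lam (i + 2) * x (i + 2)) •
      π.act (bdry (i + 2)) (-v i + y i • v (i + 1) + z i • v (i + 2)) = v i := by
  have h := (N.relations (i + 2)).1
  rw [fin_add_two_one, fin_add_two_two] at h
  rw [N.map_opposite, h, smul_smul, mul_inv_cancel₀ (mul_pos (N.lam_pos i) (N.x_pos _)).ne',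
    one_smul]

end NormalForm

end Pants

/-! ### Double and triple ratios in the normal form. -/

namespace Pants

variable {π : ConvexProjectiveStructure}

lemma fin_sub_one (i : Fin 3) : i - 1 = i + 2 := by revert i; decide

/-- The two vertices lie on opposite sides of their common edge; this cancels the minus sign in the
double ratios. -/
lemma wedge_vertex (u v w : V) (y z : ℝ) :
    wedge v w (-u + y • v + z • w) = -wedge v w u := by
  simp only [wedge_eq, Pi.add_apply, Pi.neg_apply, Pi.smul_apply, smul_eq_mul]
  ring

namespace NormalForm

variable {lam m n : Fin 3 → ℝ} {v : Fin 3 → V} {x y z : Fin 3 → ℝ}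
  (N : NormalForm π lam m n v x y z)
include N

lemma prod_eq_one (i : Fin 3) : lam i * m i * n i = 1 := (N.spectrum i).prod_eq_one

lemma v_ne_zero (i : Fin 3) : v i ≠ 0 := (N.li i).ne_zero 0

lemma spectrum' (i : Fin 3) : HasSpectrum (π.hol (bdry' i)) (lam i) (m i) (n i) := by
  rw [bdry', map_mul, map_mul, map_inv]
  exact (N.spectrum i).conj _

lemma vertex_ne_zero (i : Fin 3) : -v i + y i • v (i + 1) + z i • v (i + 2) ≠ 0 := fun h0 => by
  have := linearIndependent_triple_iff.1 (N.li i) (-1) (y i) (z i) (by rw [← h0]; module)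
  linarith [this.1]

lemma vertex_mem (i : Fin 3) :
    -v i + y i • v (i + 1) + z i • v (i + 2) ∈ eigenspace (π.hol (bdry' i)) (lam i) := by
  have h1 : π.act (bdry (i + 1)) (v i) ∈ eigenspace (π.hol (bdry' i)) (lam i) := by
    refine Module.End.mem_eigenspace_iff.2 ?_
    change π.act (bdry' i) _ = _
    rw [bdry', ConvexProjectiveStructure.act_mul, ConvexProjectiveStructure.act_mul,
      ConvexProjectiveStructure.act_inv_act, N.map_v, map_smul]
  rw [N.map_next] at h1
  have h2 := Submodule.smul_mem _ (x (i + 1))⁻¹ h1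
  rwa [smul_smul, inv_mul_cancel₀ (N.x_pos _).ne', one_smul] at h2

section Flags

variable {f k f' k' : Fin 3 → V}

lemma exists_smul_v {i : Fin 3} (hf : SpansUnstableFlag (π.hol (bdry i)) (f i) (k i)) :
    ∃ c : ℝ, c ≠ 0 ∧ f i = c • v i := by
  obtain ⟨h1, h2⟩ := hf.mem_eigenspace (N.spectrum i)
  obtain ⟨c, hc⟩ := (N.spectrum i).exists_smul h1 (Module.End.mem_eigenspace_iff.2 (N.map_v i))
    (N.v_ne_zero i)
  exact ⟨c, fun h0 => h2 (by rw [hc, h0, zero_smul]), hc⟩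

lemma exists_smul_vertex {i : Fin 3} (hf : SpansUnstableFlag (π.hol (bdry' i)) (f' i) (k' i)) :
    ∃ c : ℝ, c ≠ 0 ∧ f' i = c • (-v i + y i • v (i + 1) + z i • v (i + 2)) := by
  obtain ⟨h1, h2⟩ := hf.mem_eigenspace (N.spectrum' i)
  obtain ⟨c, hc⟩ := (N.spectrum' i).exists_smul h1 (N.vertex_mem i) (N.vertex_ne_zero i)
  exact ⟨c, fun h0 => h2 (by rw [hc, h0, zero_smul]), hc⟩

/-- The plane functional of the unstable flag at `i`. -/
lemma plane {i : Fin 3} (hf : SpansUnstableFlag (π.hol (bdry i)) (f i) (k i)) :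
    wedgeLin (f i) (k i) (v (i + 1)) ≠ 0 ∧ wedgeLin (f i) (k i) (v (i + 2)) ≠ 0 ∧
    (n i + x i) * wedgeLin (f i) (k i) (v (i + 2)) =
      x i * z (i + 2) * wedgeLin (f i) (k i) (v (i + 1)) := by
  obtain ⟨h1, h2⟩ := hf.wedgeLin_map (N.spectrum i)
  obtain ⟨-, h4, h5, h6, -⟩ := N.functional (i := i) h1 h2 (N.n_pos i)
    ((N.spectrum i).2.1.trans (N.spectrum i).2.2.1).ne'
  exact ⟨h4, h5, h6⟩

/-- `A_{i+2}` maps the opposite vertex to a multiple of `v i` and scales the functional by `n`. The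
factor becomes `m / x` because the eigenvalues have product `1`. -/
lemma plane_opposite {i : Fin 3}
    (hf : SpansUnstableFlag (π.hol (bdry (i + 2))) (f (i + 2)) (k (i + 2))) :
    wedgeLin (f (i + 2)) (k (i + 2)) (-v i + y i • v (i + 1) + z i • v (i + 2)) =
      m (i + 2) / x (i + 2) * wedgeLin (f (i + 2)) (k (i + 2)) (v i) := by
  have h1 := (hf.wedgeLin_map (N.spectrum _)).1
  conv_rhs => rw [← N.map_opposite' i]
  rw [map_smul]
  change _ = _ * (_ * wedgeLin (f (i + 2)) (k (i + 2)) (Matrix.toLin' (π.hol (bdry (i + 2))).1 _))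
  rw [h1]
  have h2 := N.prod_eq_one (i + 2)
  have h3 := N.x_pos (i + 2)
  generalize wedgeLin (f (i + 2)) (k (i + 2)) _ = p
  calc p = (lam (i + 2) * m (i + 2) * n (i + 2)) * p := by rw [h2, one_mul]
    _ = _ := by field_simp

lemma plane_next {i : Fin 3}
    (hf : SpansUnstableFlag (π.hol (bdry (i + 1))) (f (i + 1)) (k (i + 1))) :
    wedgeLin (f (i + 1)) (k (i + 1)) (-v i + y i • v (i + 1) + z i • v (i + 2)) =
      n (i + 1) / x (i + 1) * wedgeLin (f (i + 1)) (k (i + 1)) (v i) := by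
  have h1 := (hf.wedgeLin_map (N.spectrum _)).1 (v i)
  change wedgeLin (f (i + 1)) (k (i + 1)) (π.act (bdry (i + 1)) _) = _ at h1
  rw [N.map_next, map_smul, smul_eq_mul] at h1
  have h3 := N.x_pos (i + 1)
  field_simp
  linarith

lemma wedge_v (i : Fin 3) : wedge (v (i + 1)) (v (i + 2)) (v i) ≠ 0 := by
  rw [← wedge_cyc]
  exact wedge_ne_zero_iff.2 (N.li i)

variable (hf : ∀ i, SpansUnstableFlag (π.hol (bdry i)) (f i) (k i))
  (hf' : ∀ i, SpansUnstableFlag (π.hol (bdry' i)) (f' i) (k' i))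
include hf hf'

lemma doubleRatio₁_eq (i : Fin 3) :
    doubleRatio₁ (f (i + 1)) (f (i - 1)) (k (i - 1)) (f i) (f' i) = m (i + 2) / x (i + 2) := by
  rw [fin_sub_one, doubleRatio₁]
  obtain ⟨c, hc, e⟩ := N.exists_smul_v (hf i)
  obtain ⟨c1, hc1, e1⟩ := N.exists_smul_v (hf (i + 1))
  obtain ⟨c2, hc2, e2⟩ := N.exists_smul_v (hf (i + 2))
  obtain ⟨c', hc', e'⟩ := N.exists_smul_vertex (hf' i)
  have h1 := N.plane_opposite (hf (i + 2))
  have h2 := (N.plane (hf (i + 2))).1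
  rw [fin_add_two_one] at h2
  change -(_ / _ * (wedgeLin (f (i + 2)) (k (i + 2)) (f' i) /
    wedgeLin (f (i + 2)) (k (i + 2)) (f i))) = _
  generalize wedgeLin (f (i + 2)) (k (i + 2)) = ψ at *
  rw [e, e1, e2, e']
  simp only [wedge_smul_left, wedge_smul_mid, wedge_smul_right, map_smul, smul_eq_mul]
  rw [h1, wedge_vertex]
  have h3 := N.wedge_v i
  have h4 := (N.x_pos (i + 2)).ne'
  field_simp

lemma doubleRatio₂_eq (i : Fin 3) :
    doubleRatio₂ (f (i + 1)) (k (i + 1)) (f (i - 1)) (f i) (f' i) = x (i + 1) / n (i + 1) := by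
  rw [fin_sub_one, doubleRatio₂]
  obtain ⟨c, hc, e⟩ := N.exists_smul_v (hf i)
  obtain ⟨c1, hc1, e1⟩ := N.exists_smul_v (hf (i + 1))
  obtain ⟨c2, hc2, e2⟩ := N.exists_smul_v (hf (i + 2))
  obtain ⟨c', hc', e'⟩ := N.exists_smul_vertex (hf' i)
  have h1 := N.plane_next (hf (i + 1))
  have h2 := (N.plane (hf (i + 1))).2.1
  rw [fin_add_one_two] at h2
  change -(_ / _ * (wedgeLin (f (i + 1)) (k (i + 1)) (f i) /
    wedgeLin (f (i + 1)) (k (i + 1)) (f' i))) = _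
  generalize wedgeLin (f (i + 1)) (k (i + 1)) = ψ at *
  rw [e, e1, e2, e']
  simp only [wedge_smul_left, wedge_smul_mid, wedge_smul_right, map_smul, smul_eq_mul]
  rw [h1, wedge_vertex]
  have h3 := N.wedge_v i
  have h4 := (N.x_pos (i + 1)).ne'
  have h5 := (N.n_pos (i + 1)).ne'
  field_simp

-- The triple ratio regroups by planes: each vertex contributes the quotient of the values of its
-- plane functional at the other two, which `plane` determines.
omit hf' in
lemma tripleRatio_eq : tripleRatio (f 1) (k 1) (f 2) (k 2) (f 3) (k 3) =
    (1 + n 1 / x 1) * (1 + n 2 / x 2) * (1 + n 3 / x 3) / (z 1 * z 2 * z 3) := by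
  obtain ⟨c1, hc1, e1⟩ := N.exists_smul_v (hf 1)
  obtain ⟨c2, hc2, e2⟩ := N.exists_smul_v (hf 2)
  obtain ⟨c3, hc3, e3⟩ := N.exists_smul_v (hf 3)
  obtain ⟨a1, b1, r1⟩ : wedgeLin (f 1) (k 1) (v 2) ≠ 0 ∧ wedgeLin (f 1) (k 1) (v 3) ≠ 0 ∧
    (n 1 + x 1) * wedgeLin (f 1) (k 1) (v 3) = x 1 * z 3 * wedgeLin (f 1) (k 1) (v 2) :=
    N.plane (hf 1)
  obtain ⟨a2, b2, r2⟩ : wedgeLin (f 2) (k 2) (v 3) ≠ 0 ∧ wedgeLin (f 2) (k 2) (v 1) ≠ 0 ∧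
    (n 2 + x 2) * wedgeLin (f 2) (k 2) (v 1) = x 2 * z 1 * wedgeLin (f 2) (k 2) (v 3) :=
    N.plane (hf 2)
  obtain ⟨a3, b3, r3⟩ : wedgeLin (f 3) (k 3) (v 1) ≠ 0 ∧ wedgeLin (f 3) (k 3) (v 2) ≠ 0 ∧
    (n 3 + x 3) * wedgeLin (f 3) (k 3) (v 2) = x 3 * z 2 * wedgeLin (f 3) (k 3) (v 1) :=
    N.plane (hf 3)
  rw [tripleRatio, wedge_cyc (f 2) (f 3) (k 3), wedge_cyc (f 1) (f 3) (k 3),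
    wedge_cyc (f 1) (f 2) (k 2)]
  change wedgeLin (f 1) (k 1) (f 2) / wedgeLin (f 3) (k 3) (f 2) *
    (wedgeLin (f 3) (k 3) (f 1) / wedgeLin (f 2) (k 2) (f 1)) *
    (wedgeLin (f 2) (k 2) (f 3) / wedgeLin (f 1) (k 1) (f 3)) = _
  generalize wedgeLin (f 1) (k 1) = ψ₁ at *
  generalize wedgeLin (f 2) (k 2) = ψ₂ at *
  generalize wedgeLin (f 3) (k 3) = ψ₃ at *
  rw [e1, e2, e3]
  simp only [map_smul, smul_eq_mul]
  have x1 := (N.x_pos 1).ne'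
  have x2 := (N.x_pos 2).ne'
  have x3 := (N.x_pos 3).ne'
  have z1 := (N.z_pos 1).ne'
  have z2 := (N.z_pos 2).ne'
  have z3 := (N.z_pos 3).ne'
  have q1 : ψ₁ (v 2) / ψ₁ (v 3) = (1 + n 1 / x 1) / z 3 := by field_simp; linarith
  have q2 : ψ₂ (v 3) / ψ₂ (v 1) = (1 + n 2 / x 2) / z 1 := by field_simp; linarith
  have q3 : ψ₃ (v 1) / ψ₃ (v 2) = (1 + n 3 / x 3) / z 2 := by field_simp; linarith
  calc _ = (ψ₁ (v 2) / ψ₁ (v 3)) * (ψ₂ (v 3) / ψ₂ (v 1)) * (ψ₃ (v 1) / ψ₃ (v 2)) := by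
        field_simp
    _ = _ := by
        rw [q1, q2, q3]
        field_simp

lemma tripleRatio_eq' : tripleRatio (f' 1) (k' 1) (f 3) (k 3) (f 2) (k 2) =
    z 1 * z 2 * z 3 /
      (m 1 * m 2 * m 3 * ((1 + n 1 / x 1) * (1 + n 2 / x 2) * (1 + n 3 / x 3))) := by
  obtain ⟨c1, hc1, e1⟩ := N.exists_smul_vertex (hf' 1)
  obtain ⟨c2, hc2, e2⟩ := N.exists_smul_v (hf 2)
  obtain ⟨c3, hc3, e3⟩ := N.exists_smul_v (hf 3)
  obtain ⟨w1, w2⟩ := (hf' 1).wedgeLin_map (N.spectrum' 1)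
  -- As `bdry' 1` is the conjugate of `bdry 1` by `bdry 2`, pulling its plane functional back by
  -- `A₂` gives a left eigenvector of `A₁`, to which `functional` applies.
  have w3 : ∀ u, wedgeLin (f' 1) (k' 1) (π.act (bdry 2) (π.act (bdry 1) u)) =
      n 1 * wedgeLin (f' 1) (k' 1) (π.act (bdry 2) u) := by
    intro u
    rw [← w1]
    congr 1
    change _ = π.act (bdry 2 * bdry 1 * (bdry 2)⁻¹) _
    simp
  obtain ⟨-, a1, b1, r1, -⟩ := N.functional (i := 1) (ψ := wedgeLin (f' 1) (k' 1) ∘ₗ π.act (bdry 2))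
    w3 (fun h0 => w2 (LinearMap.ext fun u => by
      have := LinearMap.congr_fun h0 (π.act (bdry 2)⁻¹ u)
      simpa using this)) (N.n_pos 1) ((N.spectrum 1).2.1.trans (N.spectrum 1).2.2.1).ne'
  have s2 : lam 2 * wedgeLin (f' 1) (k' 1) (v 2) = wedgeLin (f' 1) (k' 1) (π.act (bdry 2) (v 2)) := by
    rw [N.map_v, map_smul, smul_eq_mul]
  have s3 : wedgeLin (f' 1) (k' 1) (v 3) =
      lam 3 * n 1 * wedgeLin (f' 1) (k' 1) (π.act (bdry 2) (v 3)) := by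
    have k1 : π.act (bdry 2) (-v 3 + y 3 • v 1 + z 3 • v 2) = (lam 3 * x 1)⁻¹ • v 3 :=
      N.map_opposite 3
    have k2 : π.act (bdry 1) (v 3) = x 1 • (-v 3 + y 3 • v 1 + z 3 • v 2) := N.map_next 3
    have k3 := w3 (v 3)
    rw [k2, map_smul, k1, map_smul, map_smul, smul_eq_mul, smul_eq_mul] at k3
    have := (N.x_pos 1).ne'
    have := (N.lam_pos 3).ne'
    field_simp at k3
    linarith
  replace a1 : wedgeLin (f' 1) (k' 1) (π.act (bdry 2) (v 2)) ≠ 0 := a1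
  replace b1 : wedgeLin (f' 1) (k' 1) (π.act (bdry 2) (v 3)) ≠ 0 := b1
  replace r1 : (n 1 + x 1) * wedgeLin (f' 1) (k' 1) (π.act (bdry 2) (v 3)) =
    x 1 * z 3 * wedgeLin (f' 1) (k' 1) (π.act (bdry 2) (v 2)) := r1
  obtain ⟨a2, b2, r2⟩ : wedgeLin (f 2) (k 2) (v 3) ≠ 0 ∧ wedgeLin (f 2) (k 2) (v 1) ≠ 0 ∧
    (n 2 + x 2) * wedgeLin (f 2) (k 2) (v 1) = x 2 * z 1 * wedgeLin (f 2) (k 2) (v 3) :=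
    N.plane (hf 2)
  obtain ⟨a3, b3, r3⟩ : wedgeLin (f 3) (k 3) (v 1) ≠ 0 ∧ wedgeLin (f 3) (k 3) (v 2) ≠ 0 ∧
    (n 3 + x 3) * wedgeLin (f 3) (k 3) (v 2) = x 3 * z 2 * wedgeLin (f 3) (k 3) (v 1) :=
    N.plane (hf 3)
  have p2 : wedgeLin (f 2) (k 2) (-v 1 + y 1 • v 2 + z 1 • v 3) =
    n 2 / x 2 * wedgeLin (f 2) (k 2) (v 1) := N.plane_next (i := 1) (hf 2)
  have p3 : wedgeLin (f 3) (k 3) (-v 1 + y 1 • v 2 + z 1 • v 3) =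
    m 3 / x 3 * wedgeLin (f 3) (k 3) (v 1) := N.plane_opposite (i := 1) (hf 3)
  have R : lam 3 * x 3 = lam 1 * x 2 := (N.relations 3).1
  replace e1 : f' 1 = c1 • (-v 1 + y 1 • v 2 + z 1 • v 3) := e1
  rw [tripleRatio, wedge_cyc (f 3) (f 2) (k 2), wedge_cyc (f' 1) (f 3) (k 3),
    wedge_cyc (f' 1) (f 2) (k 2)]
  change wedgeLin (f' 1) (k' 1) (f 3) / wedgeLin (f 2) (k 2) (f 3) *
    (wedgeLin (f 2) (k 2) (f' 1) / wedgeLin (f 3) (k 3) (f' 1)) *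
    (wedgeLin (f 3) (k 3) (f 2) / wedgeLin (f' 1) (k' 1) (f 2)) = _
  generalize wedgeLin (f' 1) (k' 1) = ψ₁ at *
  generalize wedgeLin (f 2) (k 2) = ψ₂ at *
  generalize wedgeLin (f 3) (k 3) = ψ₃ at *
  rw [e1, e2, e3]
  simp only [map_smul, smul_eq_mul]
  rw [p2, p3, s3]
  have x1 := N.x_pos 1
  have x2 := N.x_pos 2
  have x3 := N.x_pos 3
  have z1 := N.z_pos 1
  have z2 := N.z_pos 2
  have z3 := N.z_pos 3
  have l1 := N.lam_pos 1
  have l2 := N.lam_pos 2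
  have l3 := N.lam_pos 3
  have m1 := N.m_pos 1
  have m2 := N.m_pos 2
  have m3 := N.m_pos 3
  have n1 := N.n_pos 1
  have n2 := N.n_pos 2
  have n3 := N.n_pos 3
  have d1 := N.prod_eq_one 1
  have d2 := N.prod_eq_one 2
  have s2' : ψ₁ (v 2) = ψ₁ (π.act (bdry 2) (v 2)) / lam 2 := by
    field_simp
    linarith
  rw [s2']
  have q1 : ψ₁ (π.act (bdry 2) (v 3)) / ψ₁ (π.act (bdry 2) (v 2)) = z 3 / (1 + n 1 / x 1) := by
    field_simp; linarith
  have q2 : ψ₂ (v 1) / ψ₂ (v 3) = z 1 / (1 + n 2 / x 2) := by field_simp; linarith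
  have q3 : ψ₃ (v 2) / ψ₃ (v 1) = z 2 / (1 + n 3 / x 3) := by field_simp; linarith
  -- By `lam 3 * x 3 = lam 1 * x 2` the prefactor becomes `lam 1 * lam 2 * n 1 * n 2 / m 3`, which
  -- is `1 / (m 1 * m 2 * m 3)`. The three quotients are inverse to those for `T₊`.
  calc _ = (lam 2 * n 1 * n 2 / (m 3 * x 2)) * (lam 3 * x 3) *
        ((ψ₁ (π.act (bdry 2) (v 3)) / ψ₁ (π.act (bdry 2) (v 2))) * (ψ₂ (v 1) / ψ₂ (v 3)) *
          (ψ₃ (v 2) / ψ₃ (v 1))) := by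
        field_simp
    _ = (lam 1 * m 1 * n 1) * (lam 2 * m 2 * n 2) / (m 1 * m 2 * m 3) *
        ((z 3 / (1 + n 1 / x 1)) * (z 1 / (1 + n 2 / x 2)) * (z 2 / (1 + n 3 / x 3))) := by
        rw [q1, q2, q3, R]
        field_simp
    _ = _ := by
        rw [d1, d2]
        field_simp

end Flags

lemma exists_flags : (∃ f k : Fin 3 → V, ∀ i, SpansUnstableFlag (π.hol (bdry i)) (f i) (k i)) ∧
    ∃ f' k' : Fin 3 → V, ∀ i, SpansUnstableFlag (π.hol (bdry' i)) (f' i) (k' i) := by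
  have key : ∀ {M : SL(3, ℝ)} {l m n : ℝ}, HasSpectrum M l m n → ∃ f k, SpansUnstableFlag M f k := by
    intro M l m n h
    obtain ⟨r, u, w, ξ, η, ζ, E⟩ := h.exists_eigenBasis
    exact ⟨r, u, E.spansUnstableFlag⟩
  constructor
  · choose f k h using fun i => key (N.spectrum i)
    exact ⟨f, k, h⟩
  · choose f k h using fun i => key (N.spectrum' i)
    exact ⟨f, k, h⟩

/-- The exponentials of the Fock-Goncharov coordinates in terms of the normal form. -/
lemma isFockGoncharov_iff {σ₁ σ₂ : Fin 3 → ℝ} {τp τm : ℝ} : IsFockGoncharov π σ₁ σ₂ τp τm ↔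
    (∀ i, σ₁ i = Real.log (m (i + 2) / x (i + 2))) ∧ (∀ i, σ₂ i = Real.log (x (i + 1) / n (i + 1))) ∧
    τp = Real.log ((1 + n 1 / x 1) * (1 + n 2 / x 2) * (1 + n 3 / x 3) / (z 1 * z 2 * z 3)) ∧
    τm = Real.log (z 1 * z 2 * z 3 /
      (m 1 * m 2 * m 3 * ((1 + n 1 / x 1) * (1 + n 2 / x 2) * (1 + n 3 / x 3)))) := by
  constructor
  · intro h
    -- The defining condition quantifies over all representatives, so one choice must exist before
    -- it yields values.
    obtain ⟨⟨f, k, hf⟩, f', k', hf'⟩ := N.exists_flags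
    obtain ⟨h1, h2, h3, h4⟩ := h f k f' k' hf hf'
    rw [N.tripleRatio_eq hf] at h3
    rw [N.tripleRatio_eq' hf hf'] at h4
    refine ⟨fun i => ?_, fun i => ?_, h3.2, h4.2⟩
    · rw [(h1 i).2, N.doubleRatio₁_eq hf hf']
    · rw [(h2 i).2, N.doubleRatio₂_eq hf hf']
  · rintro ⟨h1, h2, h3, h4⟩ f k f' k' hf hf'
    have hx := N.x_pos
    have hm := N.m_pos
    have hn := N.n_pos
    have hz := N.z_pos
    have hX : 0 < (1 + n 1 / x 1) * (1 + n 2 / x 2) * (1 + n 3 / x 3) := by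
      have := div_pos (hn 1) (hx 1)
      have := div_pos (hn 2) (hx 2)
      have := div_pos (hn 3) (hx 3)
      positivity
    have hZ : 0 < z 1 * z 2 * z 3 := mul_pos (mul_pos (hz 1) (hz 2)) (hz 3)
    have hM : 0 < m 1 * m 2 * m 3 := mul_pos (mul_pos (hm 1) (hm 2)) (hm 3)
    rw [N.tripleRatio_eq hf, N.tripleRatio_eq' hf hf']
    refine ⟨fun i => ?_, fun i => ?_, ⟨div_pos hX hZ, h3⟩, div_pos hZ (mul_pos hM hX), h4⟩
    · rw [N.doubleRatio₁_eq hf hf']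
      exact ⟨div_pos (hm _) (hx _), h1 i⟩
    · rw [N.doubleRatio₂_eq hf hf']
      exact ⟨div_pos (hx _) (hn _), h2 i⟩

end NormalForm

/-- The quadratic equations determine the positive parameter. -/
lemma quadratic_injective {a b p q : ℝ} (ha : 0 ≤ a) (hb : 0 < b) (hp : 0 < p) (hq : 0 < q)
    (h : 1 + a * p + p ^ 2 / b = 1 + a * q + q ^ 2 / b) : p = q := by
  have h1 : (p - q) * (a * b + p + q) = 0 := by
    field_simp at h
    linarith
  exact sub_eq_zero.1 ((mul_eq_zero.1 h1).resolve_right (by positivity))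

/-! ### The common parameter `s` and the middle eigenvalue. -/

namespace NormalForm

variable {lam m n : Fin 3 → ℝ} {v : Fin 3 → V} {x y z : Fin 3 → ℝ}
  (N : NormalForm π lam m n v x y z)
include N

lemma x_next (i : Fin 3) : lam (i + 1) * x (i + 1) = lam (i + 2) * x i := by
  have h1 := (N.relations i).1
  have h2 := (N.relations (i + 2)).1
  rw [fin_add_two_one, fin_add_two_two] at h2
  have h3 := N.lam_pos i
  refine mul_left_cancel₀ h3.ne' ?_
  calc lam i * (lam (i + 1) * x (i + 1)) = lam (i + 1) * (lam i * x (i + 1)) := by ring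
    _ = lam (i + 2) * (lam (i + 1) * x (i + 2)) := by rw [← h2]; ring
    _ = lam i * (lam (i + 2) * x i) := by rw [← h1]; ring

/-- This invariance under rotation of the indices is why one `s` serves all three of Goldman's
equations. -/
lemma x_mul_sqrt_next (i : Fin 3) : x (i + 1) * √(lam (i + 1) * lam i / lam (i + 2)) =
    x i * √(lam i * lam (i + 2) / lam (i + 1)) := by
  have h0 := N.lam_pos i
  have h1 := N.lam_pos (i + 1)
  have h2 := N.lam_pos (i + 2)
  have hx := N.x_pos i
  have hx1 := N.x_pos (i + 1)
  have h := N.x_next i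
  rw [← sq_eq_sq₀ (by positivity) (by positivity), mul_pow, mul_pow, Real.sq_sqrt (by positivity),
    Real.sq_sqrt (by positivity)]
  have e : x (i + 1) = lam (i + 2) * x i / lam (i + 1) := by
    field_simp
    linarith
  rw [e]
  field_simp

/-- The parameter `s` is determined by any of the three equations. -/
lemma exists_s : ∃ s : ℝ, 0 < s ∧
    ∀ i, s * √(lam i * lam (i + 2) / lam (i + 1)) = (x i)⁻¹ := by
  have hg : ∀ i, 0 < √(lam i * lam (i + 2) / lam (i + 1)) := fun i =>
    Real.sqrt_pos.2 (div_pos (mul_pos (N.lam_pos _) (N.lam_pos _)) (N.lam_pos _))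
  have h : ∀ i, x (i + 1) * √(lam (i + 1) * lam (i + 1 + 2) / lam (i + 1 + 1)) =
      x i * √(lam i * lam (i + 2) / lam (i + 1)) := fun i => by
    rw [fin_add_one_one, fin_add_one_two]
    exact N.x_mul_sqrt_next i
  set g : Fin 3 → ℝ := fun i => √(lam i * lam (i + 2) / lam (i + 1)) with hgdef
  have h' : ∀ i, x (i + 1) * g (i + 1) = x i * g i := h
  have hall : ∀ i, x i * g i = x 0 * g 0 := by
    have e1 : x 1 * g 1 = x 0 * g 0 := h' 0
    have e2 : x 2 * g 2 = x 1 * g 1 := h' 1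
    intro i
    fin_cases i
    · rfl
    · exact e1
    · exact e2.trans e1
  refine ⟨(x 0 * g 0)⁻¹, inv_pos.2 (mul_pos (N.x_pos 0) (hg 0)), fun i => ?_⟩
  change _ * g i = _
  rw [← hall i]
  have := (hg i).ne'
  have := (N.x_pos i).ne'
  change g i ≠ 0 at *
  field_simp

lemma quadratic_eq {s : ℝ} {i : Fin 3} (h : s * √(lam i * lam (i + 2) / lam (i + 1)) = (x i)⁻¹) :
    z (i + 2) * y (i + 1) = 1 + (m i + n i) * √(lam i * lam (i + 2) / lam (i + 1)) * s +
      lam (i + 2) / lam (i + 1) * s ^ 2 := by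
  rw [(N.relations i).2, ← h, mul_pow, Real.sq_sqrt
    (div_pos (mul_pos (N.lam_pos _) (N.lam_pos _)) (N.lam_pos _)).le]
  have h0 := (N.lam_pos i).ne'
  have h1 := (N.lam_pos (i + 1)).ne'
  field_simp

lemma s_unique {s : ℝ} (hs : 0 < s) {i : Fin 3}
    (h : z (i + 2) * y (i + 1) = 1 + (m i + n i) * √(lam i * lam (i + 2) / lam (i + 1)) * s +
      lam (i + 2) / lam (i + 1) * s ^ 2) :
    s * √(lam i * lam (i + 2) / lam (i + 1)) = (x i)⁻¹ := by
  have h0 := N.lam_pos i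
  have h1 := N.lam_pos (i + 1)
  have h2 := N.lam_pos (i + 2)
  have hg : 0 < √(lam i * lam (i + 2) / lam (i + 1)) := Real.sqrt_pos.2 (by positivity)
  refine quadratic_injective (a := m i + n i) (b := lam i) (add_pos (N.m_pos i) (N.n_pos i)).le h0
    (mul_pos hs hg) (inv_pos.2 (N.x_pos i)) ?_
  rw [← (N.relations i).2, h, mul_pow, Real.sq_sqrt (by positivity)]
  field_simp

/-- Since `1 / lam i = m i * n i`, the discriminant is `(n i - m i) ^ 2`, and `m i < n i` selects
the root. -/
lemma mu_eq (i : Fin 3) : (m i + n i - √((m i + n i) ^ 2 - 4 / lam i)) / 2 = m i := by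
  have h0 := N.lam_pos i
  have h1 := N.prod_eq_one i
  have h2 := (N.spectrum i).2.2.1
  have : (m i + n i) ^ 2 - 4 / lam i = (n i - m i) ^ 2 := by
    have h3 : 1 / lam i = m i * n i := by
      field_simp
      linarith
    have h4 : 4 / lam i = 4 * (1 / lam i) := by ring
    rw [h4, h3]
    ring
  rw [this, Real.sqrt_sq (sub_nonneg.2 h2.le)]
  ring

end NormalForm

end Pants

/-! ### Goldman parameters in the normal form and the change of coordinates. -/

namespace Pants

variable {π : ConvexProjectiveStructure}

lemma NormalForm.isGoldman {lam m n : Fin 3 → ℝ} {v : Fin 3 → V} {x y z : Fin 3 → ℝ}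
    (N : NormalForm π lam m n v x y z) :
    ∃ s, IsGoldman π lam (fun i => m i + n i) s (z 2 * z 3 / y 3) := by
  obtain ⟨s, hs, h⟩ := N.exists_s
  have v1 : -v 1 + y 1 • v 2 + z 1 • v 3 ∈ eigenspace (π.hol (bdry' 1)) (lam 1) := N.vertex_mem 1
  have v2 : -v 2 + y 2 • v 3 + z 2 • v 1 ∈ eigenspace (π.hol (bdry' 2)) (lam 2) := N.vertex_mem 2
  have v3 : -v 3 + y 3 • v 1 + z 3 • v 2 ∈ eigenspace (π.hol (bdry' 3)) (lam 3) := N.vertex_mem 3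
  refine ⟨s, fun i => ⟨m i, n i, N.spectrum i, rfl⟩, hs, v, y 1, z 1, z 2, y 2, y 3, z 3, ?_,
    fun i => Module.End.mem_eigenspace_iff.2 (N.map_v i),
    ⟨N.y_pos 1, N.z_pos 1, N.z_pos 2, N.y_pos 2, N.y_pos 3, N.z_pos 3⟩, v1, ?_, ?_, rfl,
    N.quadratic_eq (h 1), ?_, ?_⟩
  · have h0 : v = ![v 0, v (0 + 1), v (0 + 2)] := by
      funext i
      fin_cases i <;> rfl
    rw [h0]
    exact N.li 0
  · convert v2 using 1
    module
  · convert v3 using 1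
    module
  · have h2 : z 1 * y 3 = 1 + (m 2 + n 2) * √(lam 2 * lam 1 / lam 3) * s + lam 1 / lam 3 * s ^ 2 :=
      N.quadratic_eq (h 2)
    rw [mul_comm (lam 1) (lam 2), mul_comm (y 3), h2]
  · have h3 : z 2 * y 1 = 1 + (m 3 + n 3) * √(lam 3 * lam 2 / lam 1) * s + lam 2 / lam 1 * s ^ 2 :=
      N.quadratic_eq (h 3)
    rw [mul_comm (lam 2) (lam 3), h3]

lemma IsGoldman.exists_normalForm {lam tau : Fin 3 → ℝ} {s t : ℝ} (G : IsGoldman π lam tau s t) :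
    ∃ m n v x y z, NormalForm π lam m n v x y z ∧ (∀ i, tau i = m i + n i) ∧ 0 < s ∧
      t = z 2 * z 3 / y 3 ∧ ∀ i, s * √(lam i * lam (i + 2) / lam (i + 1)) = (x i)⁻¹ := by
  obtain ⟨hs, s_pos, v, b₁, c₁, a₂, c₂, a₃, b₃, hli, hv, ⟨hb₁, hc₁, ha₂, hc₂, ha₃, hb₃⟩, h1, h2, h3,
    ht, q1, q2, q3⟩ := G
  choose m n hs htau using hs
  -- Vectors over `Fin 3` start at index `0`, which stands for `3`. Cyclically, `y` is the
  -- coefficient of the next vertex and `z` that of the one after.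
  obtain ⟨x, N⟩ := NormalForm.of_eigenvectors (y := ![a₃, b₁, c₂]) (z := ![b₃, c₁, a₂]) hs hv
    (fun i => hli.ne_zero i) (fun i => by
      fin_cases i
      · change -v 3 + a₃ • v 1 + b₃ • v 2 ∈ eigenspace (π.hol (bdry' 3)) (lam 3)
        convert h3 using 1
        module
      · exact h1
      · change -v 2 + c₂ • v 3 + a₂ • v 1 ∈ eigenspace (π.hol (bdry' 2)) (lam 2)
        convert h2 using 1
        module)
    (fun i => by fin_cases i <;> assumption) (fun i => by fin_cases i <;> assumption)
  refine ⟨m, n, v, x, _, _, N, htau, s_pos, ht, fun i => N.s_unique s_pos ?_⟩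
  rw [← htau]
  fin_cases i
  · change a₂ * b₁ = 1 + tau 3 * √(lam 3 * lam 2 / lam 1) * s + lam 2 / lam 1 * s ^ 2
    rw [mul_comm (lam 3), q3]
  · exact q1
  · change c₁ * a₃ = 1 + tau 2 * √(lam 2 * lam 1 / lam 3) * s + lam 1 / lam 3 * s ^ 2
    rw [mul_comm c₁, mul_comm (lam 2), q2]

end Pants

end

theorem proposition3 (π : Pants.ConvexProjectiveStructure) :
    (∃ (lam tau : Fin 3 → ℝ) (s t : ℝ), Pants.IsGoldman π lam tau s t) ∧
    (∃ (σ₁ σ₂ : Fin 3 → ℝ) (τp τm : ℝ), Pants.IsFockGoncharov π σ₁ σ₂ τp τm) ∧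
    ∀ (lam tau μ : Fin 3 → ℝ) (s t : ℝ) (σ₁ σ₂ : Fin 3 → ℝ) (τp τm : ℝ),
      Pants.IsGoldman π lam tau s t →
      Pants.IsFockGoncharov π σ₁ σ₂ τp τm →
      (∀ i, μ i = (tau i - √(tau i ^ 2 - 4 / lam i)) / 2) →
      (∀ i, σ₁ i = Real.log (s * μ (i - 1) * √(lam (i - 1) * lam (i + 1) / lam i))) ∧
      (∀ i, σ₂ i = Real.log (μ (i + 1) / s * √(lam (i - 1) * lam (i + 1) / lam i))) ∧
      τp = Real.log ((Real.exp (-σ₂ 2) + 1) * (Real.exp (-σ₂ 3) + 1) /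
        (t * (Real.exp (σ₁ 3) + 1))) ∧
      τm = Real.log (t * (Real.exp (σ₁ 3) + 1) /
        (μ 1 * μ 2 * μ 3 * ((Real.exp (-σ₂ 2) + 1) * (Real.exp (-σ₂ 3) + 1)))) := by
  obtain ⟨lam, m, n, v, x, y, z, N⟩ := Pants.exists_normalForm π
  obtain ⟨s, hG⟩ := N.isGoldman
  refine ⟨⟨_, _, _, _, hG⟩, ⟨_, _, _, _,
    N.isFockGoncharov_iff.2 ⟨fun _ => rfl, fun _ => rfl, rfl, rfl⟩⟩, ?_⟩
  clear N hG lam m n v x y z s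
  intro lam tau μ s t σ₁ σ₂ τp τm G FG hμ
  obtain ⟨m, n, v, x, y, z, N, htau, hs, ht, hsx⟩ := G.exists_normalForm
  obtain ⟨h1, h2, h3, h4⟩ := N.isFockGoncharov_iff.1 FG
  have hμm : μ = m := by
    funext i
    rw [hμ, htau, N.mu_eq]
  subst hμm
  have hx := N.x_pos
  have hn := N.n_pos
  have hm := N.m_pos
  have hl := N.lam_pos
  have e2 : Real.exp (-σ₂ 2) = n 3 / x 3 := by
    have : σ₂ 2 = Real.log (x 3 / n 3) := h2 2
    rw [Real.exp_neg, this, Real.exp_log (div_pos (hx 3) (hn 3)), inv_div]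
  have e3 : Real.exp (-σ₂ 3) = n 1 / x 1 := by
    have : σ₂ 3 = Real.log (x 1 / n 1) := h2 3
    rw [Real.exp_neg, this, Real.exp_log (div_pos (hx 1) (hn 1)), inv_div]
  have e1 : Real.exp (σ₁ 3) = μ 2 / x 2 := by
    have : σ₁ 3 = Real.log (μ 2 / x 2) := h1 3
    rw [this, Real.exp_log (div_pos (hm 2) (hx 2))]
  have hy3 := N.y_pos 3
  have hz1 := N.z_pos 1
  have hz2 := N.z_pos 2
  have hz3 := N.z_pos 3
  have x1 := hx 1
  have x2 := hx 2
  have x3 := hx 3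
  have n1 := hn 1
  have n2 := hn 2
  have n3 := hn 3
  have m1 := hm 1
  have m2 := hm 2
  have m3 := hm 3
  -- With `1 / lam 2 = μ 2 * n 2` Goldman's quadratic for `i = 2` factors. This removes `n 2` from
  -- the triple ratio and introduces `y 3`, the denominator of `t`.
  have hquad : (1 + n 2 / x 2) * (1 + μ 2 / x 2) = z 1 * y 3 := by
    have h5 : z 1 * y 3 = 1 + (μ 2 + n 2) * (x 2)⁻¹ + (x 2)⁻¹ ^ 2 / lam 2 := (N.relations 2).2
    have h6 := N.prod_eq_one 2
    have h7 : 1 / lam 2 = μ 2 * n 2 := by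
      have := hl 2
      field_simp
      linarith
    rw [h5, div_eq_mul_one_div _ (lam 2), h7]
    field_simp
    ring
  have hXp : (1 + n 1 / x 1) * (1 + n 2 / x 2) * (1 + n 3 / x 3) / (z 1 * z 2 * z 3) =
      (n 3 / x 3 + 1) * (n 1 / x 1 + 1) / (t * (μ 2 / x 2 + 1)) := by
    have hpos : 0 < 1 + μ 2 / x 2 := by positivity
    have h8 : 1 + n 2 / x 2 = z 1 * y 3 / (1 + μ 2 / x 2) := by
      rw [← hquad]
      field_simp
    rw [h8, ht, add_comm (μ 2 / x 2) 1]
    generalize 1 + μ 2 / x 2 = p at hpos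
    field_simp
    ring
  have hg : ∀ i, 0 < √(lam i * lam (i + 2) / lam (i + 1)) := fun i =>
    Real.sqrt_pos.2 (div_pos (mul_pos (hl _) (hl _)) (hl _))
  refine ⟨fun i => ?_, fun i => ?_, ?_, ?_⟩
  · have h5 := hsx (i + 2)
    rw [Pants.fin_add_two_one, Pants.fin_add_two_two] at h5
    rw [h1, Pants.fin_sub_one, mul_right_comm, h5]
    congr 1
    rw [mul_comm, div_eq_mul_inv]
  · have h5 := hsx (i + 1)
    have h7 := hg (i + 1)
    rw [Pants.fin_add_one_one, Pants.fin_add_one_two] at h5 h7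
    rw [h2, Pants.fin_sub_one]
    congr 1
    have hl0 := hl i
    have hl1 := hl (i + 1)
    have hl2 := hl (i + 2)
    -- The two roots come from the stated formula and from `s⁻¹`. The resulting factor `lam (i + 1)`
    -- turns `μ` into `1 / n`, since the eigenvalues have product `1`.
    have h6 : √(lam (i + 2) * lam (i + 1) / lam i) * √(lam (i + 1) * lam i / lam (i + 2)) =
        lam (i + 1) := by
      rw [← Real.sqrt_mul (by positivity)]
      have : lam (i + 2) * lam (i + 1) / lam i * (lam (i + 1) * lam i / lam (i + 2)) =
          lam (i + 1) ^ 2 := by field_simp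
      rw [this, Real.sqrt_sq hl1.le]
    have h8 : s⁻¹ = x (i + 1) * √(lam (i + 1) * lam i / lam (i + 2)) := by
      have := hx (i + 1)
      field_simp
      field_simp at h5
      linarith
    have h9 := N.prod_eq_one (i + 1)
    have hn1 := hn (i + 1)
    rw [div_eq_mul_inv (μ (i + 1)), h8]
    have h10 : μ (i + 1) * (x (i + 1) * √(lam (i + 1) * lam i / lam (i + 2))) *
        √(lam (i + 2) * lam (i + 1) / lam i) = μ (i + 1) * x (i + 1) * lam (i + 1) := by
      conv_rhs => rw [← h6]
      ring
    rw [h10, div_eq_iff hn1.ne']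
    calc x (i + 1) = (lam (i + 1) * μ (i + 1) * n (i + 1)) * x (i + 1) := by rw [h9, one_mul]
      _ = _ := by ring
  · rw [h3, e1, e2, e3, hXp]
  · rw [h4, e1, e2, e3]
    congr 1
    -- Apart from `μ 1 * μ 2 * μ 3`, the ratio for `T₋` is the inverse of that for `T₊`, so the same
    -- identity applies after inversion.
    rw [← inv_inj, inv_div, inv_div, mul_div_assoc, hXp, ← mul_div_assoc]
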